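/- **Setting.** Let $\alpha,\beta\ge 0$. Let $S^i=\tfrac12\sigma^i$ ($\sigma^i$ the Pauli matrices), $S^\pm=S^1\pm\mathrm iS^2$, $D^\pm=\nabla_1\pm\mathrm i\nabla_2$ (distributional derivatives), and let $h$ be the self-adjoint operator in $L^2(\mathbb R^3)\otimes\mathbb C^2$ with domain $H^2(\mathbb R^3)\otimes\mathbb C^2$, $$h=-\Delta+\alpha\,(D^-\otimes S^+-D^+\otimes S^-)+2\beta\,(1\otimes S^3).$$ Let $H=h\otimes 1+1\otimes h$ (the closure of the operator defined on the algebraic tensor product $\operatorname{dom}h\odot\operatorname{dom}h$), an operator in $L^2(\mathbb R^3\times\mathbb R^3)\otimes(\mathbb C^2\otimes\mathbb C^2)$. Let $\mathcal S=\{(1,1),(1,0),(1,-1),(0,0)\}$, and let $|\sigma\rangle$, $\sigma=(S,s)\in\mathcal S$, be the orthonormal basis of $\mathbb C^2\otimes\mathbb C^2\cong\mathbb C^3\oplus\mathbb C^1$ given by the Clebsch–Gordan coefficients $\langle\tfrac12 s_1\,\tfrac12 s_2|S s\rangle$. Let $K(x_1,x_2)=(x,X)=(x_1-x_2,\tfrac12(x_1+x_2))$,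 let $T$ be one of the two volume-preserving maps $K^{-1}$ (so that functions of $(x_1,x_2)$ are rewritten as functions of the centre-of-mass coordinates $Q=(x,X)$) and $K$, and let $L$ be the unitary map $$(LF)_\sigma(Q)=\sum_{s_1,s_2}\langle\tfrac12 s_1\,\tfrac12 s_2|S s\rangle\,F_{s_1s_2}(TQ)$$ onto $\mathcal H_0=L^2(\mathbb R^6)\otimes(\mathbb C^3\oplus\mathbb C^1)$. Put $H^c=LHL^*$, $\operatorname{dom}H^c=L\operatorname{dom}H$. (The statement below holds for either choice of $T$.) For $n\in\mathbb N$ let $\mathcal H_n=\mathcal H_n(H^c)=\operatorname{dom}(|H^c|+1)^{n/2}$ with the norm $\|(|H^c|+1)^{n/2}f\|$, and let $\mathcal H_{-n}$ be its dual with respect to the inner product of $\mathcal H_0$: a functional $\psi$ on the test functions $C_0^\infty(\mathbb R^6)\otimes(\mathbb C^3\oplus\mathbb C^1)$ belongs to $\mathcal H_{-n}$ if there is $\eta\in\mathcal H_0$ with $\psi(f)=\langle\eta,(|H^c|+1)^{n/2}f\rangle$ for all test functions $f$. For $\psi\in\mathcal H_{-4}$, $((\mathbb H^c)^2+1)^{-1}\psi$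 denotes the element $\eta\in\mathcal H_0$ with $\psi(f)=\langle\eta,((H^c)^2+1)f\rangle$ for all test functions $f$. For $\sigma\in\mathcal S$, $X\in\mathbb R^3$ and $N_\sigma>0$ let $\psi_\sigma$ be the point interaction concentrated at $Q_0=(0,X)$, $\langle\psi_\sigma,f\rangle=N_\sigma f_\sigma(Q_0)$ for $f=\sum_\sigma f_\sigma\otimes|\sigma\rangle$. **Theorem.** (1) For all $\alpha,\beta\ge0$, $\sigma\in\mathcal S$, $X\in\mathbb R^3$ and $N_\sigma>0$ one has $\psi_\sigma\in\mathcal H_{-4}(H^c)\smallsetminus\mathcal H_{-3}(H^c)$. (2) For all $\alpha,\beta\ge0$ and $\sigma\in\mathcal S$ there is exactly one $N_\sigma=N_\sigma(\alpha,\beta)>0$, the same for all $X$, for which $((\mathbb H^c)^2+1)^{-1}\psi_\sigma$ is a unit vector of $\mathcal H_0$. For every fixed $\beta>0$, with $\theta_\beta=\arg(2\beta+\mathrm i)$ (principal value) and Kronecker symbols $\delta$, as $\alpha\searrow0$ (and $\alpha\geq 0$), $$\begin{aligned} N_\sigma^{-2}={}&\frac{1}{512\pi^3}\Bigl(\delta_{s0}\pi+2\delta_{S1}\bigl[\delta_{s1}(-2\beta+\theta_\beta(1+4\beta^2))+\delta_{s,-1}(2\beta+(\pi-\theta_\beta)(1+4\beta^2))\bigr]\Bigr)\\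 &+\frac{\alpha^2}{1536\pi^3\beta^2}\Bigl(\tfrac14\delta_{s0}\bigl(2\beta[\pi(5+4\beta^2)-11\theta_\beta+4\beta(2-3\beta\theta_\beta)]-4\log(1+4\beta^2)\\ &\qquad+\beta\sqrt{1+4\beta^2}\,[(4\beta(\pi-\theta_\beta)-\log(1+4\beta^2))\cos\theta_\beta+2(\pi-\theta_\beta+\beta\log(1+4\beta^2))\sin\theta_\beta]\bigr)\\ &\qquad+\delta_{S1}\bigl[\delta_{s1}(8\beta^2(1-2\beta\theta_\beta)+\log(1+4\beta^2))+\delta_{s,-1}(8\beta^2(1+2\beta(\pi-\theta_\beta))+\log(1+4\beta^2))\bigr]\Bigr)+O(\alpha^4). \end{aligned}$$ For $\beta=0$ both coefficients (of $\alpha^0$ and of $\alpha^2$) have finite limits as $\beta\searrow0$, and the same expansion holds with these limits as coefficients. -/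

import Mathlib

open MeasureTheory Filter Topology
open scoped SchwartzMap LineDeriv Laplacian Distributions

namespace Rashba

noncomputable section

/-! ### One-particle operator -/

/-- Position space `ℝ³`. -/
abbrev E3 : Type := EuclideanSpace ℝ (Fin 3)

/-- The spin space `ℂ²`; index `0` is `|½⟩`, index `1` is `|-½⟩`. -/
abbrev C2 : Type := EuclideanSpace ℂ (Fin 2)

/-- The one-particle space `L²(ℝ³) ⊗ ℂ² = L²(ℝ³; ℂ²)`. -/
abbrev OneParticle : Type := Lp C2 2 (volume : Measure E3)

/-- The spin operator `S¹ = σ¹ / 2`, with `σⁱ` the Pauli matrices. -/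
def S1 : Matrix (Fin 2) (Fin 2) ℂ := (1 / 2 : ℂ) • !![0, 1; 1, 0]

/-- `S² = σ² / 2`. -/
def S2 : Matrix (Fin 2) (Fin 2) ℂ := (1 / 2 : ℂ) • !![0, -Complex.I; Complex.I, 0]

/-- `S³ = σ³ / 2`. -/
def S3 : Matrix (Fin 2) (Fin 2) ℂ := (1 / 2 : ℂ) • !![1, 0; 0, -1]

/-- `S⁺ = S¹ + i S²`. -/
def Splus : Matrix (Fin 2) (Fin 2) ℂ := S1 + Complex.I • S2

/-- `S⁻ = S¹ - i S²`. -/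
def Sminus : Matrix (Fin 2) (Fin 2) ℂ := S1 - Complex.I • S2

/-- `1 ⊗ M` on `ℂ²`-valued tempered distributions. -/
def spinAct (M : Matrix (Fin 2) (Fin 2) ℂ) : 𝓢'(E3, C2) →L[ℂ] 𝓢'(E3, C2) :=
  PointwiseConvergenceCLM.postcomp 𝓢(E3, ℂ) (Matrix.toEuclideanCLM (𝕜 := ℂ) M)

/-- The distributional partial derivative `∇ᵢ`. -/
def partialD (i : Fin 3) : 𝓢'(E3, C2) →L[ℂ] 𝓢'(E3, C2) :=
  LineDeriv.lineDerivOpCLM ℂ 𝓢'(E3, C2) (EuclideanSpace.single i (1 : ℝ) : E3)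

/-- `D⁺ = ∇₁ + i ∇₂`. -/
def Dplus : 𝓢'(E3, C2) →L[ℂ] 𝓢'(E3, C2) := partialD 0 + Complex.I • partialD 1

/-- `D⁻ = ∇₁ - i ∇₂`. -/
def Dminus : 𝓢'(E3, C2) →L[ℂ] 𝓢'(E3, C2) := partialD 0 - Complex.I • partialD 1

/-- The differential expression
`-Δ + α (D⁻ ⊗ S⁺ - D⁺ ⊗ S⁻) + β (2 · 1 ⊗ S³)` on tempered distributions. -/
def rashbaExpr (α β : ℝ) : 𝓢'(E3, C2) →L[ℂ] 𝓢'(E3, C2) :=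
  -LineDeriv.laplacianCLM ℂ E3 𝓢'(E3, C2)
    + (α : ℂ) • (spinAct Splus ∘L Dminus - spinAct Sminus ∘L Dplus)
    + (β : ℂ) • ((2 : ℂ) • spinAct S3)

/-- The graph of the one-particle operator: pairs `(u, f)` with `u ∈ H²(ℝ³) ⊗ ℂ²` and
`f = (-Δ + α Uˢᵒ + β Uᴮ) u`. -/
def rashbaGraph (α β : ℝ) : Submodule ℂ (OneParticle × OneParticle) where
  carrier := {p | TemperedDistribution.MemSobolev 2 2 (p.1 : 𝓢'(E3, C2)) ∧
    (p.2 : 𝓢'(E3, C2)) = rashbaExpr α β (p.1 : 𝓢'(E3, C2))}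
  add_mem' := by
    rintro ⟨a, b⟩ ⟨c, d⟩ ⟨h1, h2⟩ ⟨h3, h4⟩
    simp only [← Lp.toTemperedDistributionCLM_apply] at *
    simp only [Set.mem_ofPred_eq, Prod.mk_add_mk, map_add]
    exact ⟨h1.add h3, by rw [h2, h4]⟩
  zero_mem' := by
    simp only [← Lp.toTemperedDistributionCLM_apply, Set.mem_ofPred_eq, Prod.fst_zero,
      Prod.snd_zero, map_zero, and_true]
    exact TemperedDistribution.memSobolev_fun_zero E3 C2 2 2
  smul_mem' := by
    rintro c ⟨a, b⟩ ⟨h1, h2⟩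
    simp only [← Lp.toTemperedDistributionCLM_apply] at *
    simp only [Set.mem_ofPred_eq, Prod.smul_mk, map_smul]
    exact ⟨h1.smul c, by rw [h2]⟩

/-- The Rashba operator `h = -Δ + α Uˢᵒ + β Uᴮ` with domain `H²(ℝ³) ⊗ ℂ²`. -/
def h (α β : ℝ) : OneParticle →ₗ.[ℂ] OneParticle := (rashbaGraph α β).toLinearPMap

/-! ### Two-particle operator -/

/-- Configuration space `ℝ⁶ = ℝ³ × ℝ³` of two particles. -/
abbrev E6 : Type := WithLp 2 (E3 × E3)

/-- The spin space `ℂ² ⊗ ℂ²` of two particles. -/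
abbrev C4 : Type := EuclideanSpace ℂ (Fin 2 × Fin 2)

/-- The two-particle space, the Hilbert tensor square of the one-particle space, realized as
`L²(ℝ³ × ℝ³; ℂ² ⊗ ℂ²)`. -/
abbrev TwoParticle : Type := Lp C4 2 (volume : Measure E6)

/-- The function `(u ⊗ v)(x₁, x₂)_{s₁ s₂} = u(x₁)_{s₁} v(x₂)_{s₂}`. -/
def tensorFun (u v : E3 → C2) (q : E6) : C4 :=
  WithLp.toLp 2 fun s => u q.fst s.1 * v q.snd s.2

theorem norm_tensorFun (u v : E3 → C2) (q : E6) :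
    ‖tensorFun u v q‖ = ‖u q.fst‖ * ‖v q.snd‖ := by
  rw [EuclideanSpace.norm_eq, EuclideanSpace.norm_eq, EuclideanSpace.norm_eq,
    ← Real.sqrt_mul (by positivity)]
  congr 1
  rw [Finset.sum_mul_sum, Fintype.sum_prod_type]
  simp [tensorFun, mul_pow]

theorem memLp_tensorFun (u v : OneParticle) :
    MemLp (tensorFun u v) 2 (volume : Measure E6) := by
  have hm : MeasurePreserving (WithLp.ofLp : E6 → E3 × E3) := WithLp.volume_preserving_ofLp E3 E3
  have hu : AEStronglyMeasurable (fun q : E6 => u q.fst) volume :=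
    ((Lp.aestronglyMeasurable u).comp_fst (ν := (volume : Measure E3))).comp_measurePreserving hm
  have hv : AEStronglyMeasurable (fun q : E6 => v q.snd) volume :=
    ((Lp.aestronglyMeasurable v).comp_snd (μ := (volume : Measure E3))).comp_measurePreserving hm
  have hmeas : AEStronglyMeasurable (tensorFun u v) (volume : Measure E6) := by
    have hc : Continuous fun p : C2 × C2 =>
        (WithLp.toLp 2 fun s : Fin 2 × Fin 2 => p.1 s.1 * p.2 s.2 : C4) := by fun_prop
    exact hc.comp_aestronglyMeasurable (hu.prodMk hv)
  refine (memLp_two_iff_integrable_sq_norm hmeas).2 ?_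
  have h1 : Integrable (fun x => ‖u x‖ ^ 2) (volume : Measure E3) :=
    (memLp_two_iff_integrable_sq_norm (Lp.aestronglyMeasurable u)).1 (Lp.memLp u)
  have h2 : Integrable (fun x => ‖v x‖ ^ 2) (volume : Measure E3) :=
    (memLp_two_iff_integrable_sq_norm (Lp.aestronglyMeasurable v)).1 (Lp.memLp v)
  have h3 := hm.integrable_comp_of_integrable (h1.mul_prod h2)
  refine h3.congr (ae_of_all _ fun q => ?_)
  simp [norm_tensorFun, mul_pow]

/-- The elementary tensor `u ⊗ v`. -/
def tensor (u v : OneParticle) : TwoParticle := (memLp_tensorFun u v).toLp _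

/-- `A ⊙ 1 + 1 ⊙ A` on the linear span of the elementary tensors `u ⊗ v`, `u, v ∈ dom A`. -/
def algTensorSum (A : OneParticle →ₗ.[ℂ] OneParticle) : TwoParticle →ₗ.[ℂ] TwoParticle :=
  (Submodule.span ℂ {p : TwoParticle × TwoParticle | ∃ u v : A.domain,
    p = (tensor u v, tensor (A u) v + tensor u (A v))}).toLinearPMap

/-- The two-particle operator `H = h ⊗ 1 + 1 ⊗ h`, the closure of `h ⊙ 1 + 1 ⊙ h`. -/
def H (α β : ℝ) : TwoParticle →ₗ.[ℂ] TwoParticle := (algTensorSum (h α β)).closure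

/-! ### Centre-of-mass coordinates -/

/-- The index set `{(1,1), (1,0), (1,-1), (0,0)}` of pairs `(S, s)`, `S ∈ {0, 1}`,
`s ∈ {-S, …, S}`. -/
inductive Idx
  | triplet1
  | triplet0
  | tripletm1
  | singlet
  deriving DecidableEq

instance : Fintype Idx where
  elems := {.triplet1, .triplet0, .tripletm1, .singlet}
  complete x := by cases x <;> simp

/-- The total spin `S`. -/
def Idx.S : Idx → ℕ
  | triplet1 => 1
  | triplet0 => 1
  | tripletm1 => 1
  | singlet => 0

/-- The spin projection `s`. -/
def Idx.s : Idx → ℤ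
  | triplet1 => 1
  | triplet0 => 0
  | tripletm1 => -1
  | singlet => 0

/-- The spin space `ℂ³ ⊕ ℂ¹` with orthonormal basis `|S s⟩`. -/
abbrev CIdx : Type := EuclideanSpace ℂ Idx

/-- The Clebsch–Gordan coefficients `⟨½ s₁ ½ s₂ | S s⟩`. -/
def clebschGordan : Matrix Idx (Fin 2 × Fin 2) ℂ
  | .triplet1, (0, 0) => 1
  | .triplet0, (0, 1) => 1 / (Real.sqrt 2 : ℂ)
  | .triplet0, (1, 0) => 1 / (Real.sqrt 2 : ℂ)
  | .tripletm1, (1, 1) => 1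
  | .singlet, (0, 1) => 1 / (Real.sqrt 2 : ℂ)
  | .singlet, (1, 0) => -1 / (Real.sqrt 2 : ℂ)
  | _, _ => 0

/-- The identification `ℂ² ⊗ ℂ² → ℂ³ ⊕ ℂ¹`. -/
def spinCoupling : C4 →L[ℂ] CIdx :=
  LinearMap.toContinuousLinearMap (Matrix.toEuclideanLin clebschGordan)

/-- The space `L²(ℝ⁶) ⊗ (ℂ³ ⊕ ℂ¹)`. -/
abbrev Kc : Type := Lp CIdx 2 (volume : Measure E6)

/-- Volume preserving linear changes of variables of `ℝ⁶`. -/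
abbrev VolEquiv : Type :=
  {T : E6 ≃ₗ[ℝ] E6 // MeasurePreserving T volume volume}

/-- The centre-of-mass map `K : (x₁, x₂) ↦ (x, X) = (x₁ - x₂, (x₁ + x₂) / 2)`. -/
def comLin : E6 ≃ₗ[ℝ] E6 where
  toFun q := WithLp.toLp 2 (q.fst - q.snd, (1 / 2 : ℝ) • (q.fst + q.snd))
  invFun Q := WithLp.toLp 2 (Q.snd + (1 / 2 : ℝ) • Q.fst, Q.snd - (1 / 2 : ℝ) • Q.fst)
  map_add' p q := by
    apply WithLp.ofLp_injective
    ext i <;> simp <;> ring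
  map_smul' c q := by
    apply WithLp.ofLp_injective
    ext i <;> simp <;> ring
  left_inv q := by
    apply WithLp.ofLp_injective
    ext i <;> simp <;> ring
  right_inv q := by
    apply WithLp.ofLp_injective
    ext i <;> simp <;> ring

theorem measurePreserving_comLin : MeasurePreserving comLin volume volume := by
  have h1 : MeasurePreserving (fun p : E3 × E3 => (p.2, p.1 - p.2))
      (volume.prod volume) (volume.prod volume) := by
    have := (MeasurePreserving.id (volume : Measure E3)).skew_product
      (μc := (volume : Measure E3)) (μd := (volume : Measure E3))
      (g := fun a c => c - a) (by fun_prop)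
      (ae_of_all _ fun a => (measurePreserving_sub_right volume a).map_eq)
    exact this.comp Measure.measurePreserving_swap
  have h2 : MeasurePreserving (fun p : E3 × E3 => (p.2, p.1 + (1 / 2 : ℝ) • p.2))
      (volume.prod volume) (volume.prod volume) := by
    have := (MeasurePreserving.id (volume : Measure E3)).skew_product
      (μc := (volume : Measure E3)) (μd := (volume : Measure E3))
      (g := fun a c => c + (1 / 2 : ℝ) • a) (by fun_prop)
      (ae_of_all _ fun a => (measurePreserving_add_right volume ((1 / 2 : ℝ) • a)).map_eq)
    exact this.comp Measure.measurePreserving_swap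
  have h3 := (WithLp.volume_preserving_toLp E3 E3).comp
    ((h2.comp h1).comp (WithLp.volume_preserving_ofLp E3 E3))
  have h4 : (comLin : E6 → E6) = WithLp.toLp 2 ∘
      ((fun p : E3 × E3 => (p.2, p.1 + (1 / 2 : ℝ) • p.2)) ∘
        fun p : E3 × E3 => (p.2, p.1 - p.2)) ∘ WithLp.ofLp := by
    funext q
    apply WithLp.ofLp_injective
    ext i <;> simp [comLin] <;> ring
  rw [h4]
  exact h3

theorem measurePreserving_comLin_symm : MeasurePreserving comLin.symm volume volume := by
  have h1 : MeasurePreserving (fun p : E3 × E3 => (p.1, p.2 - (1 / 2 : ℝ) • p.1))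
      (volume.prod volume) (volume.prod volume) :=
    (MeasurePreserving.id (volume : Measure E3)).skew_product
      (μc := (volume : Measure E3)) (μd := (volume : Measure E3))
      (g := fun a c => c - (1 / 2 : ℝ) • a) (by fun_prop)
      (ae_of_all _ fun a => (measurePreserving_sub_right volume ((1 / 2 : ℝ) • a)).map_eq)
  have h2 : MeasurePreserving (fun p : E3 × E3 => (p.2, p.1 + p.2))
      (volume.prod volume) (volume.prod volume) := by
    have := (MeasurePreserving.id (volume : Measure E3)).skew_product
      (μc := (volume : Measure E3)) (μd := (volume : Measure E3))
      (g := fun a c => c + a) (by fun_prop)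
      (ae_of_all _ fun a => (measurePreserving_add_right volume a).map_eq)
    exact this.comp Measure.measurePreserving_swap
  have h3 := (WithLp.volume_preserving_toLp E3 E3).comp
    (((Measure.measurePreserving_swap.comp h2).comp h1).comp
      (WithLp.volume_preserving_ofLp E3 E3))
  have h4 : (comLin.symm : E6 → E6) = WithLp.toLp 2 ∘
      ((Prod.swap ∘ fun p : E3 × E3 => (p.2, p.1 + p.2)) ∘
        fun p : E3 × E3 => (p.1, p.2 - (1 / 2 : ℝ) • p.1)) ∘ WithLp.ofLp := by
    funext q
    apply WithLp.ofLp_injective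
    ext i <;> simp [comLin] <;> ring
  rw [h4]
  exact h3

/-- The centre-of-mass map `K` as a volume preserving change of variables. -/
def com : VolEquiv := ⟨comLin, measurePreserving_comLin⟩

/-- The inverse `K⁻¹ : (x, X) ↦ (X + x / 2, X - x / 2)` of the centre-of-mass map. -/
def comInv : VolEquiv := ⟨comLin.symm, measurePreserving_comLin_symm⟩

/-- The unitary substitution `F ↦ F ∘ T` on the two-particle space. -/
def substitution (T : VolEquiv) : TwoParticle →L[ℂ] TwoParticle :=
  (Lp.compMeasurePreservingₗᵢ ℂ T.1 T.2).toContinuousLinearMap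

/-- The unitary map `L`: substitution by `T` in the position variables and passage to the basis
`|S s⟩` in the spin variables. -/
def L (T : VolEquiv) : TwoParticle →L[ℂ] Kc :=
  spinCoupling.compLpL 2 volume ∘L substitution T

/-- `Hᶜ = L H L*`, `dom Hᶜ = L dom H`: the operator with graph `{(L F, L H F) | F ∈ dom H}`. -/
def Hc (T : VolEquiv) (α β : ℝ) : Kc →ₗ.[ℂ] Kc :=
  ((H α β).graph.map ((L T).toLinearMap.prodMap (L T).toLinearMap)).toLinearPMap

/-! ### The scale of a self-adjoint operator -/

section Scale

variable {𝓗 : Type*} [NormedAddCommGroup 𝓗] [InnerProductSpace ℂ 𝓗] [CompleteSpace 𝓗]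

/-- `B = (A² + 1)⁻¹`: for all `f`, `B f ∈ dom A²` and `A² B f + B f = f`. For a self-adjoint `A`
there is exactly one such bounded operator `B`. -/
def IsInvSqAddOne (A : 𝓗 →ₗ.[ℂ] 𝓗) (B : 𝓗 →L[ℂ] 𝓗) : Prop :=
  ∀ f, ∃ g, (B f, g) ∈ A.graph ∧ (g, f - B f) ∈ A.graph

open scoped Classical in
/-- The bounded operator `(A² + 1)⁻¹` for a self-adjoint operator `A`. -/
def invSqAddOne (A : 𝓗 →ₗ.[ℂ] 𝓗) : 𝓗 →L[ℂ] 𝓗 :=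
  if hB : ∃ B, IsInvSqAddOne A B then hB.choose else 0

/-- The bounded operator `(|A| + 1)^(-n/2)` for a self-adjoint operator `A`, through the continuous
functional calculus of `(A² + 1)⁻¹`: if `t = 1 / (λ² + 1)`, then
`√t / (√t + √(1 - t)) = 1 / (|λ| + 1)`. -/
def absAddOnePow (A : 𝓗 →ₗ.[ℂ] 𝓗) (n : ℕ) : 𝓗 →L[ℂ] 𝓗 :=
  cfc (fun t : ℝ => (Real.sqrt t / (Real.sqrt t + Real.sqrt (1 - t))) ^ ((n : ℝ) / 2))
    (invSqAddOne A)

variable {𝓓 : Type*}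

/-- Let `𝓓` be a space of test functions, embedded into `𝓗` by `ι`, let `ψ` be a functional on `𝓓`,
and let `B` be a bounded injective self-adjoint operator whose range contains the test functions.
`IsExtApply ι B ψ η` says that `η ∈ 𝓗` is the image of `ψ` under the extension of `B` by duality:
`ψ(φ) = ⟨η, B⁻¹ φ⟩` for all test functions `φ`. -/
def IsExtApply (ι : 𝓓 → 𝓗) (B : 𝓗 →L[ℂ] 𝓗) (ψ : 𝓓 → ℂ) (η : 𝓗) : Prop :=
  ∀ φ, ∃ g, B g = ι φ ∧ ψ φ = inner ℂ η g

/-- `ψ ∈ ℋ₋ₙ(A)`. Here `ℋₙ(A)` is the domain of `(|A| + 1)^(n/2)`, with the norm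
`‖f‖ₙ = ‖(|A| + 1)^(n/2) f‖`, and `ℋ₋ₙ(A)` is its dual with respect to the pairing of `𝓗`; so
`ψ ∈ ℋ₋ₙ(A)` means that there is `η = (|A| + 1)^(-n/2) ψ ∈ 𝓗` with
`ψ(φ) = ⟨η, (|A| + 1)^(n/2) φ⟩` for all test functions `φ`. -/
def MemNegScale (A : 𝓗 →ₗ.[ℂ] 𝓗) (ι : 𝓓 → 𝓗) (n : ℕ) (ψ : 𝓓 → ℂ) : Prop :=
  ∃ η, IsExtApply ι (absAddOnePow A n) ψ η

/-- `(A² + 1)⁻¹ ψ`, with `(A² + 1)⁻¹` extended by duality, is a unit vector of `𝓗`. -/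
def IsNormalized (A : 𝓗 →ₗ.[ℂ] 𝓗) (ι : 𝓓 → 𝓗) (ψ : 𝓓 → ℂ) : Prop :=
  ∃ η, IsExtApply ι (invSqAddOne A) ψ η ∧ ‖η‖ = 1

end Scale

/-! ### The point interaction -/

/-- Test functions `C₀^∞(ℝ⁶) ⊗ (ℂ³ ⊕ ℂ¹)`. -/
abbrev Test : Type := 𝓓((⊤ : TopologicalSpace.Opens E6), CIdx)

/-- The embedding of the test functions into `L²`. -/
def testToL2 (φ : Test) : Kc :=
  (φ.continuous.memLp_of_hasCompactSupport (p := 2) (μ := (volume : Measure E6))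
    φ.hasCompactSupport).toLp φ

/-- The distribution `ψ_σ` concentrated at `Q₀ = (0, X)`: `⟨ψ_σ, f⟩ = N f_σ(Q₀)`. -/
def psi (σ : Idx) (X : E3) (N : ℝ) (φ : Test) : ℂ :=
  (N : ℂ) * φ (WithLp.toLp 2 ((0 : E3), X)) σ

/-! ### The expansion of the normalization constant -/

/-- `θ_β = arg(2β + i)`. -/
def theta (β : ℝ) : ℝ := Complex.arg (2 * (β : ℂ) + Complex.I)

/-- The Kronecker symbol. -/
def kron {ι : Type*} [DecidableEq ι] (a b : ι) : ℝ := if a = b then 1 else 0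

/-- The coefficient of `α⁰` in `N_σ⁻²`. -/
def coeff0 (σ : Idx) (β : ℝ) : ℝ :=
  1 / (512 * Real.pi ^ 3) *
    (kron σ.s 0 * Real.pi
      + 2 * kron σ.S 1 *
        (kron σ.s 1 * (-2 * β + theta β * (1 + 4 * β ^ 2))
          + kron σ.s (-1) * (2 * β + (Real.pi - theta β) * (1 + 4 * β ^ 2))))

/-- The coefficient of `α²` in `N_σ⁻²`, for `β > 0`. -/
def coeff2 (σ : Idx) (β : ℝ) : ℝ :=
  1 / (1536 * Real.pi ^ 3 * β ^ 2) *
    (1 / 4 * kron σ.s 0 *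
        (2 * β * (Real.pi * (5 + 4 * β ^ 2) - 11 * theta β
            + 4 * β * (2 - 3 * β * theta β))
          - 4 * Real.log (1 + 4 * β ^ 2)
          + β * Real.sqrt (1 + 4 * β ^ 2) *
            ((4 * β * (Real.pi - theta β) - Real.log (1 + 4 * β ^ 2)) * Real.cos (theta β)
              + 2 * (Real.pi - theta β + β * Real.log (1 + 4 * β ^ 2)) * Real.sin (theta β)))
      + kron σ.S 1 *
        (kron σ.s 1 * (8 * β ^ 2 * (1 - 2 * β * theta β) + Real.log (1 + 4 * β ^ 2))
          + kron σ.s (-1) *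
            (8 * β ^ 2 * (1 + 2 * β * (Real.pi - theta β)) + Real.log (1 + 4 * β ^ 2))))

end

end Rashba

/-! ### Functional calculus of matrix-valued multiplication operators -/

open MeasureTheory Filter Topology
open scoped SchwartzMap LineDeriv Laplacian Distributions

namespace Rashba

noncomputable section

/-! ### Multiplication operators on vector-valued `L²` -/

section Multiplication

open scoped BoundedContinuousFunction ENNReal

variable {E V : Type*} [TopologicalSpace E] [SecondCountableTopology E] [MeasurableSpace E]
  [BorelSpace E] [NormedAddCommGroup V] [InnerProductSpace ℂ V] [CompleteSpace V] {μ : Measure E}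

/-! The Fourier transform turns `h` into multiplication by a Hermitian 2×2 matrix. Since `𝓕 (u ⊗ v)
= 𝓕 u ⊗ 𝓕 v`, it turns `H` into multiplication by a Hermitian 4×4 matrix `M(p) = kin p + α W(p) + β
Z` on `ℝ⁶`, with `W` linear in `p` and `Z` constant; `diagonalizer` carries `Hᶜ` to the same `M`.
The graph of `H` lies in the closed graph of this multiplication (`graph_H_le`) and is large enough
for `H² + 1` to reach all of `L²` (`coreSpace_eq_top`). Hence `((Hᶜ)² + 1)⁻¹` and `(|Hᶜ| +
1)^(-n/2)` act as the corresponding functions of the matrix `M(p)` (`invSqAddOne_Hc`,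
`absAddOnePow_Hc`).

In momentum space `ψ_σ` is a character of modulus one times `N |σ⟩` (`psi_eq_integral`), and a
function `G` of the operator sends it to `G(p) |σ⟩` times the same character
(`isExtApply_conj_iff`); uniqueness holds because Fourier transforms of test functions separate
functions (`ae_eq_zero_of_integral_fourier_mul_eq_zero`). The character, and with it `X`, disappears
from norms, so everything is decided by the integral of `‖G(p) |σ⟩‖²` over `ℝ⁶`. As `α W + β Z` is
`O(√(1 + kin))`, the matrix `|M| + 1` is comparable to `1 + ‖p‖²`. Its power `-n` is integrable in
dimension 6 for `n = 4` and not for `n = 3`, which is the first claim. For the second, `N⁻²` is the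
integral `normSq` of `‖(M² + 1)⁻¹ |σ⟩‖²`.

The matrix at `α = 0` preserves the span of `↑↑, ↓↓` and the span of `↑↓, ↓↑`, while `W` exchanges
them. Thus the terms of order `α` and `α³` vanish, and the remainder of the resolvent expansion is
at most a constant times `α⁴ (1 + kin)⁻⁴`, which is integrable (`exists_abs_norm_resSq_sq_sub_le`).
For the second order, `|σ⟩` is an eigenvector at `α = 0` with eigenvalue `a`, and `W |σ⟩` is a sum
of orthogonal eigenvectors `w₁, w₂` with eigenvalues `b₁, b₂`. With `f(t) = (1 + t²)⁻²` the
coefficient is the sum of `‖wᵢ‖²` times the second divided difference of `f` at `a, a, bᵢ`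
(`norm_sq_pertOne_add_inner_pertTwo`). Each `‖wᵢ‖²` is a quadratic form in `p`; averaging over
spheres replaces it by a multiple of `kin`, and `u = kin p` leaves one-dimensional integrals with
elementary antiderivatives. For `β = 0` the divided difference becomes `f''/2`, and the integral
agrees with the limit of the coefficients. -/

/-- A bounded continuous operator-valued function as an element of `L^∞`. -/
def opToLp (μ : Measure E) (g : E →ᵇ (V →L[ℂ] V)) : Lp (V →L[ℂ] V) ∞ μ :=
  (memLp_top_of_bound (μ := μ) (g.continuous.stronglyMeasurable.aestronglyMeasurable) ‖g‖
    (ae_of_all _ g.norm_coe_le_norm)).toLp g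

/-- Multiplication by a bounded continuous operator-valued function. -/
def mulOp (μ : Measure E) (g : E →ᵇ (V →L[ℂ] V)) : Lp V 2 μ →L[ℂ] Lp V 2 μ :=
  (ContinuousLinearMap.id ℂ (V →L[ℂ] V)).holderL μ ∞ 2 2 (opToLp μ g)

theorem mulOp_ae (g : E →ᵇ (V →L[ℂ] V)) (f : Lp V 2 μ) :
    mulOp μ g f =ᵐ[μ] fun x => g x (f x) := by
  have h1 := (ContinuousLinearMap.id ℂ (V →L[ℂ] V)).coeFn_holder (r := 2) (opToLp μ g) f
  have h2 : opToLp μ g =ᵐ[μ] g := MemLp.coeFn_toLp _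
  filter_upwards [h1, h2] with x h1 h2
  rw [← h2]
  exact h1

theorem mulOp_eq_of_ae {g : E →ᵇ (V →L[ℂ] V)} {f f' : Lp V 2 μ}
    (hh : f' =ᵐ[μ] fun x => g x (f x)) : mulOp μ g f = f' :=
  Lp.ext ((mulOp_ae g f).trans hh.symm)

theorem inner_mulOp_left (g : E →ᵇ (V →L[ℂ] V)) (f f' : Lp V 2 μ) :
    inner ℂ (mulOp μ (star g) f) f' = inner ℂ f (mulOp μ g f') := by
  rw [L2.inner_def, L2.inner_def]
  refine integral_congr_ae ?_
  filter_upwards [mulOp_ae (star g) f, mulOp_ae g f'] with x h1 h2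
  rw [h1, h2]
  exact ContinuousLinearMap.adjoint_inner_left (g x) (f' x) (f x)

/-- Multiplication operators as a representation of the C⋆-algebra of bounded continuous
operator-valued functions. -/
def mulHom (μ : Measure E) : (E →ᵇ (V →L[ℂ] V)) →⋆ₐ[ℂ] (Lp V 2 μ →L[ℂ] Lp V 2 μ) where
  toFun := mulOp μ
  map_one' := by
    ext1 f
    exact mulOp_eq_of_ae (ae_of_all _ fun x => by simp)
  map_mul' g g' := by
    ext1 f
    refine mulOp_eq_of_ae ?_
    filter_upwards [mulOp_ae g (mulOp μ g' f), mulOp_ae g' f] with x h1 h2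
    rw [h2] at h1
    exact h1
  map_zero' := by
    ext1 f
    refine mulOp_eq_of_ae ?_
    filter_upwards [Lp.coeFn_zero V 2 μ] with x h1
    simpa using h1
  map_add' g g' := by
    ext1 f
    refine mulOp_eq_of_ae ?_
    filter_upwards [mulOp_ae g f, mulOp_ae g' f, Lp.coeFn_add (mulOp μ g f) (mulOp μ g' f)]
      with x h1 h2 h3
    simp only [_root_.add_apply, BoundedContinuousFunction.coe_add, Pi.add_apply]
      at h3 ⊢
    rw [h3, h1, h2]
  commutes' r := by
    ext1 f
    refine mulOp_eq_of_ae ?_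
    filter_upwards [Lp.coeFn_smul r f] with x h1
    simp only [Algebra.algebraMap_eq_smul_one]
    simpa using h1
  map_star' g := by
    refine (ContinuousLinearMap.eq_adjoint_iff _ _).2 fun f f' => ?_
    exact inner_mulOp_left g f f'

/-- Evaluation at a point as a homomorphism of C⋆-algebras. -/
def evalHom (x : E) : (E →ᵇ (V →L[ℂ] V)) →⋆ₐ[ℂ] (V →L[ℂ] V) where
  toFun g := g x
  map_one' := rfl
  map_mul' _ _ := rfl
  map_zero' := rfl
  map_add' _ _ := rfl
  commutes' _ := rfl
  map_star' _ := rfl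

/-- The continuous functional calculus for real functions in a C⋆-algebra, with the real algebra
structure obtained by restriction of scalars. -/
def realCfc {A : Type*} [CStarAlgebra A] (f : ℝ → ℝ) (a : A) : A := cfc f a

/-- A ⋆-homomorphism of C⋆-algebras is contractive, hence continuous, and so commutes with the
functional calculus. It is applied to `evalHom`, to `mulHom` and to conjugation by a unitary;
together these reduce functions of an operator on `L²` to functions of a matrix at each momentum. -/
theorem map_realCfc {A B : Type*} [CStarAlgebra A] [CStarAlgebra B] (φ : A →⋆ₐ[ℂ] B) {f : ℝ → ℝ}
    (hf : Continuous f) {a : A} (ha : IsSelfAdjoint a) : φ (realCfc f a) = realCfc f (φ a) :=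
  φ.map_cfc f a (hf := hf.continuousOn)
    (hφ := AddMonoidHomClass.continuous_of_bound φ 1
      (by simpa only [one_mul] using NonUnitalStarAlgHom.norm_apply_le φ))
    (ha := ha) (hφa := ha.map φ)

theorem isSelfAdjoint_realCfc {A : Type*} [CStarAlgebra A] (f : ℝ → ℝ) (a : A) :
    IsSelfAdjoint (realCfc f a) :=
  cfc_predicate f a

theorem realCfc_apply_bcf {f : ℝ → ℝ} (hf : Continuous f) {g : E →ᵇ (V →L[ℂ] V)}
    (hg : IsSelfAdjoint g) (x : E) : realCfc f g x = realCfc f (g x) :=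
  map_realCfc (evalHom x) hf hg

theorem realCfc_mulOp {f : ℝ → ℝ} (hf : Continuous f) {g : E →ᵇ (V →L[ℂ] V)}
    (hg : IsSelfAdjoint g) : realCfc f (mulOp μ g) = mulOp μ (realCfc f g) :=
  (map_realCfc (mulHom μ) hf hg).symm

end Multiplication

end

end Rashba

open MeasureTheory Filter Topology
open scoped SchwartzMap LineDeriv Laplacian Distributions

namespace Rashba

noncomputable section

/-! ### The operator `(T² + 1)⁻¹` -/

section Resolvent

variable {V : Type*} [NormedAddCommGroup V] [InnerProductSpace ℂ V] [CompleteSpace V]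

/-- `(T² + 1)⁻¹`. -/
def resSq (T : V →L[ℂ] V) : V →L[ℂ] V := Ring.inverse (T * T + 1)

variable {T : V →L[ℂ] V}

/-- The spectrum is real, so it contains neither `i` nor `-i`, and `T² + 1 = (i - T)(-i - T)`. -/
theorem isUnit_sq_add_one (hT : IsSelfAdjoint T) : IsUnit (T * T + 1) := by
  have key : ∀ z : ℂ, z.im ≠ 0 → IsUnit (algebraMap ℂ (V →L[ℂ] V) z - T) := by
    intro z hz
    by_contra hcon
    have hmem : z ∈ spectrum ℂ T := spectrum.mem_iff.2 hcon
    have := hT.mem_spectrum_eq_re hmem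
    apply hz
    rw [this]
    simp
  have h1 := key Complex.I (by simp)
  have h2 := key (-Complex.I) (by simp)
  rw [map_neg] at h2
  set a := algebraMap ℂ (V →L[ℂ] V) Complex.I
  have ha : a * a = -1 := by rw [← map_mul, Complex.I_mul_I, map_neg, map_one]
  have h3 : T * T + 1 = (-1 : V →L[ℂ] V) * ((a - T) * (-a - T)) * -1 := by
    have h4 : (a - T) * (-a - T) = -(a * a) + (T * a - a * T) + T * T := by noncomm_ring
    rw [h4, ha, Algebra.commutes Complex.I T]
    noncomm_ring
  rw [h3]
  exact ((isUnit_one.neg).mul (h1.mul h2)).mul isUnit_one.neg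

theorem sq_add_one_mul_resSq (hT : IsSelfAdjoint T) : (T * T + 1) * resSq T = 1 :=
  Ring.mul_inverse_cancel _ (isUnit_sq_add_one hT)

theorem resSq_mul_sq_add_one (hT : IsSelfAdjoint T) : resSq T * (T * T + 1) = 1 :=
  Ring.inverse_mul_cancel _ (isUnit_sq_add_one hT)

theorem resSq_apply_sq_add_one (hT : IsSelfAdjoint T) (x : V) : resSq T (T (T x) + x) = x := by
  simpa using congr($(resSq_mul_sq_add_one hT) x)

theorem sq_add_one_resSq_apply (hT : IsSelfAdjoint T) (x : V) :
    T (T (resSq T x)) + resSq T x = x := by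
  simpa using congr($(sq_add_one_mul_resSq hT) x)

theorem isSelfAdjoint_resSq (hT : IsSelfAdjoint T) : IsSelfAdjoint (resSq T) := by
  have h1 : IsSelfAdjoint (T * T + 1) := by
    have : IsSelfAdjoint (star T * T) := IsSelfAdjoint.star_mul_self T
    rw [hT.star_eq] at this
    exact this.add (IsSelfAdjoint.one _)
  unfold IsSelfAdjoint resSq
  rw [← Ring.inverse_star, h1.star_eq]

/-- Pair `(T² + 1) x` with `x` and use Cauchy–Schwarz. The contraction bounds below and, later, the
decay of the resolvent in momentum all come from this inequality. -/
theorem norm_sq_add_norm_sq_le (hT : IsSelfAdjoint T) (x : V) :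
    ‖T x‖ ^ 2 + ‖x‖ ^ 2 ≤ ‖x‖ * ‖T (T x) + x‖ := by
  have h1 : RCLike.re (inner ℂ x (T (T x) + x)) = ‖T x‖ ^ 2 + ‖x‖ ^ 2 := by
    rw [inner_add_right, map_add, inner_self_eq_norm_sq, ← ContinuousLinearMap.adjoint_inner_left,
      ← ContinuousLinearMap.star_eq_adjoint, hT.star_eq, inner_self_eq_norm_sq]
  rw [← h1]
  exact (RCLike.re_le_norm _).trans (norm_inner_le_norm _ _)

theorem norm_resSq_apply_le (hT : IsSelfAdjoint T) (x : V) : ‖resSq T x‖ ≤ ‖x‖ := by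
  have h1 := norm_sq_add_norm_sq_le hT (resSq T x)
  rw [sq_add_one_resSq_apply hT] at h1
  nlinarith [norm_nonneg (resSq T x), norm_nonneg x, sq_nonneg ‖T (resSq T x)‖]

theorem norm_apply_resSq_le (hT : IsSelfAdjoint T) (x : V) : ‖T (resSq T x)‖ ≤ ‖x‖ := by
  have h1 := norm_sq_add_norm_sq_le hT (resSq T x)
  rw [sq_add_one_resSq_apply hT] at h1
  have h2 := norm_resSq_apply_le hT x
  refine le_of_sq_le_sq ?_ (norm_nonneg _)
  nlinarith [norm_nonneg (resSq T x), norm_nonneg x]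

theorem norm_resSq_le (hT : IsSelfAdjoint T) : ‖resSq T‖ ≤ 1 :=
  ContinuousLinearMap.opNorm_le_bound _ zero_le_one fun x => by
    simpa using norm_resSq_apply_le hT x

theorem norm_mul_resSq_le (hT : IsSelfAdjoint T) : ‖T * resSq T‖ ≤ 1 :=
  ContinuousLinearMap.opNorm_le_bound _ zero_le_one fun x => by
    simpa using norm_apply_resSq_le hT x

theorem continuous_resSq {E : Type*} [TopologicalSpace E] {M : E → V →L[ℂ] V}
    (hM : Continuous M) (hMs : ∀ p, IsSelfAdjoint (M p)) : Continuous fun p => resSq (M p) := by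
  rw [continuous_iff_continuousAt]
  intro p
  obtain ⟨u, hu⟩ := isUnit_sq_add_one (hMs p)
  have h1 := NormedRing.inverse_continuousAt u
  rw [hu] at h1
  exact h1.comp (f := fun p => M p * M p + 1) ((hM.mul hM).add continuous_const).continuousAt

end Resolvent

set_option linter.unusedSectionVars false

/-! ### Operators unitarily equivalent to a multiplication operator -/

section Diagonal

open scoped BoundedContinuousFunction ENNReal

variable {E V : Type*} [TopologicalSpace E] [SecondCountableTopology E] [MeasurableSpace E]
  [BorelSpace E] [NormedAddCommGroup V] [InnerProductSpace ℂ V] [CompleteSpace V] {μ : Measure E}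

/-- A continuous self-adjoint operator-valued function. -/
structure Symbol (E V : Type*) [TopologicalSpace E] [NormedAddCommGroup V]
    [InnerProductSpace ℂ V] [CompleteSpace V] where
  /-- the values -/
  toFun : E → V →L[ℂ] V
  continuous_toFun : Continuous toFun
  isSelfAdjoint_toFun : ∀ p, IsSelfAdjoint (toFun p)

/-- `(M² + 1)⁻¹` as a bounded continuous function. -/
def Symbol.res (M : Symbol E V) : E →ᵇ (V →L[ℂ] V) :=
  BoundedContinuousFunction.ofNormedAddCommGroup (fun p => resSq (M.toFun p))
    (continuous_resSq M.continuous_toFun M.isSelfAdjoint_toFun) 1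
    fun p => norm_resSq_le (M.isSelfAdjoint_toFun p)

/-- `M (M² + 1)⁻¹` as a bounded continuous function. -/
def Symbol.mulRes (M : Symbol E V) : E →ᵇ (V →L[ℂ] V) :=
  BoundedContinuousFunction.ofNormedAddCommGroup (fun p => M.toFun p * resSq (M.toFun p))
    (M.continuous_toFun.mul (continuous_resSq M.continuous_toFun M.isSelfAdjoint_toFun)) 1
    fun p => norm_mul_resSq_le (M.isSelfAdjoint_toFun p)

@[simp]
theorem Symbol.res_apply (M : Symbol E V) (p : E) : M.res p = resSq (M.toFun p) := rfl

@[simp]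
theorem Symbol.mulRes_apply (M : Symbol E V) (p : E) :
    M.mulRes p = M.toFun p * resSq (M.toFun p) := rfl

theorem Symbol.isSelfAdjoint_res (M : Symbol E V) : IsSelfAdjoint M.res := by
  ext1 p
  exact isSelfAdjoint_resSq (M.isSelfAdjoint_toFun p)

variable {𝓗 : Type*} [NormedAddCommGroup 𝓗] [InnerProductSpace ℂ 𝓗] [CompleteSpace 𝓗]

/-- The two graph relations say `U f = (M² + 1) U B f` almost everywhere, and `M² + 1` is inverted
pointwise. Only the inclusion of the graph of `A` in that of multiplication by `M` is needed, so the
choice made in `invSqAddOne` is forced. -/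
theorem IsInvSqAddOne.eq_conj {A : 𝓗 →ₗ.[ℂ] 𝓗} {B : 𝓗 →L[ℂ] 𝓗} (hB : IsInvSqAddOne A B)
    (U : 𝓗 ≃ₗᵢ[ℂ] Lp V 2 μ) (M : Symbol E V)
    (hA : ∀ x y, (x, y) ∈ A.graph → U y =ᵐ[μ] fun p => M.toFun p (U x p)) :
    B = U.symm.conjStarAlgEquiv (mulOp μ M.res) := by
  ext1 f
  obtain ⟨g, hg1, hg2⟩ := hB f
  rw [LinearIsometryEquiv.conjStarAlgEquiv_apply_apply, LinearIsometryEquiv.symm_symm]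
  apply U.injective
  rw [LinearIsometryEquiv.apply_symm_apply]
  symm
  apply mulOp_eq_of_ae
  have h3 := hA _ _ hg1
  have h4 := hA _ _ hg2
  rw [map_sub] at h4
  filter_upwards [h3, h4, Lp.coeFn_sub (U f) (U (B f))] with p h3 h4 h5
  rw [h4, Pi.sub_apply, h3] at h5
  have h6 : U f p = M.toFun p (M.toFun p (U (B f) p)) + U (B f) p := by rw [h5]; abel
  rw [h6, Symbol.res_apply, resSq_apply_sq_add_one (M.isSelfAdjoint_toFun p)]

theorem invSqAddOne_eq_conj {A : 𝓗 →ₗ.[ℂ] 𝓗} (hB : ∃ B, IsInvSqAddOne A B)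
    (U : 𝓗 ≃ₗᵢ[ℂ] Lp V 2 μ) (M : Symbol E V)
    (hA : ∀ x y, (x, y) ∈ A.graph → U y =ᵐ[μ] fun p => M.toFun p (U x p)) :
    invSqAddOne A = U.symm.conjStarAlgEquiv (mulOp μ M.res) := by
  have : IsInvSqAddOne A (invSqAddOne A) := by
    rw [invSqAddOne, dif_pos hB]
    exact hB.choose_spec
  exact this.eq_conj U M hA

/-- `t ↦ (|λ| + 1)^(-n/2)` for `t = 1 / (λ² + 1)`. -/
def scaleFun (n : ℕ) (t : ℝ) : ℝ :=
  (Real.sqrt t / (Real.sqrt t + Real.sqrt (1 - t))) ^ ((n : ℝ) / 2)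

/-- `Real.sqrt` is zero on negative numbers, so positivity persists outside `[0, 1]`. This makes
`scaleFun` continuous on all of `ℝ`, as `map_realCfc` asks. -/
theorem sqrt_add_sqrt_pos (t : ℝ) : 0 < Real.sqrt t + Real.sqrt (1 - t) := by
  rcases le_or_gt t 0 with ht | ht
  · have : 0 < Real.sqrt (1 - t) := Real.sqrt_pos.2 (by linarith)
    positivity
  · have := Real.sqrt_pos.2 ht
    positivity

theorem continuous_scaleFun (n : ℕ) : Continuous (scaleFun n) := by
  unfold scaleFun
  refine Continuous.rpow_const ?_ fun _ => Or.inr (by positivity)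
  exact Continuous.div (by fun_prop) (by fun_prop) fun t => (sqrt_add_sqrt_pos t).ne'

theorem absAddOnePow_eq_realCfc (A : 𝓗 →ₗ.[ℂ] 𝓗) (n : ℕ) :
    absAddOnePow A n = realCfc (scaleFun n) (invSqAddOne A) := rfl

theorem absAddOnePow_eq_conj {A : 𝓗 →ₗ.[ℂ] 𝓗} (hB : ∃ B, IsInvSqAddOne A B)
    (U : 𝓗 ≃ₗᵢ[ℂ] Lp V 2 μ) (M : Symbol E V)
    (hA : ∀ x y, (x, y) ∈ A.graph → U y =ᵐ[μ] fun p => M.toFun p (U x p)) (n : ℕ) :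
    absAddOnePow A n = U.symm.conjStarAlgEquiv (mulOp μ (realCfc (scaleFun n) M.res)) := by
  rw [absAddOnePow_eq_realCfc, invSqAddOne_eq_conj hB U M hA]
  have hsa : IsSelfAdjoint (mulOp μ M.res) := M.isSelfAdjoint_res.map (mulHom μ)
  have := map_realCfc (StarAlgHomClass.toStarAlgHom U.symm.conjStarAlgEquiv) (continuous_scaleFun n) hsa
  rw [realCfc_mulOp (continuous_scaleFun n) M.isSelfAdjoint_res] at this
  exact this.symm

end Diagonal

end

end Rashba

/-! ### Diagonalization of the two-particle operator by the Fourier transform -/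

open MeasureTheory Filter Topology
open scoped SchwartzMap LineDeriv Laplacian Distributions

namespace Rashba

noncomputable section

/-! ### The one-particle operator on the Fourier side -/

section OneParticleSymbol

open scoped FourierTransform

theorem locallyIntegrable_clm_apply {E V : Type*} [NormedAddCommGroup E] [NormedSpace ℝ E]
    [FiniteDimensional ℝ E] [MeasurableSpace E] [BorelSpace E] [NormedAddCommGroup V]
    [NormedSpace ℂ V] {μ : Measure E} {A : E → V →L[ℂ] V} (hA : Continuous A) {f : E → V}
    (hf : LocallyIntegrable f μ) : LocallyIntegrable (fun x => A x (f x)) μ := by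
  rw [locallyIntegrable_iff]
  intro K hK
  obtain ⟨C, hC⟩ := hK.exists_bound_of_continuousOn hA.continuousOn
  refine (ContinuousLinearMap.id ℂ (V →L[ℂ] V)).integrable_of_bilin_of_bdd_left C
    hA.stronglyMeasurable.aestronglyMeasurable ?_ (hf.integrableOn_isCompact hK)
  exact (ae_restrict_iff' hK.measurableSet).2 (ae_of_all _ hC)

theorem integrable_schwartz_smul {E V : Type*} [NormedAddCommGroup E] [NormedSpace ℝ E]
    [FiniteDimensional ℝ E] [MeasurableSpace E] [BorelSpace E] [NormedAddCommGroup V]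
    [NormedSpace ℂ V] {μ : Measure E} [μ.HasTemperateGrowth] (φ : 𝓢(E, ℂ)) (f : Lp V 2 μ) :
    Integrable (fun x => φ x • f x) μ :=
  memLp_one_iff_integrable.1 ((Lp.memLp f).smul (φ.memLp 2 μ))

/-- `z(ξ) = 2π (ξ₁ + i ξ₂)`. -/
def zFun (ξ : E3) : ℂ := 2 * Real.pi * ((ξ 0 : ℂ) + Complex.I * ξ 1)

/-- The symbol of the one-particle operator. -/
def oneSymbol (α β : ℝ) (ξ : E3) : Matrix (Fin 2) (Fin 2) ℂ :=
  (((2 * Real.pi) ^ 2 * ‖ξ‖ ^ 2 : ℝ) : ℂ) • 1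
    + (α : ℂ) • (Complex.I • (star (zFun ξ) • Splus - zFun ξ • Sminus))
    + (β : ℂ) • ((2 : ℂ) • S3)

theorem continuous_zFun : Continuous zFun := by
  unfold zFun
  fun_prop

theorem continuous_oneSymbol (α β : ℝ) : Continuous (oneSymbol α β) := by
  have := continuous_zFun
  unfold oneSymbol
  fun_prop

theorem continuous_toEuclideanCLM {n : Type*} [Fintype n] [DecidableEq n] :
    Continuous (Matrix.toEuclideanCLM (𝕜 := ℂ) (n := n)) :=
  LinearMap.continuous_of_finiteDimensional
    (Matrix.toEuclideanCLM (𝕜 := ℂ) (n := n)).toAlgEquiv.toLinearMap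

theorem toEuclideanCLM_smul {n : Type*} [Fintype n] [DecidableEq n] (c : ℂ) (M : Matrix n n ℂ) :
    Matrix.toEuclideanCLM (𝕜 := ℂ) (c • M) = c • Matrix.toEuclideanCLM (𝕜 := ℂ) M :=
  (Matrix.toEuclideanCLM (𝕜 := ℂ) (n := n)).toAlgEquiv.toLinearMap.map_smul c M

/-- The symbol of the one-particle operator acting on `ℂ²`. -/
def oneOp (α β : ℝ) (ξ : E3) : C2 →L[ℂ] C2 := Matrix.toEuclideanCLM (𝕜 := ℂ) (oneSymbol α β ξ)

theorem continuous_oneOp (α β : ℝ) : Continuous (oneOp α β) :=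
  continuous_toEuclideanCLM.comp (continuous_oneSymbol α β)

theorem fourier_lineDeriv_apply (u : OneParticle) (m : E3) (φ : 𝓢(E3, ℂ)) :
    𝓕 (∂_{m} (u : 𝓢'(E3, C2))) φ
      = ∫ ξ, φ ξ • ((2 * Real.pi * Complex.I * (inner ℝ ξ m : ℝ)) • (𝓕 u : OneParticle) ξ) := by
  have hg : (fun x : E3 => ((inner ℝ x m : ℝ) : ℂ)).HasTemperateGrowth := by fun_prop
  rw [TemperedDistribution.fourier_lineDerivOp_eq, Lp.fourier_toTemperedDistribution_eq]
  simp only [_root_.smul_apply, TemperedDistribution.smulLeftCLM_apply_apply,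
    Lp.toTemperedDistribution_apply]
  rw [← integral_smul]
  refine integral_congr_ae (ae_of_all _ fun ξ => ?_)
  dsimp only
  rw [SchwartzMap.smulLeftCLM_apply_apply hg]
  simp only [smul_smul, smul_eq_mul]
  congr 1
  ring

theorem fourier_laplacian_apply (u : OneParticle) (φ : 𝓢(E3, ℂ)) :
    𝓕 (Δ (u : 𝓢'(E3, C2))) φ
      = -∫ ξ, φ ξ • ((((2 * Real.pi) ^ 2 * ‖ξ‖ ^ 2 : ℝ) : ℂ) • (𝓕 u : OneParticle) ξ) := by
  have hg : (fun x : E3 => ((‖x‖ ^ 2 : ℝ) : ℂ)).HasTemperateGrowth := by fun_prop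
  rw [TemperedDistribution.laplacian_eq_fourierMultiplierCLM,
    TemperedDistribution.fourierMultiplierCLM_apply]
  rw [← Complex.coe_smul, FourierTransform.fourier_smul, FourierTransform.fourier_fourierInv_eq,
    Lp.fourier_toTemperedDistribution_eq]
  simp only [_root_.smul_apply, TemperedDistribution.smulLeftCLM_apply_apply,
    Lp.toTemperedDistribution_apply]
  rw [← integral_smul, ← integral_neg]
  refine integral_congr_ae (ae_of_all _ fun ξ => ?_)
  dsimp only
  rw [SchwartzMap.smulLeftCLM_apply_apply hg]
  simp only [smul_smul, smul_eq_mul, ← neg_smul]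
  congr 1
  push_cast
  ring

theorem oneOp_apply (α β : ℝ) (ξ : E3) (x : C2) :
    oneOp α β ξ x = (((2 * Real.pi) ^ 2 * ‖ξ‖ ^ 2 : ℝ) : ℂ) • x
      + (α : ℂ) • (Complex.I • (star (zFun ξ) • Matrix.toEuclideanCLM (𝕜 := ℂ) Splus x
        - zFun ξ • Matrix.toEuclideanCLM (𝕜 := ℂ) Sminus x))
      + (β : ℂ) • ((2 : ℂ) • Matrix.toEuclideanCLM (𝕜 := ℂ) S3 x) := by
  simp only [oneOp, oneSymbol, map_add, toEuclideanCLM_smul, map_sub, map_one, _root_.add_apply,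
    _root_.smul_apply, _root_.sub_apply, one_apply_eq_self]

/-- Linearity of the integral, isolated so that computing the symbol becomes an identity between
integrands. `F₁` and `F₂` stand for the two first derivatives, `Fq` for the Laplacian term. -/
theorem integral_rashba {F₀ F₁ F₂ Fq : E3 → C2} (h₀ : Integrable F₀) (h₁ : Integrable F₁)
    (h₂ : Integrable F₂) (hq : Integrable Fq) (P Q S : C2 →L[ℂ] C2) (α β : ℂ) :
    ∫ ξ, (Fq ξ + α • (P (F₁ ξ - Complex.I • F₂ ξ) - Q (F₁ ξ + Complex.I • F₂ ξ))
      + β • ((2 : ℂ) • S (F₀ ξ)))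
      = (∫ ξ, Fq ξ) + α • (P ((∫ ξ, F₁ ξ) - Complex.I • ∫ ξ, F₂ ξ)
        - Q ((∫ ξ, F₁ ξ) + Complex.I • ∫ ξ, F₂ ξ)) + β • ((2 : ℂ) • S (∫ ξ, F₀ ξ)) := by
  have hI : Integrable fun ξ => Complex.I • F₂ ξ := h₂.fun_smul _
  have hs : Integrable fun ξ => F₁ ξ - Complex.I • F₂ ξ := h₁.sub hI
  have ha : Integrable fun ξ => F₁ ξ + Complex.I • F₂ ξ := h₁.add hI
  have hP : Integrable fun ξ => P (F₁ ξ - Complex.I • F₂ ξ) := P.integrable_comp hs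
  have hQ : Integrable fun ξ => Q (F₁ ξ + Complex.I • F₂ ξ) := Q.integrable_comp ha
  have hS : Integrable fun ξ => S (F₀ ξ) := S.integrable_comp h₀
  have hPQ : Integrable fun ξ => α • (P (F₁ ξ - Complex.I • F₂ ξ) - Q (F₁ ξ + Complex.I • F₂ ξ)) :=
    (hP.sub hQ).smul α
  have hS2 : Integrable fun ξ => β • ((2 : ℂ) • S (F₀ ξ)) := (hS.smul (2 : ℂ)).smul β
  have hl : Integrable fun ξ =>
      Fq ξ + α • (P (F₁ ξ - Complex.I • F₂ ξ) - Q (F₁ ξ + Complex.I • F₂ ξ)) := hq.add hPQ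
  rw [integral_add hl hS2, integral_add hq hPQ, integral_smul, integral_smul, integral_smul,
    integral_sub hP hQ, P.integral_comp_comm hs, Q.integral_comp_comm ha,
    S.integral_comp_comm h₀, integral_sub h₁ hI, integral_add h₁ hI, integral_smul]

theorem fourier_rashbaExpr_apply (α β : ℝ) (u : OneParticle) (φ : 𝓢(E3, ℂ)) :
    𝓕 (rashbaExpr α β (u : 𝓢'(E3, C2))) φ
      = ∫ ξ, φ ξ • oneOp α β ξ ((𝓕 u : OneParticle) ξ) := by
  have hint : ∀ g : E3 → ℂ, g.HasTemperateGrowth →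
      Integrable fun ξ => φ ξ • (g ξ • (𝓕 u : OneParticle) ξ) := by
    intro g hg
    refine (integrable_schwartz_smul (SchwartzMap.smulLeftCLM ℂ g φ) (𝓕 u : OneParticle)).congr
      (ae_of_all _ fun ξ => ?_)
    simp only [SchwartzMap.smulLeftCLM_apply_apply hg, smul_smul, smul_eq_mul, mul_comm]
  have i0 := integrable_schwartz_smul φ (𝓕 u : OneParticle)
  have i1 := fun m : E3 => hint (fun ξ => 2 * Real.pi * Complex.I * (inner ℝ ξ m : ℝ))
    (by fun_prop)
  have i2 := hint (fun ξ => (((2 * Real.pi) ^ 2 * ‖ξ‖ ^ 2 : ℝ) : ℂ)) (by fun_prop)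
  set e0 : E3 := EuclideanSpace.single 0 1
  set e1 : E3 := EuclideanSpace.single 1 1
  set P := Matrix.toEuclideanCLM (𝕜 := ℂ) Splus
  set Q := Matrix.toEuclideanCLM (𝕜 := ℂ) Sminus
  set S := Matrix.toEuclideanCLM (𝕜 := ℂ) S3
  have hL : 𝓕 (rashbaExpr α β (u : 𝓢'(E3, C2))) φ
      = -𝓕 (Δ (u : 𝓢'(E3, C2))) φ
        + (α : ℂ) • (P (𝓕 (∂_{e0} (u : 𝓢'(E3, C2))) φ
            - Complex.I • 𝓕 (∂_{e1} (u : 𝓢'(E3, C2))) φ)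
          - Q (𝓕 (∂_{e0} (u : 𝓢'(E3, C2))) φ
            + Complex.I • 𝓕 (∂_{e1} (u : 𝓢'(E3, C2))) φ))
        + (β : ℂ) • ((2 : ℂ) • S (𝓕 (u : 𝓢'(E3, C2)) φ)) := by
    rw [← TemperedDistribution.laplacianCLM_apply]
    rfl
  rw [hL, fourier_laplacian_apply, fourier_lineDeriv_apply, fourier_lineDeriv_apply, neg_neg,
    Lp.fourier_toTemperedDistribution_eq, Lp.toTemperedDistribution_apply]
  rw [← integral_rashba i0 (i1 e0) (i1 e1) i2]
  refine integral_congr_ae (ae_of_all _ fun ξ => ?_)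
  have h0 : (inner ℝ ξ e0 : ℝ) = ξ 0 := by simp [e0, EuclideanSpace.inner_single_right]
  have h1 : (inner ℝ ξ e1 : ℝ) = ξ 1 := by simp [e1, EuclideanSpace.inner_single_right]
  -- `∇₁ - i∇₂` has the symbol `2πi (ξ₁ - iξ₂)`, which is `i` times the conjugate of `z`, and `∇₁ +
  -- i∇₂` has the symbol `i z`.
  have hz : star (zFun ξ) = 2 * Real.pi * ((ξ 0 : ℂ) - Complex.I * ξ 1) := by
    simp [zFun]
    ring
  have hi : Complex.I * Complex.I = -1 := Complex.I_mul_I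
  simp only [oneOp_apply, h0, h1, map_smul, map_sub,
    map_add, hz, smul_add, smul_sub, smul_smul]
  rw [zFun]
  match_scalars <;> ring

/-- On the Fourier side the Rashba expression is multiplication by its symbol. -/
theorem eq_rashbaExpr_iff (α β : ℝ) (u f : OneParticle) :
    (f : 𝓢'(E3, C2)) = rashbaExpr α β (u : 𝓢'(E3, C2)) ↔
      (𝓕 f : OneParticle) =ᵐ[volume] fun ξ => oneOp α β ξ ((𝓕 u : OneParticle) ξ) := by
  constructor
  · intro hh
    have h1 := congrArg (fun w : 𝓢'(E3, C2) => 𝓕 w) hh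
    simp only [Lp.fourier_toTemperedDistribution_eq] at h1
    -- Both sides are locally integrable, so it is enough to compare them on smooth functions of
    -- compact support; these are Schwartz functions, on which the distributional identity can be
    -- evaluated.
    refine ae_eq_of_integral_contDiff_smul_eq ((Lp.memLp _).locallyIntegrable one_le_two)
      (locallyIntegrable_clm_apply (continuous_oneOp α β)
        ((Lp.memLp (𝓕 u : OneParticle)).locallyIntegrable one_le_two)) ?_
    intro g hg hgc
    have hg₁ : HasCompactSupport (Complex.ofRealCLM ∘ g) := hgc.comp_left rfl
    have hg₂ : ContDiff ℝ (⊤ : ℕ∞) (Complex.ofRealCLM ∘ g) := by fun_prop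
    have h2 := congrArg (fun w : 𝓢'(E3, C2) => w (hg₁.toSchwartzMap hg₂)) h1
    simp only [fourier_rashbaExpr_apply, Lp.toTemperedDistribution_apply] at h2
    simpa using h2
  · intro hh
    have h1 : 𝓕 (f : 𝓢'(E3, C2)) = 𝓕 (rashbaExpr α β (u : 𝓢'(E3, C2))) := by
      ext1 φ
      rw [fourier_rashbaExpr_apply, Lp.fourier_toTemperedDistribution_eq,
        Lp.toTemperedDistribution_apply]
      refine integral_congr_ae ?_
      filter_upwards [hh] with ξ h2
      rw [h2]
    have h2 := congrArg (fun w : 𝓢'(E3, C2) => 𝓕⁻ w) h1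
    simpa only [FourierTransform.fourierInv_fourier_eq] using h2

/-- The Sobolev weight of order two is `(1 + ‖ξ‖²)^(2/2)`; the hypothesis is the `H²` condition
freed of the real power. -/
theorem memSobolev_two_of_memLp (u : OneParticle)
    (hu : MemLp (fun ξ : E3 => ((1 + ‖ξ‖ ^ 2 : ℝ) : ℂ) • (𝓕 u : OneParticle) ξ) 2 volume) :
    TemperedDistribution.MemSobolev 2 2 (u : 𝓢'(E3, C2)) := by
  rw [TemperedDistribution.memSobolev_iff_exists_smulLeftCLM_fourier]
  refine ⟨hu.toLp, ?_⟩
  have hg : (fun x : E3 => (((1 + ‖x‖ ^ 2) ^ ((2 : ℝ) / 2) : ℝ) : ℂ)).HasTemperateGrowth := by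
    fun_prop
  ext1 φ
  rw [Lp.fourier_toTemperedDistribution_eq, TemperedDistribution.smulLeftCLM_apply_apply,
    Lp.toTemperedDistribution_apply, Lp.toTemperedDistribution_apply]
  refine integral_congr_ae ?_
  filter_upwards [hu.coeFn_toLp] with ξ h1
  rw [h1, SchwartzMap.smulLeftCLM_apply_apply hg, smul_smul]
  congr 1
  norm_num [mul_comm]

end OneParticleSymbol

end

end Rashba

open MeasureTheory Filter Topology
open scoped SchwartzMap LineDeriv Laplacian Distributions

namespace Rashba

noncomputable section

/-! ### The Fourier transform of elementary tensors -/

section TensorFourier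

open scoped FourierTransform

theorem quasiMeasurePreserving_fst : Measure.QuasiMeasurePreserving (fun q : E6 => q.fst)
    volume volume :=
  Measure.quasiMeasurePreserving_fst.comp (WithLp.volume_preserving_ofLp E3 E3).quasiMeasurePreserving

theorem quasiMeasurePreserving_snd : Measure.QuasiMeasurePreserving (fun q : E6 => q.snd)
    volume volume :=
  Measure.quasiMeasurePreserving_snd.comp (WithLp.volume_preserving_ofLp E3 E3).quasiMeasurePreserving

theorem integral_E6 {G : Type*} [NormedAddCommGroup G] [NormedSpace ℝ G] (f : E3 × E3 → G) :
    ∫ q : E6, f (q.fst, q.snd) = ∫ q, f q ∂((volume : Measure E3).prod volume) :=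
  (WithLp.volume_preserving_ofLp E3 E3).integral_comp
    (MeasurableEquiv.toLp 2 (E3 × E3)).symm.measurableEmbedding f

theorem tensorFun_congr {u u' v v' : E3 → C2} (hu : u =ᵐ[volume] u') (hv : v =ᵐ[volume] v') :
    tensorFun u v =ᵐ[volume] tensorFun u' v' := by
  filter_upwards [quasiMeasurePreserving_fst.ae_eq_comp hu,
    quasiMeasurePreserving_snd.ae_eq_comp hv] with q h1 h2
  simp only [Function.comp_apply] at h1 h2
  simp only [tensorFun, h1, h2]

theorem tensor_ae (u v : OneParticle) : tensor u v =ᵐ[volume] tensorFun u v :=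
  MemLp.coeFn_toLp _

theorem tensor_eq_of_ae {u v : OneParticle} {w : TwoParticle} (hw : w =ᵐ[volume] tensorFun u v) :
    w = tensor u v :=
  Lp.ext (hw.trans (tensor_ae u v).symm)

theorem lp_norm_sq {E V : Type*} [MeasurableSpace E] {μ : Measure E} [NormedAddCommGroup V]
    [InnerProductSpace ℂ V] (f : Lp V 2 μ) : ‖f‖ ^ 2 = ∫ x, ‖f x‖ ^ 2 ∂μ := by
  have h1 := L2.inner_def (𝕜 := ℂ) f f
  rw [inner_self_eq_norm_sq_to_K] at h1
  have h2 : ∀ x, inner ℂ (f x) (f x) = ((‖f x‖ ^ 2 : ℝ) : ℂ) := fun x => by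
    rw [inner_self_eq_norm_sq_to_K]; simp
  simp only [h2] at h1
  rw [integral_complex_ofReal] at h1
  refine Complex.ofReal_injective ?_
  rw [← h1]
  simp

/-- Fubini on `E6`. It makes `tensor` a bounded bilinear map, whose continuity the density argument
in `fourier_tensor` needs. -/
theorem norm_tensor (u v : OneParticle) : ‖tensor u v‖ = ‖u‖ * ‖v‖ := by
  have h1 : ‖tensor u v‖ ^ 2 = ‖u‖ ^ 2 * ‖v‖ ^ 2 := by
    rw [lp_norm_sq, lp_norm_sq, lp_norm_sq, ← integral_prod_mul,
      ← integral_E6 fun q : E3 × E3 => ‖u q.1‖ ^ 2 * ‖v q.2‖ ^ 2]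
    refine integral_congr_ae ?_
    filter_upwards [tensor_ae u v] with q hq
    rw [hq, norm_tensorFun, mul_pow]
  rw [← mul_pow] at h1
  exact (sq_eq_sq₀ (norm_nonneg _) (by positivity)).1 h1

theorem isBoundedBilinearMap_tensor :
    IsBoundedBilinearMap ℂ fun p : OneParticle × OneParticle => tensor p.1 p.2 where
  add_left u u' v := by
    symm
    apply tensor_eq_of_ae
    filter_upwards [Lp.coeFn_add (tensor u v) (tensor u' v), tensor_ae u v, tensor_ae u' v,
      tensorFun_congr (Lp.coeFn_add u u') (ae_eq_refl v)] with q h1 h2 h3 h4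
    rw [h1, h4, Pi.add_apply, h2, h3]
    ext s
    simp [tensorFun, add_mul]
  smul_left c u v := by
    symm
    apply tensor_eq_of_ae
    filter_upwards [Lp.coeFn_smul c (tensor u v), tensor_ae u v,
      tensorFun_congr (Lp.coeFn_smul c u) (ae_eq_refl v)] with q h1 h2 h4
    rw [h1, h4, Pi.smul_apply, h2]
    ext s
    simp [tensorFun, mul_assoc]
  add_right u v v' := by
    symm
    apply tensor_eq_of_ae
    filter_upwards [Lp.coeFn_add (tensor u v) (tensor u v'), tensor_ae u v, tensor_ae u v',
      tensorFun_congr (ae_eq_refl u) (Lp.coeFn_add v v')] with q h1 h2 h3 h4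
    rw [h1, h4, Pi.add_apply, h2, h3]
    ext s
    simp [tensorFun, mul_add]
  smul_right c u v := by
    symm
    apply tensor_eq_of_ae
    filter_upwards [Lp.coeFn_smul c (tensor u v), tensor_ae u v,
      tensorFun_congr (ae_eq_refl u) (Lp.coeFn_smul c v)] with q h1 h2 h4
    rw [h1, h4, Pi.smul_apply, h2]
    ext s
    simp [tensorFun, mul_left_comm]
  bound := ⟨1, one_pos, fun u v => by rw [norm_tensor, one_mul]⟩

/-- The `L²` Fourier transform of an integrable function is its Fourier integral. -/
theorem fourier_toLp_ae {E F : Type*} [NormedAddCommGroup E] [MeasurableSpace E] [BorelSpace E]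
    [InnerProductSpace ℝ E] [FiniteDimensional ℝ E] [NormedAddCommGroup F] [InnerProductSpace ℂ F]
    [CompleteSpace F] {f : E → F} (hf : Integrable f) (hf2 : MemLp f 2 (volume : Measure E)) :
    (𝓕 (hf2.toLp f) : Lp F 2 (volume : Measure E)) =ᵐ[volume] 𝓕 f := by
  have hc : Continuous (𝓕 f) :=
    VectorFourier.fourierIntegral_continuous Real.continuous_fourierChar
      (by exact continuous_inner) hf
  refine ae_eq_of_integral_contDiff_smul_eq ((Lp.memLp _).locallyIntegrable one_le_two)
    hc.locallyIntegrable ?_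
  intro g hg hgc
  have hg₁ : HasCompactSupport (Complex.ofRealCLM ∘ g) := hgc.comp_left rfl
  have hg₂ : ContDiff ℝ (⊤ : ℕ∞) (Complex.ofRealCLM ∘ g) := by fun_prop
  set φ : 𝓢(E, ℂ) := hg₁.toSchwartzMap hg₂ with hφ
  have h1 := congrArg (fun w : 𝓢'(E, F) => w φ) (Lp.fourier_toTemperedDistribution_eq (hf2.toLp f))
  simp only [TemperedDistribution.fourier_apply, Lp.toTemperedDistribution_apply] at h1
  have h2 : ∫ x, (𝓕 φ) x • hf2.toLp f x = ∫ x, (𝓕 φ) x • f x := by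
    refine integral_congr_ae ?_
    filter_upwards [hf2.coeFn_toLp] with x hx
    rw [hx]
  have h3 : ∫ x, (𝓕 φ) x • f x = ∫ x, φ x • 𝓕 f x := by
    have := VectorFourier.integral_fourierIntegral_smul_eq_flip (L := innerₗ E)
      Real.continuous_fourierChar continuous_inner φ.integrable hf (μ := volume) (ν := volume)
    simpa using! this
  rw [h2, h3] at h1
  simpa [hφ] using h1.symm

theorem integrable_tensorFun {u v : E3 → C2} (hu : Integrable u) (hv : Integrable v) :
    Integrable (tensorFun u v) := by
  have hm := WithLp.volume_preserving_ofLp E3 E3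
  have hmeas : AEStronglyMeasurable (tensorFun u v) (volume : Measure E6) := by
    have hc : Continuous fun p : C2 × C2 =>
        (WithLp.toLp 2 fun s : Fin 2 × Fin 2 => p.1 s.1 * p.2 s.2 : C4) := by fun_prop
    exact hc.comp_aestronglyMeasurable ((hu.1.comp_fst.comp_measurePreserving hm).prodMk
      (hv.1.comp_snd.comp_measurePreserving hm))
  refine (integrable_norm_iff hmeas).1 ?_
  refine (hm.integrable_comp_of_integrable (hu.norm.mul_prod hv.norm)).congr
    (ae_of_all _ fun q => ?_)
  simp [norm_tensorFun]

/-- The inner product of `E6` is the sum of the two inner products, so the character factors and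
Fubini applies. -/
theorem fourier_tensorFun {u v : E3 → C2} (hu : Integrable u) (hv : Integrable v) (p : E6) :
    𝓕 (tensorFun u v) p = tensorFun (𝓕 u) (𝓕 v) p := by
  have hcomp : ∀ {E : Type} [NormedAddCommGroup E] [MeasurableSpace E] [BorelSpace E]
      [InnerProductSpace ℝ E] [FiniteDimensional ℝ E] {n : Type} [Fintype n]
      (f : E → EuclideanSpace ℂ n) (_ : Integrable f) (x : E) (i : n),
      𝓕 f x i = ∫ y, (Real.fourierChar (-(inner ℝ y x)) : ℂ) * f y i := by
    intro E _ _ _ _ _ n _ f hf x i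
    rw [Real.fourier_eq]
    have hint : Integrable fun y => Real.fourierChar (-(inner ℝ y x)) • f y :=
      (Real.fourierIntegral_convergent_iff x).2 hf
    have := (EuclideanSpace.proj (𝕜 := ℂ) i).integral_comp_comm hint
    exact this.symm
  ext s
  rw [hcomp _ (integrable_tensorFun hu hv)]
  simp only [tensorFun]
  rw [hcomp _ hu, hcomp _ hv, ← integral_prod_mul, ← integral_E6 fun q : E3 × E3 =>
    ((Real.fourierChar (-(inner ℝ q.1 p.fst)) : ℂ) * u q.1 s.1) *
      ((Real.fourierChar (-(inner ℝ q.2 p.snd)) : ℂ) * v q.2 s.2)]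
  refine integral_congr_ae (ae_of_all _ fun q => ?_)
  have h1 : (inner ℝ q p : ℝ) = inner ℝ q.fst p.fst + inner ℝ q.snd p.snd := rfl
  simp only [h1, neg_add, AddChar.map_add_eq_mul, Circle.coe_mul]
  ring

/-- Both sides are continuous in `(u, v)`, so Schwartz functions suffice; there the `L²` transform
is the Fourier integral. -/
theorem fourier_tensor (u v : OneParticle) :
    (𝓕 (tensor u v) : TwoParticle) = tensor (𝓕 u : OneParticle) (𝓕 v : OneParticle) := by
  have hd : DenseRange (SchwartzMap.toLpCLM ℂ C2 2 (volume : Measure E3)) :=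
    SchwartzMap.denseRange_toLpCLM ENNReal.ofNat_ne_top
  have hct : Continuous fun p : OneParticle × OneParticle => tensor p.1 p.2 :=
    isBoundedBilinearMap_tensor.continuous
  have hf6 : Continuous fun w : TwoParticle => (𝓕 w : TwoParticle) :=
    (Lp.fourierTransformₗᵢ E6 C4).continuous
  have hf3 : Continuous fun w : OneParticle => (𝓕 w : OneParticle) :=
    (Lp.fourierTransformₗᵢ E3 C2).continuous
  refine hd.induction_on₂ (p := fun u v : OneParticle =>
    (𝓕 (tensor u v) : TwoParticle) = tensor (𝓕 u : OneParticle) (𝓕 v : OneParticle))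
    ?_ ?_ u v
  · refine isClosed_eq (hf6.comp hct) ?_
    exact hct.comp ((hf3.comp continuous_fst).prodMk (hf3.comp continuous_snd))
  · intro f g
    have h0 := tensor_ae (f.toLp 2) (g.toLp 2)
    have h1 : tensorFun (f.toLp 2 volume) (g.toLp 2 volume) =ᵐ[volume] tensorFun f g :=
      tensorFun_congr (f.coeFn_toLp 2 volume) (g.coeFn_toLp 2 volume)
    have hm : MemLp (tensorFun f g) 2 (volume : Measure E6) :=
      (memLp_tensorFun _ _).ae_eq h1
    have h2 : tensor (f.toLp 2) (g.toLp 2) = hm.toLp _ :=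
      Lp.ext ((h0.trans h1).trans hm.coeFn_toLp.symm)
    apply tensor_eq_of_ae
    simp only [SchwartzMap.toLpCLM_apply]
    rw [h2, SchwartzMap.toLp_fourier_eq, SchwartzMap.toLp_fourier_eq]
    refine (fourier_toLp_ae (integrable_tensorFun f.integrable g.integrable) hm).trans ?_
    refine EventuallyEq.trans (ae_of_all _ fun p => fourier_tensorFun f.integrable g.integrable p) ?_
    exact (tensorFun_congr ((𝓕 f).coeFn_toLp 2 volume) ((𝓕 g).coeFn_toLp 2 volume)).symm

end TensorFourier

end

end Rashba

open MeasureTheory Filter Topology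
open scoped SchwartzMap LineDeriv Laplacian Distributions

namespace Rashba

noncomputable section

/-! ### Functions with vanishing integrals over rectangles -/

/-- Rectangles form a π-system generating the product σ-algebra, so the vanishing spreads to all
measurable sets. -/
theorem ae_eq_zero_of_setIntegral_prod {α β : Type*} [MeasurableSpace α] [MeasurableSpace β]
    {μ : Measure (α × β)} {f : α × β → ℂ} (hf : Integrable f μ)
    (hz : ∀ s t, MeasurableSet s → MeasurableSet t → ∫ q in s ×ˢ t, f q ∂μ = 0) :
    f =ᵐ[μ] 0 := by
  suffices hall : ∀ s, MeasurableSet s → ∫ q in s, f q ∂μ = 0 from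
    Integrable.ae_eq_zero_of_forall_setIntegral_eq_zero hf fun s hs _ => hall s hs
  intro s hs
  induction s, hs using MeasurableSpace.induction_on_inter generateFrom_prod.symm isPiSystem_prod with
  | empty => simp
  | basic u hu =>
    obtain ⟨s, hs, t, ht, rfl⟩ := hu
    exact hz s t hs ht
  | compl t ht ih =>
    have h1 := integral_add_compl ht hf
    -- The whole space is a rectangle, so the total integral is zero and complements inherit the
    -- property.
    have h2 := hz Set.univ Set.univ MeasurableSet.univ MeasurableSet.univ
    rw [Set.univ_prod_univ, setIntegral_univ] at h2
    rw [ih, h2, zero_add] at h1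
    exact h1
  | iUnion g hd hm ih =>
    rw [integral_iUnion hm hd hf.integrableOn]
    simp [ih]

/-- The π-system argument needs integrability, so `G` is first cut off to products of balls of
radius `n`, which exhaust the space. -/
theorem ae_eq_zero_of_setIntegral_rectangle {G : E6 → ℂ} (hG : LocallyIntegrable G)
    (hz : ∀ A B : Set E3, MeasurableSet A → MeasurableSet B → Bornology.IsBounded A →
      Bornology.IsBounded B → ∫ q in {q : E6 | q.fst ∈ A ∧ q.snd ∈ B}, G q = 0) :
    G =ᵐ[volume] 0 := by
  have hm := WithLp.volume_preserving_ofLp E3 E3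
  have hme := (MeasurableEquiv.toLp 2 (E3 × E3)).symm.measurableEmbedding
  have hm' := WithLp.volume_preserving_toLp E3 E3
  have hrect : ∀ A B : Set E3, MeasurableSet A → MeasurableSet B →
      MeasurableSet {q : E6 | q.fst ∈ A ∧ q.snd ∈ B} := fun A B hA hB =>
    hm.measurable (hA.prod hB)
  have key : ∀ n : ℕ, ∀ᵐ q : E6, q.fst ∈ Metric.closedBall (0 : E3) n ∧
      q.snd ∈ Metric.closedBall (0 : E3) n → G q = 0 := by
    intro n
    set Kn : Set E6 := {q | q.fst ∈ Metric.closedBall (0 : E3) n ∧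
      q.snd ∈ Metric.closedBall (0 : E3) n} with hKn
    have hKm : MeasurableSet Kn := hrect _ _ measurableSet_closedBall measurableSet_closedBall
    have hKc : IsCompact Kn := by
      have h1 := (isCompact_closedBall (0 : E3) n).prod (isCompact_closedBall (0 : E3) n)
      exact (WithLp.prodContinuousLinearEquiv 2 ℝ E3 E3).toHomeomorph.isCompact_preimage.2 h1
    have hGi : Integrable (Kn.indicator G) :=
      (integrable_indicator_iff hKm).2 (hG.integrableOn_isCompact hKc)
    have h1 : (fun p : E3 × E3 => Kn.indicator G (WithLp.toLp 2 p)) =ᵐ[volume] 0 := by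
      refine ae_eq_zero_of_setIntegral_prod (hm'.integrable_comp_of_integrable hGi) ?_
      intro s t hs ht
      have h2 := hz (s ∩ Metric.closedBall 0 n) (t ∩ Metric.closedBall 0 n)
        (hs.inter measurableSet_closedBall) (ht.inter measurableSet_closedBall)
        (Metric.isBounded_closedBall.subset Set.inter_subset_right)
        (Metric.isBounded_closedBall.subset Set.inter_subset_right)
      have h3 : {q : E6 | q.fst ∈ s ∩ Metric.closedBall 0 n ∧ q.snd ∈ t ∩ Metric.closedBall 0 n}
          = {q : E6 | q.fst ∈ s ∧ q.snd ∈ t} ∩ Kn := by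
        ext q
        simp only [Set.mem_inter_iff, Set.mem_ofPred_eq, hKn]
        tauto
      rw [h3, ← setIntegral_indicator hKm] at h2
      rw [← h2]
      have h4 := hm.setIntegral_preimage_emb hme
        (fun p : E3 × E3 => Kn.indicator G (WithLp.toLp 2 p)) (s ×ˢ t)
      exact h4.symm
    have h2 := hm.quasiMeasurePreserving.ae_eq_comp h1
    filter_upwards [h2] with q hq hqK
    have h3 : q ∈ Kn := hqK
    simpa only [Function.comp_apply, WithLp.toLp_ofLp, Set.indicator_of_mem h3, Pi.zero_apply] using hq
  have h2 := ae_all_iff.2 key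
  filter_upwards [h2] with q hq
  obtain ⟨n, hn⟩ := exists_nat_ge (max ‖q.fst‖ ‖q.snd‖)
  refine hq n ⟨?_, ?_⟩
  · simpa using (le_max_left _ _).trans hn
  · simpa using (le_max_right _ _).trans hn

set_option linter.unusedSectionVars false

/-! ### Functions of bounded support -/

section BoundedSupport

variable {E V : Type*} [NormedAddCommGroup E] [NormedSpace ℝ E]
    [FiniteDimensional ℝ E] [MeasurableSpace E] [BorelSpace E] [NormedAddCommGroup V]
    [NormedSpace ℂ V] {μ : Measure E}

/-- `f` vanishes almost everywhere outside a bounded set. -/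
def AEBoundedSupport (μ : Measure E) (f : E → V) : Prop := ∃ R : ℝ, ∀ᵐ x ∂μ, R < ‖x‖ → f x = 0

/-- A continuous symbol is bounded on a ball outside of which `f` vanishes. Functions of this kind
serve as the core, because the unbounded operator can be applied to them repeatedly. -/
theorem AEBoundedSupport.memLp_clm_apply {f : E → V} (hf : AEBoundedSupport μ f)
    (hf2 : MemLp f 2 μ) {A : E → V →L[ℂ] V} (hA : Continuous A) :
    MemLp (fun x => A x (f x)) 2 μ := by
  obtain ⟨R, hR⟩ := hf
  obtain ⟨C, hC⟩ := (isCompact_closedBall (0 : E) R).exists_bound_of_continuousOn hA.continuousOn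
  refine hf2.of_le_mul (c := C) ?_ ?_
  · exact (ContinuousLinearMap.id ℂ (V →L[ℂ] V)).aestronglyMeasurable_comp₂
      hA.stronglyMeasurable.aestronglyMeasurable hf2.1
  · filter_upwards [hR] with x hx
    by_cases h : R < ‖x‖
    · simp [hx h]
    · have h1 := hC x (by simpa using not_lt.1 h)
      exact ((A x).le_opNorm _).trans (by gcongr)

theorem AEBoundedSupport.clm_apply {f : E → V} (hf : AEBoundedSupport μ f) (A : E → V →L[ℂ] V) :
    AEBoundedSupport μ fun x => A x (f x) := by
  obtain ⟨R, hR⟩ := hf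
  refine ⟨R, ?_⟩
  filter_upwards [hR] with x hx h
  simp [hx h]

theorem AEBoundedSupport.congr {f g : E → V} (hf : AEBoundedSupport μ f) (hfg : g =ᵐ[μ] f) :
    AEBoundedSupport μ g := by
  obtain ⟨R, hR⟩ := hf
  refine ⟨R, ?_⟩
  filter_upwards [hR, hfg] with x hx h1 h
  rw [h1, hx h]

theorem aeBoundedSupport_indicatorConstLp {s : Set E} (hs : MeasurableSet s) (hμ : μ s ≠ ⊤)
    (hb : Bornology.IsBounded s) (c : V) :
    AEBoundedSupport μ (indicatorConstLp 2 hs hμ c) := by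
  obtain ⟨R, hR⟩ := hb.subset_closedBall (0 : E)
  refine ⟨R, ?_⟩
  filter_upwards [indicatorConstLp_coeFn (p := 2) (hs := hs) (hμs := hμ) (c := c)] with x hx h
  rw [hx, Set.indicator_of_notMem]
  intro hxs
  have := hR hxs
  simp at this
  linarith

end BoundedSupport

end

end Rashba

open MeasureTheory Filter Topology
open scoped SchwartzMap LineDeriv Laplacian Distributions

namespace Rashba

noncomputable section

/-! ### The symbol of the two-particle operator -/

theorem toEuclideanCLM_apply_apply {n : Type*} [Fintype n] [DecidableEq n] (M : Matrix n n ℂ)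
    (x : EuclideanSpace ℂ n) (i : n) :
    Matrix.toEuclideanCLM (𝕜 := ℂ) M x i = ∑ j, M i j * x j := rfl

/-- The symbol of the two-particle operator. -/
def twoSymbol (α β : ℝ) (p : E6) : Matrix (Fin 2 × Fin 2) (Fin 2 × Fin 2) ℂ :=
  fun i j => oneSymbol α β p.fst i.1 j.1 * (1 : Matrix (Fin 2) (Fin 2) ℂ) i.2 j.2
    + (1 : Matrix (Fin 2) (Fin 2) ℂ) i.1 j.1 * oneSymbol α β p.snd i.2 j.2

/-- The symbol of the two-particle operator acting on `ℂ² ⊗ ℂ²`. -/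
def twoOp (α β : ℝ) (p : E6) : C4 →L[ℂ] C4 := Matrix.toEuclideanCLM (𝕜 := ℂ) (twoSymbol α β p)

/-- The elementary tensor of two spinors. -/
def spinTensor (x y : C2) : C4 := WithLp.toLp 2 fun s => x s.1 * y s.2

theorem tensorFun_eq_spinTensor (u v : E3 → C2) (q : E6) :
    tensorFun u v q = spinTensor (u q.fst) (v q.snd) := rfl

theorem twoOp_spinTensor (α β : ℝ) (p : E6) (x y : C2) :
    twoOp α β p (spinTensor x y)
      = spinTensor (oneOp α β p.fst x) y + spinTensor x (oneOp α β p.snd y) := by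
  ext ⟨i, j⟩
  revert i j
  simp only [twoOp, oneOp, toEuclideanCLM_apply_apply, PiLp.add_apply, spinTensor, twoSymbol,
    Fintype.sum_prod_type, Fin.sum_univ_two]
  simp only [Fin.forall_fin_two]
  refine ⟨⟨?_, ?_⟩, ?_, ?_⟩ <;> simp <;> ring

theorem continuous_twoOp (α β : ℝ) : Continuous (twoOp α β) := by
  refine continuous_toEuclideanCLM.comp ?_
  refine continuous_pi fun i => continuous_pi fun j => ?_
  have h1 : Continuous fun p : E6 => oneSymbol α β p.fst :=
    (continuous_oneSymbol α β).comp (WithLp.prodContinuousLinearEquiv 2 ℝ E3 E3).continuous.fst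
  have h2 : Continuous fun p : E6 => oneSymbol α β p.snd :=
    (continuous_oneSymbol α β).comp (WithLp.prodContinuousLinearEquiv 2 ℝ E3 E3).continuous.snd
  unfold twoSymbol
  exact ((h1.matrix_elem i.1 j.1).mul continuous_const).add
    (continuous_const.mul (h2.matrix_elem i.2 j.2))

theorem star_oneSymbol (α β : ℝ) (ξ : E3) (i j : Fin 2) :
    star (oneSymbol α β ξ i j) = oneSymbol α β ξ j i := by
  fin_cases i <;> fin_cases j <;>
    simp [oneSymbol, Splus, Sminus, S1, S2, S3] <;> ring_nf

theorem isSelfAdjoint_twoOp (α β : ℝ) (p : E6) : IsSelfAdjoint (twoOp α β p) := by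
  have h1 : IsSelfAdjoint (twoSymbol α β p) := by
    ext i j
    rw [Matrix.star_apply]
    simp only [twoSymbol, star_add, star_mul', star_oneSymbol]
    simp only [Matrix.one_apply, eq_comm]
    split_ifs <;> simp
  exact h1.map (Matrix.toEuclideanCLM (𝕜 := ℂ))

/-- The symbol of the two-particle operator as a continuous self-adjoint function. -/
def symbol (α β : ℝ) : Symbol E6 C4 where
  toFun := twoOp α β
  continuous_toFun := continuous_twoOp α β
  isSelfAdjoint_toFun := isSelfAdjoint_twoOp α β

@[simp]
theorem symbol_toFun (α β : ℝ) : (symbol α β).toFun = twoOp α β := rfl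

/-! ### The graph of the two-particle operator on the Fourier side -/

section Graph

open scoped FourierTransform

theorem mul_resSq_comm {V : Type*} [NormedAddCommGroup V] [InnerProductSpace ℂ V]
    [CompleteSpace V] {T : V →L[ℂ] V} (hT : IsSelfAdjoint T) : resSq T * T = T * resSq T := by
  have h1 : resSq T * T * ((T * T + 1) * resSq T) = resSq T * (T * T + 1) * (T * resSq T) := by
    noncomm_ring
  rwa [sq_add_one_mul_resSq hT, resSq_mul_sq_add_one hT, mul_one, one_mul] at h1

/-- The pairs `(F, G)` with `𝓕 G = M 𝓕 F`. -/
def twoGraph (α β : ℝ) : Submodule ℂ (TwoParticle × TwoParticle) :=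
  LinearMap.ker
    ((mulOp volume (symbol α β).res ∘L
        (Lp.fourierTransformₗᵢ E6 C4).toContinuousLinearEquiv.toContinuousLinearMap ∘L
          ContinuousLinearMap.snd ℂ TwoParticle TwoParticle
      - mulOp volume (symbol α β).mulRes ∘L
        (Lp.fourierTransformₗᵢ E6 C4).toContinuousLinearEquiv.toContinuousLinearMap ∘L
          ContinuousLinearMap.fst ℂ TwoParticle TwoParticle :
      TwoParticle × TwoParticle →L[ℂ] TwoParticle) : TwoParticle × TwoParticle →ₗ[ℂ] TwoParticle)

/-- To make this immediate, `twoGraph` is the kernel of a bounded operator: both sides of `𝓕 G = M 𝓕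
F` are damped by `(M² + 1)⁻¹`. -/
theorem isClosed_twoGraph (α β : ℝ) : IsClosed (twoGraph α β : Set (TwoParticle × TwoParticle)) :=
  ContinuousLinearMap.isClosed_ker _

theorem mem_twoGraph_iff (α β : ℝ) (F G : TwoParticle) :
    (F, G) ∈ twoGraph α β ↔
      (𝓕 G : TwoParticle) =ᵐ[volume] fun p => twoOp α β p ((𝓕 F : TwoParticle) p) := by
  have h1 : (F, G) ∈ twoGraph α β ↔ mulOp volume (symbol α β).res (𝓕 G : TwoParticle)
      = mulOp volume (symbol α β).mulRes (𝓕 F : TwoParticle) := by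
    rw [twoGraph, LinearMap.mem_ker]
    exact sub_eq_zero
  have hs := isSelfAdjoint_twoOp α β
  rw [h1]
  constructor
  · intro h2
    filter_upwards [mulOp_ae (symbol α β).res (𝓕 G : TwoParticle),
      mulOp_ae (symbol α β).mulRes (𝓕 F : TwoParticle)] with p h3 h4
    rw [h2, h4] at h3
    simp only [Symbol.mulRes_apply, Symbol.res_apply, symbol_toFun] at h3
    -- Applying `M² + 1` pointwise removes the damping.
    have h5 := congrArg (fun x => (twoOp α β p * twoOp α β p + 1) x) h3
    have h6 := sq_add_one_resSq_apply (hs p) ((𝓕 G : TwoParticle) p)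
    have h7 := sq_add_one_resSq_apply (hs p) ((𝓕 F : TwoParticle) p)
    change twoOp α β p (twoOp α β p (twoOp α β p (resSq (twoOp α β p) ((𝓕 F : TwoParticle) p))))
      + twoOp α β p (resSq (twoOp α β p) ((𝓕 F : TwoParticle) p)) =
      twoOp α β p (twoOp α β p (resSq (twoOp α β p) ((𝓕 G : TwoParticle) p)))
      + resSq (twoOp α β p) ((𝓕 G : TwoParticle) p) at h5
    rw [h6, ← map_add, h7] at h5
    exact h5.symm
  · intro h2
    apply Lp.ext
    filter_upwards [mulOp_ae (symbol α β).res (𝓕 G : TwoParticle),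
      mulOp_ae (symbol α β).mulRes (𝓕 F : TwoParticle), h2] with p h3 h4 h5
    rw [h3, h4, h5]
    exact congr($(mul_resSq_comm (hs p)) ((𝓕 F : TwoParticle) p))

/-- `Submodule.toLinearPMap` keeps the given submodule as its graph only if that is single-valued,
and a pair `(0, f)` has `𝓕 f = 0` by `eq_rashbaExpr_iff`. -/
theorem graph_h (α β : ℝ) : (h α β).graph = rashbaGraph α β := by
  refine Submodule.toLinearPMap_graph_eq _ ?_
  rintro ⟨u, f⟩ ⟨_, h2⟩ rfl
  rw [eq_rashbaExpr_iff] at h2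
  have h3 : (𝓕 f : OneParticle) = 0 := by
    apply Lp.ext
    have h4 : (𝓕 (0 : OneParticle) : OneParticle) = 0 := map_zero (Lp.fourierTransformₗᵢ E3 C2)
    rw [h4] at h2
    filter_upwards [h2, Lp.coeFn_zero C2 2 (volume : Measure E3)] with ξ h5 h6
    rw [h5, h6]
    simp
  exact (Lp.fourierTransformₗᵢ E3 C2).map_eq_zero_iff.1 h3

/-- The image again has a Fourier transform of bounded support, so `h` can be applied a second time;
`exists_mem_coreSpace` depends on this. -/
theorem mem_graph_h_of_boundedSupport (α β : ℝ) (u : OneParticle)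
    (hu : AEBoundedSupport volume (𝓕 u : OneParticle)) :
    ∃ f : OneParticle, (u, f) ∈ (h α β).graph ∧ AEBoundedSupport volume (𝓕 f : OneParticle) := by
  have hm := hu.memLp_clm_apply (Lp.memLp _) (continuous_oneOp α β)
  refine ⟨𝓕⁻ (hm.toLp _), ?_, ?_⟩
  · rw [graph_h]
    refine ⟨memSobolev_two_of_memLp u ?_, ?_⟩
    · have hc : Continuous fun ξ : E3 => ((1 + ‖ξ‖ ^ 2 : ℝ) : ℂ) • (1 : C2 →L[ℂ] C2) := by
        fun_prop
      exact hu.memLp_clm_apply (Lp.memLp _) hc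
    · rw [eq_rashbaExpr_iff, FourierTransform.fourier_fourierInv_eq]
      exact hm.coeFn_toLp
  · rw [FourierTransform.fourier_fourierInv_eq]
    exact (hu.clm_apply _).congr hm.coeFn_toLp

/-- The generators of the graph of `h ⊙ 1 + 1 ⊙ h`. -/
def tensorGraph (A : OneParticle →ₗ.[ℂ] OneParticle) : Submodule ℂ (TwoParticle × TwoParticle) :=
  Submodule.span ℂ {p : TwoParticle × TwoParticle | ∃ u v : A.domain,
    p = (tensor u v, tensor (A u) v + tensor u (A v))}

theorem mem_tensorGraph {A : OneParticle →ₗ.[ℂ] OneParticle} {u v f g : OneParticle}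
    (hu : (u, f) ∈ A.graph) (hv : (v, g) ∈ A.graph) :
    (tensor u v, tensor f v + tensor u g) ∈ tensorGraph A := by
  obtain ⟨u', rfl, rfl⟩ := (LinearPMap.mem_graph_iff _).1 hu
  obtain ⟨v', rfl, rfl⟩ := (LinearPMap.mem_graph_iff _).1 hv
  exact Submodule.subset_span ⟨u', v', rfl⟩

theorem tensorGraph_le (α β : ℝ) : tensorGraph (h α β) ≤ twoGraph α β := by
  refine Submodule.span_le.2 ?_
  rintro _ ⟨u, v, rfl⟩
  have hu := (h α β).mem_graph u
  have hv := (h α β).mem_graph v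
  rw [graph_h] at hu hv
  have hu' := (eq_rashbaExpr_iff α β _ _).1 hu.2
  have hv' := (eq_rashbaExpr_iff α β _ _).1 hv.2
  rw [SetLike.mem_coe, mem_twoGraph_iff]
  have h1 : (𝓕 (tensor (h α β u) v + tensor u (h α β v)) : TwoParticle)
      = (𝓕 (tensor (h α β u) v) : TwoParticle) + (𝓕 (tensor u (h α β v)) : TwoParticle) :=
    map_add (Lp.fourierTransformₗᵢ E6 C4) _ _
  rw [h1, fourier_tensor, fourier_tensor, fourier_tensor]
  filter_upwards [Lp.coeFn_add (tensor (𝓕 (h α β u) : OneParticle) (𝓕 (v : OneParticle)))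
    (tensor (𝓕 (u : OneParticle)) (𝓕 (h α β v) : OneParticle)),
    tensor_ae (𝓕 (h α β u) : OneParticle) (𝓕 (v : OneParticle)),
    tensor_ae (𝓕 (u : OneParticle)) (𝓕 (h α β v) : OneParticle),
    tensor_ae (𝓕 (u : OneParticle)) (𝓕 (v : OneParticle)),
    quasiMeasurePreserving_fst.ae_eq_comp hu', quasiMeasurePreserving_snd.ae_eq_comp hv']
    with p h2 h3 h4 h5 h6 h7
  simp only [Function.comp_apply] at h6 h7
  rw [h2, Pi.add_apply, h3, h4, h5, tensorFun_eq_spinTensor, tensorFun_eq_spinTensor,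
    tensorFun_eq_spinTensor, twoOp_spinTensor, h6, h7]

theorem twoGraph_fst_eq_zero (α β : ℝ) (x : TwoParticle × TwoParticle) (hx : x ∈ twoGraph α β)
    (h0 : x.1 = 0) : x.2 = 0 := by
  obtain ⟨F, G⟩ := x
  simp only at h0
  subst h0
  rw [mem_twoGraph_iff] at hx
  have h3 : (𝓕 G : TwoParticle) = 0 := by
    apply Lp.ext
    have h4 : (𝓕 (0 : TwoParticle) : TwoParticle) = 0 := map_zero (Lp.fourierTransformₗᵢ E6 C4)
    rw [h4] at hx
    filter_upwards [hx, Lp.coeFn_zero C4 2 (volume : Measure E6)] with ξ h5 h6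
    rw [h5, h6]
    simp
  exact (Lp.fourierTransformₗᵢ E6 C4).map_eq_zero_iff.1 h3

/-- Multiplication by the symbol is a closed extension, which yields closability. Without
closability `LinearPMap.closure` would return the operator itself. -/
theorem graph_H (α β : ℝ) : (H α β).graph = (tensorGraph (h α β)).topologicalClosure := by
  have h1 : (algTensorSum (h α β)).graph = tensorGraph (h α β) :=
    Submodule.toLinearPMap_graph_eq _ fun x hx =>
      twoGraph_fst_eq_zero α β x (tensorGraph_le α β hx)
  have h2 : (twoGraph α β).toLinearPMap.graph = twoGraph α β :=
    Submodule.toLinearPMap_graph_eq _ fun x hx => twoGraph_fst_eq_zero α β x hx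
  have h3 : (algTensorSum (h α β)).IsClosable := by
    rw [LinearPMap.isClosable_iff_exists_closed_extension]
    refine ⟨(twoGraph α β).toLinearPMap, ?_, ?_⟩
    · rw [LinearPMap.IsClosed, h2]
      exact isClosed_twoGraph α β
    · rw [← LinearPMap.le_graph_iff, h1, h2]
      exact tensorGraph_le α β
  rw [H, ← h3.graph_closure_eq_closure_graph, h1]

theorem graph_H_le (α β : ℝ) : (H α β).graph ≤ twoGraph α β := by
  rw [graph_H]
  exact Submodule.topologicalClosure_minimal _ (tensorGraph_le α β) (isClosed_twoGraph α β)

end Graph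

end

end Rashba

open MeasureTheory Filter Topology
open scoped SchwartzMap LineDeriv Laplacian Distributions

namespace Rashba

noncomputable section

/-! ### Self-adjointness of the two-particle operator -/

section Core

open scoped FourierTransform

theorem mem_twoGraph_of_mem_tensorGraph {α β : ℝ} {F G : TwoParticle}
    (hFG : (F, G) ∈ tensorGraph (h α β)) :
    (𝓕 G : TwoParticle) =ᵐ[volume] fun p => twoOp α β p ((𝓕 F : TwoParticle) p) :=
  (mem_twoGraph_iff α β F G).1 (tensorGraph_le α β hFG)

/-- The space of `f` such that `(A² + 1)⁻¹ f` and `A (A² + 1)⁻¹ f` belong to the domain of `H`,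
on the Fourier side. -/
def coreSpace (α β : ℝ) : Submodule ℂ TwoParticle :=
  let B : TwoParticle →L[ℂ] TwoParticle := mulOp volume (symbol α β).res
  let C : TwoParticle →L[ℂ] TwoParticle := mulOp volume (symbol α β).mulRes
  let J : TwoParticle →L[ℂ] TwoParticle :=
    (Lp.fourierTransformₗᵢ E6 C4).symm.toContinuousLinearEquiv.toContinuousLinearMap
  (H α β).graph.comap ((J ∘L B).prod (J ∘L C)).toLinearMap ⊓
    (H α β).graph.comap ((J ∘L C).prod (J ∘L (1 - B))).toLinearMap

theorem mem_coreSpace_iff (α β : ℝ) (f : TwoParticle) :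
    f ∈ coreSpace α β ↔
      ((𝓕⁻ (mulOp volume (symbol α β).res f) : TwoParticle),
        (𝓕⁻ (mulOp volume (symbol α β).mulRes f) : TwoParticle)) ∈ (H α β).graph ∧
      ((𝓕⁻ (mulOp volume (symbol α β).mulRes f) : TwoParticle),
        (𝓕⁻ (f - mulOp volume (symbol α β).res f) : TwoParticle)) ∈ (H α β).graph := Iff.rfl

theorem isClosed_coreSpace (α β : ℝ) : IsClosed (coreSpace α β : Set TwoParticle) := by
  have hc : IsClosed ((H α β).graph : Set (TwoParticle × TwoParticle)) := by
    rw [graph_H]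
    exact Submodule.isClosed_topologicalClosure _
  exact (hc.preimage (ContinuousLinearMap.continuous _)).inter
    (hc.preimage (ContinuousLinearMap.continuous _))

/-- For `f = (M² + 1) 𝓕 w` the damped functions `(M² + 1)⁻¹ f` and `M (M² + 1)⁻¹ f` are `𝓕 w` and `𝓕
w₁`, so the two graph relations are those assumed. -/
theorem mem_coreSpace_of_twice {α β : ℝ} {w w₁ w₂ : TwoParticle}
    (h1 : (w, w₁) ∈ tensorGraph (h α β)) (h2 : (w₁, w₂) ∈ tensorGraph (h α β)) :
    ∃ f ∈ coreSpace α β, f =ᵐ[volume] fun p =>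
      twoOp α β p (twoOp α β p ((𝓕 w : TwoParticle) p)) + (𝓕 w : TwoParticle) p := by
  have hle : tensorGraph (h α β) ≤ (H α β).graph := by
    rw [graph_H]
    exact Submodule.le_topologicalClosure _
  have e1 := mem_twoGraph_of_mem_tensorGraph h1
  have e2 := mem_twoGraph_of_mem_tensorGraph h2
  have hs := isSelfAdjoint_twoOp α β
  have hB : mulOp volume (symbol α β).res ((𝓕 w₂ : TwoParticle) + (𝓕 w : TwoParticle))
      = (𝓕 w : TwoParticle) := by
    apply mulOp_eq_of_ae
    filter_upwards [e1, e2, Lp.coeFn_add (𝓕 w₂ : TwoParticle) (𝓕 w : TwoParticle)] with p e1 e2 e3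
    rw [e3, Pi.add_apply, e2, e1]
    exact (resSq_apply_sq_add_one (hs p) _).symm
  have hC : mulOp volume (symbol α β).mulRes ((𝓕 w₂ : TwoParticle) + (𝓕 w : TwoParticle))
      = (𝓕 w₁ : TwoParticle) := by
    apply mulOp_eq_of_ae
    filter_upwards [e1, e2, Lp.coeFn_add (𝓕 w₂ : TwoParticle) (𝓕 w : TwoParticle)] with p e1 e2 e3
    rw [e3, Pi.add_apply, e2, e1]
    exact congrArg (twoOp α β p) (resSq_apply_sq_add_one (hs p) _).symm
  refine ⟨(𝓕 w₂ : TwoParticle) + (𝓕 w : TwoParticle), ?_, ?_⟩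
  swap
  · filter_upwards [e1, e2, Lp.coeFn_add (𝓕 w₂ : TwoParticle) (𝓕 w : TwoParticle)] with p e1 e2 e3
    rw [e3, Pi.add_apply, e2, e1]
  rw [mem_coreSpace_iff, hB, hC, add_sub_cancel_right, FourierTransform.fourierInv_fourier_eq,
    FourierTransform.fourierInv_fourier_eq, FourierTransform.fourierInv_fourier_eq]
  exact ⟨hle h1, hle h2⟩

/-- For tensor products of functions whose Fourier transforms have bounded support, `1 + H²` maps
into the core space. -/
theorem exists_mem_coreSpace (α β : ℝ) (u v : OneParticle) (hu : AEBoundedSupport volume u)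
    (hv : AEBoundedSupport volume v) :
    ∃ f ∈ coreSpace α β, f =ᵐ[volume] fun p =>
      twoOp α β p (twoOp α β p (tensorFun u v p)) + tensorFun u v p := by
  have hinv : ∀ w : OneParticle, (𝓕 (𝓕⁻ w : OneParticle) : OneParticle) = w :=
    FourierTransform.fourier_fourierInv_eq
  obtain ⟨u₁, hu1, hub1⟩ := mem_graph_h_of_boundedSupport α β (𝓕⁻ u) (by rwa [hinv])
  obtain ⟨u₂, hu2, -⟩ := mem_graph_h_of_boundedSupport α β u₁ hub1
  obtain ⟨v₁, hv1, hvb1⟩ := mem_graph_h_of_boundedSupport α β (𝓕⁻ v) (by rwa [hinv])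
  obtain ⟨v₂, hv2, -⟩ := mem_graph_h_of_boundedSupport α β v₁ hvb1
  have h1 := mem_tensorGraph hu1 hv1
  have h2 := (tensorGraph (h α β)).add_mem (mem_tensorGraph hu2 hv1) (mem_tensorGraph hu1 hv2)
  rw [Prod.mk_add_mk] at h2
  obtain ⟨f, hf, hfe⟩ := mem_coreSpace_of_twice h1 h2
  refine ⟨f, hf, ?_⟩
  filter_upwards [hfe, tensor_ae u v] with p e1 e2
  rw [e1, fourier_tensor, hinv, hinv, e2]

/-- The subspace is closed, so it is enough that a vector `F` orthogonal to it vanishes.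
Orthogonality to `(M² + 1)(1_A e_i ⊗ 1_B e_j)` says that the `(i, j)` component of `(M² + 1) F` has
integral zero over `A × B`. Hence `(M² + 1) F = 0` and `F = 0`. This takes the place of essential
self-adjointness of the algebraic tensor sum. -/
theorem coreSpace_eq_top (α β : ℝ) : coreSpace α β = ⊤ := by
  have hcl : (coreSpace α β).topologicalClosure = coreSpace α β :=
    (isClosed_coreSpace α β).submodule_topologicalClosure_eq
  rw [← hcl, Submodule.topologicalClosure_eq_top_iff, Submodule.eq_bot_iff]
  intro F hF
  have hs := isSelfAdjoint_twoOp α β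
  have hsym : ∀ p (x y : C4), inner ℂ (twoOp α β p x) y = inner ℂ x (twoOp α β p y) := by
    intro p x y
    rw [← ContinuousLinearMap.adjoint_inner_left, ← ContinuousLinearMap.star_eq_adjoint,
      (hs p).star_eq]
  have hcM : Continuous fun p => twoOp α β p * twoOp α β p + 1 :=
    ((continuous_twoOp α β).mul (continuous_twoOp α β)).add continuous_const
  have hG : LocallyIntegrable (fun p : E6 => (twoOp α β p * twoOp α β p + 1) (F p)) :=
    locallyIntegrable_clm_apply hcM ((Lp.memLp F).locallyIntegrable one_le_two)
  have key : ∀ i j : Fin 2, (fun p : E6 =>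
      (twoOp α β p * twoOp α β p + 1) (F p) (i, j)) =ᵐ[volume] 0 := by
    intro i j
    refine ae_eq_zero_of_setIntegral_rectangle ?_ ?_
    · rw [locallyIntegrable_iff] at hG ⊢
      intro K hK
      exact (EuclideanSpace.proj (𝕜 := ℂ) (i, j)).integrable_comp (hG K hK)
    · intro A B hA hB hAb hBb
      have hAm : volume A ≠ ⊤ := hAb.measure_lt_top.ne
      have hBm : volume B ≠ ⊤ := hBb.measure_lt_top.ne
      set u : OneParticle := indicatorConstLp 2 hA hAm (EuclideanSpace.single i (1 : ℂ)) with hu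
      set v : OneParticle := indicatorConstLp 2 hB hBm (EuclideanSpace.single j (1 : ℂ)) with hv
      obtain ⟨f, hf, hfe⟩ := exists_mem_coreSpace α β u v
        (aeBoundedSupport_indicatorConstLp hA hAm hAb _)
        (aeBoundedSupport_indicatorConstLp hB hBm hBb _)
      have h1 := (Submodule.mem_orthogonal _ _).1 hF f hf
      rw [L2.inner_def] at h1
      have hmeas : MeasurableSet {q : E6 | q.fst ∈ A ∧ q.snd ∈ B} :=
        (WithLp.volume_preserving_ofLp E3 E3).measurable (hA.prod hB)
      rw [← integral_indicator hmeas, ← h1]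
      refine integral_congr_ae ?_
      have hue : u =ᵐ[volume] A.indicator fun _ => EuclideanSpace.single i (1 : ℂ) :=
        indicatorConstLp_coeFn
      have hve : v =ᵐ[volume] B.indicator fun _ => EuclideanSpace.single j (1 : ℂ) :=
        indicatorConstLp_coeFn
      filter_upwards [hfe, tensorFun_congr hue hve] with p h2 h3
      rw [h2, h3, inner_add_left, hsym, hsym, ← inner_add_right]
      by_cases hp : p ∈ {q : E6 | q.fst ∈ A ∧ q.snd ∈ B}
      · rw [Set.indicator_of_mem hp]
        have h4 : tensorFun (A.indicator fun _ => EuclideanSpace.single i (1 : ℂ))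
            (B.indicator fun _ => EuclideanSpace.single j (1 : ℂ)) p
            = EuclideanSpace.single (i, j) (1 : ℂ) := by
          ext ⟨k, l⟩
          simp only [tensorFun, Set.indicator_of_mem hp.1, Set.indicator_of_mem hp.2]
          simp [← ite_and, and_comm]
        rw [h4, EuclideanSpace.inner_single_left]
        simp
      · rw [Set.indicator_of_notMem hp]
        have h4 : tensorFun (A.indicator fun _ => EuclideanSpace.single i (1 : ℂ))
            (B.indicator fun _ => EuclideanSpace.single j (1 : ℂ)) p = 0 := by
          ext ⟨k, l⟩
          by_cases hpA : p.fst ∈ A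
          · have hpB : p.snd ∉ B := fun hpB => hp ⟨hpA, hpB⟩
            simp [tensorFun, hpB]
          · simp [tensorFun, hpA]
        rw [h4, inner_zero_left]
  apply Lp.ext
  filter_upwards [key 0 0, key 0 1, key 1 0, key 1 1, Lp.coeFn_zero C4 2 (volume : Measure E6)]
    with p h00 h01 h10 h11 h0
  have h2 : (twoOp α β p * twoOp α β p + 1) (F p) = 0 := by
    ext ⟨i, j⟩
    revert i j
    simp only [Fin.forall_fin_two]
    exact ⟨⟨h00, h01⟩, h10, h11⟩
  have h3 := resSq_apply_sq_add_one (hs p) (F p)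
  have h4 : twoOp α β p (twoOp α β p (F p)) + F p = 0 := h2
  rw [h4, map_zero] at h3
  rw [h0, ← h3]
  rfl

end Core

end

end Rashba

open MeasureTheory Filter Topology
open scoped SchwartzMap LineDeriv Laplacian Distributions

namespace Rashba

noncomputable section

/-! ### The unitary map to centre-of-mass coordinates -/

section Unitary

open scoped FourierTransform Matrix

theorem sqrt_two_inv_mul_self : ((Real.sqrt 2 : ℂ))⁻¹ * ((Real.sqrt 2 : ℂ))⁻¹ = 2⁻¹ := by
  rw [← mul_inv, ← Complex.ofReal_mul, Real.mul_self_sqrt (by norm_num)]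
  norm_num

theorem sum_Idx {G : Type*} [AddCommMonoid G] (f : Idx → G) :
    ∑ i, f i = f .triplet1 + f .triplet0 + f .tripletm1 + f .singlet := by
  have : (Finset.univ : Finset Idx) = {.triplet1, .triplet0, .tripletm1, .singlet} := rfl
  rw [this, Finset.sum_insert (by decide), Finset.sum_insert (by decide),
    Finset.sum_insert (by decide), Finset.sum_singleton]
  simp only [add_assoc]

theorem clebschGordan_mul_conjTranspose : clebschGordan * clebschGordanᴴ = 1 := by
  have hs := sqrt_two_inv_mul_self
  ext i j
  rw [Matrix.mul_apply, Fintype.sum_prod_type]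
  simp only [Fin.sum_univ_two, Matrix.conjTranspose_apply]
  cases i <;> cases j <;>
    simp [clebschGordan, div_eq_mul_inv, hs] <;> norm_num

theorem conjTranspose_mul_clebschGordan : clebschGordanᴴ * clebschGordan = 1 := by
  have hs := sqrt_two_inv_mul_self
  ext ⟨i, i'⟩ ⟨j, j'⟩
  rw [Matrix.mul_apply, sum_Idx]
  simp only [Matrix.conjTranspose_apply]
  revert i i' j j'
  simp only [Fin.forall_fin_two]
  refine ⟨⟨⟨⟨?_, ?_⟩, ?_, ?_⟩, ⟨?_, ?_⟩, ?_, ?_⟩, ⟨⟨?_, ?_⟩, ?_, ?_⟩, ⟨?_, ?_⟩, ?_, ?_⟩ <;>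
    simp [clebschGordan, div_eq_mul_inv, hs] <;> norm_num

/-- The adjoint of `spinCoupling`. -/
def spinUncoupling : CIdx →L[ℂ] C4 :=
  LinearMap.toContinuousLinearMap (Matrix.toEuclideanLin clebschGordanᴴ)

theorem spinCoupling_spinUncoupling (x : CIdx) : spinCoupling (spinUncoupling x) = x := by
  simp [spinCoupling, spinUncoupling, Matrix.toLpLin_apply, Matrix.mulVec_mulVec,
    clebschGordan_mul_conjTranspose]

theorem spinUncoupling_spinCoupling (x : C4) : spinUncoupling (spinCoupling x) = x := by
  simp [spinCoupling, spinUncoupling, Matrix.toLpLin_apply, Matrix.mulVec_mulVec,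
    conjTranspose_mul_clebschGordan]

theorem inner_spinCoupling (x : C4) (y : CIdx) :
    inner ℂ (spinCoupling x) y = inner ℂ x (spinUncoupling y) := by
  have h1 := Matrix.toEuclideanLin_conjTranspose_eq_adjoint clebschGordan
  have h2 := LinearMap.adjoint_inner_right (Matrix.toEuclideanLin clebschGordan) x y
  rw [← h1] at h2
  exact h2.symm

theorem norm_spinCoupling (x : C4) : ‖spinCoupling x‖ = ‖x‖ := by
  have h1 : (inner ℂ (spinCoupling x) (spinCoupling x) : ℂ) = inner ℂ x x := by
    rw [inner_spinCoupling, spinUncoupling_spinCoupling]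
  rw [inner_self_eq_norm_sq_to_K, inner_self_eq_norm_sq_to_K] at h1
  have h2 : ‖spinCoupling x‖ ^ 2 = ‖x‖ ^ 2 := by exact_mod_cast h1
  exact (sq_eq_sq₀ (norm_nonneg _) (norm_nonneg _)).1 h2

theorem measurePreserving_linearEquiv_symm {E : Type*} [NormedAddCommGroup E] [NormedSpace ℝ E]
    [FiniteDimensional ℝ E] [MeasurableSpace E] [BorelSpace E] {μ : Measure E} (T : E ≃ₗ[ℝ] E)
    (hT : MeasurePreserving T μ μ) : MeasurePreserving T.symm μ μ :=
  MeasurePreserving.symm T.toContinuousLinearEquiv.toHomeomorph.toMeasurableEquiv hT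

theorem measurePreserving_symm (T : VolEquiv) : MeasurePreserving T.1.symm volume volume :=
  measurePreserving_linearEquiv_symm T.1 T.2

theorem L_ae (T : VolEquiv) (F : TwoParticle) :
    L T F =ᵐ[volume] fun Q => spinCoupling (F (T.1 Q)) := by
  have h1 : substitution T F =ᵐ[volume] F ∘ T.1 := Lp.coeFn_compMeasurePreserving F T.2
  have h2 : L T F =ᵐ[volume] fun Q => spinCoupling (substitution T F Q) :=
    ContinuousLinearMap.coeFn_compLpL _ _
  filter_upwards [h1, h2] with Q h1 h2
  rw [h2, h1]
  rfl

theorem norm_L (T : VolEquiv) (F : TwoParticle) : ‖L T F‖ = ‖F‖ := by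
  have h1 : ‖substitution T F‖ = ‖F‖ := (Lp.compMeasurePreservingₗᵢ ℂ T.1 T.2).norm_map F
  rw [← h1, Lp.norm_def, Lp.norm_def]
  congr 1
  refine eLpNorm_congr_norm_ae ?_
  have h2 : L T F =ᵐ[volume] fun Q => spinCoupling (substitution T F Q) :=
    ContinuousLinearMap.coeFn_compLpL _ _
  filter_upwards [h2] with Q h2
  rw [h2, norm_spinCoupling]

theorem memLp_uncouple (T : VolEquiv) {f : E6 → CIdx} (hf : MemLp f 2 volume) :
    MemLp (fun q => spinUncoupling (f (T.1.symm q))) 2 (volume : Measure E6) :=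
  spinUncoupling.comp_memLp' (hf.comp_measurePreserving (measurePreserving_symm T))

theorem L_toLp_uncouple (T : VolEquiv) {f : E6 → CIdx} (hf : MemLp f 2 volume) :
    L T ((memLp_uncouple T hf).toLp _) = hf.toLp _ := by
  apply Lp.ext
  filter_upwards [L_ae T ((memLp_uncouple T hf).toLp _), hf.coeFn_toLp,
    T.2.quasiMeasurePreserving.ae_eq_comp (memLp_uncouple T hf).coeFn_toLp] with Q h1 h2 h3
  simp only [Function.comp_apply, LinearEquiv.symm_apply_apply] at h3
  rw [h1, h2, h3, spinCoupling_spinUncoupling]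

/-- The unitary map `L`. -/
def LEquiv (T : VolEquiv) : TwoParticle ≃ₗᵢ[ℂ] Kc :=
  LinearIsometryEquiv.ofSurjective ⟨(L T).toLinearMap, norm_L T⟩ fun G =>
    ⟨(memLp_uncouple T (Lp.memLp G)).toLp _, by
      have h1 := L_toLp_uncouple T (Lp.memLp G)
      rw [Lp.toLp_coeFn] at h1
      exact h1⟩

theorem LEquiv_apply (T : VolEquiv) (F : TwoParticle) : LEquiv T F = L T F := rfl

/-- The unitary map that diagonalizes `Hᶜ`. -/
def diagonalizer (T : VolEquiv) : Kc ≃ₗᵢ[ℂ] TwoParticle :=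
  (LEquiv T).symm.trans (Lp.fourierTransformₗᵢ E6 C4)

theorem diagonalizer_apply_L (T : VolEquiv) (F : TwoParticle) :
    diagonalizer T (L T F) = (𝓕 F : TwoParticle) := by
  rw [← LEquiv_apply, diagonalizer, LinearIsometryEquiv.trans_apply,
    LinearIsometryEquiv.symm_apply_apply]
  rfl

theorem diagonalizer_symm_apply (T : VolEquiv) (f : TwoParticle) :
    (diagonalizer T).symm f = L T (𝓕⁻ f : TwoParticle) := by
  rw [LinearIsometryEquiv.symm_apply_eq, diagonalizer_apply_L,
    FourierTransform.fourier_fourierInv_eq]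

/-- `L` is isometric, hence injective, so the image of the graph of `H` is again single-valued. -/
theorem mem_graph_Hc_iff (T : VolEquiv) (α β : ℝ) (x y : Kc) :
    (x, y) ∈ (Hc T α β).graph ↔ ∃ F G, (F, G) ∈ (H α β).graph ∧ L T F = x ∧ L T G = y := by
  have h1 : (Hc T α β).graph
      = (H α β).graph.map ((L T).toLinearMap.prodMap (L T).toLinearMap) := by
    refine Submodule.toLinearPMap_graph_eq _ ?_
    rintro _ ⟨⟨F, G⟩, hFG, rfl⟩ h0
    have hF : LEquiv T F = 0 := h0
    have hF0 := (LEquiv T).map_eq_zero_iff.1 hF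
    have hG0 := (H α β).graph_fst_eq_zero_snd hFG hF0
    change L T G = 0
    rw [hG0, map_zero]
  rw [h1, Submodule.mem_map]
  constructor
  · rintro ⟨⟨F, G⟩, hFG, h2⟩
    exact ⟨F, G, hFG, congrArg Prod.fst h2, congrArg Prod.snd h2⟩
  · rintro ⟨F, G, hFG, rfl, rfl⟩
    exact ⟨(F, G), hFG, rfl⟩

theorem diagonalizer_of_mem_graph (T : VolEquiv) (α β : ℝ) (x y : Kc)
    (hxy : (x, y) ∈ (Hc T α β).graph) :
    diagonalizer T y =ᵐ[volume] fun p => (symbol α β).toFun p (diagonalizer T x p) := by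
  obtain ⟨F, G, hFG, rfl, rfl⟩ := (mem_graph_Hc_iff T α β x y).1 hxy
  rw [diagonalizer_apply_L, diagonalizer_apply_L]
  exact (mem_twoGraph_iff α β F G).1 (graph_H_le α β hFG)

/-- Since `coreSpace` is everything, both graph relations hold for every `f`. Thus the default value
in `invSqAddOne` is not taken for `Hᶜ`. -/
theorem exists_isInvSqAddOne (T : VolEquiv) (α β : ℝ) : ∃ B, IsInvSqAddOne (Hc T α β) B := by
  refine ⟨(diagonalizer T).symm.conjStarAlgEquiv (mulOp volume (symbol α β).res), fun f => ?_⟩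
  have h1 : diagonalizer T f ∈ coreSpace α β := by rw [coreSpace_eq_top]; trivial
  obtain ⟨h2, h3⟩ := (mem_coreSpace_iff α β _).1 h1
  rw [LinearIsometryEquiv.conjStarAlgEquiv_apply_apply, LinearIsometryEquiv.symm_symm]
  refine ⟨(diagonalizer T).symm (mulOp volume (symbol α β).mulRes (diagonalizer T f)), ?_, ?_⟩
  · exact (mem_graph_Hc_iff T α β _ _).2
      ⟨_, _, h2, (diagonalizer_symm_apply T _).symm, (diagonalizer_symm_apply T _).symm⟩
  · refine (mem_graph_Hc_iff T α β _ _).2 ⟨_, _, h3, (diagonalizer_symm_apply T _).symm, ?_⟩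
    rw [← diagonalizer_symm_apply, map_sub, LinearIsometryEquiv.symm_apply_apply]

theorem invSqAddOne_Hc (T : VolEquiv) (α β : ℝ) :
    invSqAddOne (Hc T α β)
      = (diagonalizer T).symm.conjStarAlgEquiv (mulOp volume (symbol α β).res) :=
  invSqAddOne_eq_conj (exists_isInvSqAddOne T α β) _ _ (diagonalizer_of_mem_graph T α β)

theorem absAddOnePow_Hc (T : VolEquiv) (α β : ℝ) (n : ℕ) :
    absAddOnePow (Hc T α β) n = (diagonalizer T).symm.conjStarAlgEquiv
      (mulOp volume (realCfc (scaleFun n) (symbol α β).res)) :=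
  absAddOnePow_eq_conj (exists_isInvSqAddOne T α β) _ _ (diagonalizer_of_mem_graph T α β) n

end Unitary

end

end Rashba

/-! ### The point interaction in momentum space -/

open MeasureTheory Filter Topology
open scoped SchwartzMap LineDeriv Laplacian Distributions

namespace Rashba

noncomputable section

/-! ### Functions orthogonal to the Fourier transforms of test functions -/

section Uniqueness

open scoped FourierTransform ContDiff RealInnerProductSpace

theorem contDiff_fourierChar_inner {E : Type*} [NormedAddCommGroup E] [InnerProductSpace ℝ E] (q : E) :
    ContDiff ℝ ∞ fun x : E => (Real.fourierChar ⟪x, q⟫ : ℂ) := by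
  simp only [Real.fourierChar_apply]
  exact ((Complex.ofRealCLM.contDiff.comp
    (contDiff_const.mul (contDiff_id.inner ℝ contDiff_const))).mul contDiff_const).cexp

variable {E : Type*} [NormedAddCommGroup E] [InnerProductSpace ℝ E] [FiniteDimensional ℝ E]
  [MeasurableSpace E] [BorelSpace E]

/-- For a test function `G`, the integral of `f G` equals that of `𝓕 f · 𝓕⁻ G`, which is zero. -/
theorem ae_eq_zero_of_fourier_eq_zero {f : E → ℂ} (hf : Integrable f) (h0 : ∀ w, 𝓕 f w = 0) :
    ∀ᵐ x, f x = 0 := by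
  refine ae_eq_zero_of_integral_contDiff_smul_eq_zero hf.locallyIntegrable fun g hg hgs => ?_
  have hgs' : HasCompactSupport (fun x => (g x : ℂ)) := hgs.comp_left Complex.ofReal_zero
  have hg' : ContDiff ℝ ∞ (fun x => (g x : ℂ)) := Complex.ofRealCLM.contDiff.comp hg
  let G : 𝓢(E, ℂ) := hgs'.toSchwartzMap hg'
  have h1 := VectorFourier.integral_fourierIntegral_smul_eq_flip (L := innerₗ E)
    Real.continuous_fourierChar continuous_inner (f := f) (g := (𝓕⁻ G : 𝓢(E, ℂ))) hf
    (SchwartzMap.integrable (μ := volume) (𝓕⁻ G : 𝓢(E, ℂ)))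
  have h2 : ∀ x, VectorFourier.fourierIntegral Real.fourierChar volume (innerₗ E).flip
      (𝓕⁻ G : 𝓢(E, ℂ)) x = (g x : ℂ) := by
    intro x
    rw [flip_innerₗ]
    change (𝓕 (𝓕⁻ G : 𝓢(E, ℂ)) : 𝓢(E, ℂ)) x = _
    rw [FourierTransform.fourier_fourierInv_eq]
    rfl
  simp only [h2] at h1
  calc ∫ x, g x • f x = ∫ x, f x • (g x : ℂ) := by
        refine integral_congr_ae (ae_of_all _ fun x => ?_)
        simp [mul_comm]
    _ = ∫ x, 𝓕 f x • (𝓕⁻ G : 𝓢(E, ℂ)) x := h1.symm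
    _ = 0 := by simp [h0]

/-- A function annihilated by the Fourier transforms of all test functions vanishes. -/
theorem ae_eq_zero_of_integral_fourier_mul_eq_zero {D : E → ℂ}
    (hD : ∀ g : 𝓢(E, ℂ), Integrable fun p => g p * D p)
    (h0 : ∀ g : E → ℂ, ContDiff ℝ ∞ g → HasCompactSupport g → ∫ p, 𝓕 g p * D p = 0) :
    ∀ᵐ p, D p = 0 := by
  refine measure_null_of_locally_null {p | ¬ D p = 0} fun q _ => ?_
  -- A bump modulated by the frequency `q`: its Fourier transform at `q` is the integral of the
  -- bump, hence nonzero, and it stays nonzero near `q`. Therefore `𝓕 g · D = 0` almost everywhere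
  -- is enough for `D = 0` near `q`.
  let b : ContDiffBump (0 : E) := ⟨1, 2, by norm_num, by norm_num⟩
  let g : E → ℂ := fun x => (Real.fourierChar ⟪x, q⟫ : ℂ) * ((b x : ℝ) : ℂ)
  have hg : ContDiff ℝ ∞ g :=
    (contDiff_fourierChar_inner q).mul (Complex.ofRealCLM.contDiff.comp b.contDiff)
  have hgs : HasCompactSupport g :=
    (b.hasCompactSupport.comp_left (g := fun t : ℝ => (t : ℂ)) Complex.ofReal_zero).mul_left
  have hgq : 𝓕 g q ≠ 0 := by
    rw [Real.fourier_eq]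
    have h1 : ∀ x, Real.fourierChar (-⟪x, q⟫) • g x = ((b x : ℝ) : ℂ) := by
      intro x
      rw [Circle.smul_def, smul_eq_mul, ← mul_assoc, ← Circle.coe_mul, ← AddChar.map_add_eq_mul]
      simp
    simp only [h1]
    rw [integral_complex_ofReal]
    exact_mod_cast (b.integral_pos (μ := volume)).ne'
  have hgc : Continuous (𝓕 g) := by
    have := (𝓕 (hgs.toSchwartzMap hg) : 𝓢(E, ℂ)).continuous
    exact this
  have hint : Integrable fun p => 𝓕 g p * D p := hD (𝓕 (hgs.toSchwartzMap hg))
  have hz : ∀ᵐ p, 𝓕 g p * D p = 0 := by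
    -- The translate of `g` by `a` is again a test function, and translation multiplies `𝓕 g` by the
    -- character of frequency `a`. The hypothesis on all translates says that the Fourier transform
    -- of `𝓕 g · D` is zero.
    refine ae_eq_zero_of_fourier_eq_zero hint fun a => ?_
    have hga : ContDiff ℝ ∞ fun x => g (x + -a) := hg.comp (contDiff_id.add contDiff_const)
    have hgas : HasCompactSupport fun x => g (x + -a) :=
      hgs.comp_homeomorph (Homeomorph.addRight (-a))
    have h1 := h0 _ hga hgas
    rw [← h1, Real.fourier_eq]
    refine integral_congr_ae (ae_of_all _ fun p => ?_)
    have h2 := congrFun (VectorFourier.fourierIntegral_comp_add_right Real.fourierChar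
      volume (innerₗ E) g (-a)) p
    have h3 : 𝓕 (fun x => g (x + -a)) p = Real.fourierChar (-⟪p, a⟫) • 𝓕 g p := by
      refine h2.trans ?_
      simp only [innerₗ_apply_apply, inner_neg_left, real_inner_comm]
      rfl
    dsimp only
    rw [h3, smul_mul_assoc]
  refine ⟨{p | ¬ D p = 0} ∩ {p | 𝓕 g p ≠ 0}, inter_mem_nhdsWithin _
    ((isOpen_ne_fun hgc continuous_const).mem_nhds hgq), measure_mono_null ?_ hz⟩
  rintro p ⟨hp1, hp2⟩
  exact mul_ne_zero hp2 hp1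

end Uniqueness

/-! ### Inverses of multiplication operators -/

section Inverse

open scoped BoundedContinuousFunction

variable {E V : Type*} [TopologicalSpace E] [NormedAddCommGroup V] [InnerProductSpace ℂ V]
  [FiniteDimensional ℂ V]

theorem isUnit_of_norm_le {A : V →L[ℂ] V} {c : ℝ} (hA : ∀ x, ‖x‖ ≤ c * ‖A x‖) : IsUnit A := by
  have hinj : Function.Injective A := by
    refine (injective_iff_map_eq_zero A).2 fun x hx => ?_
    have := hA x
    rw [hx, norm_zero, mul_zero] at this
    exact norm_le_zero_iff.1 this
  exact ContinuousLinearMap.isUnit_iff_bijective.2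
    ⟨hinj, (LinearMap.injective_iff_surjective (f := A.toLinearMap)).1 hinj⟩

omit [FiniteDimensional ℂ V] in
theorem apply_inverse_apply {A : V →L[ℂ] V} (hA : IsUnit A) (x : V) : A (Ring.inverse A x) = x :=
  congrArg (fun B : V →L[ℂ] V => B x) (Ring.mul_inverse_cancel A hA)

omit [FiniteDimensional ℂ V] in
theorem inverse_apply_apply {A : V →L[ℂ] V} (hA : IsUnit A) (x : V) : Ring.inverse A (A x) = x :=
  congrArg (fun B : V →L[ℂ] V => B x) (Ring.inverse_mul_cancel A hA)

theorem continuous_inverse {G : E → V →L[ℂ] V} (hG : Continuous G) (hu : ∀ p, IsUnit (G p)) :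
    Continuous fun p => Ring.inverse (G p) := by
  refine continuous_iff_continuousAt.2 fun p => ?_
  obtain ⟨u, hu⟩ := hu p
  have h1 := NormedRing.inverse_continuousAt u
  rw [hu] at h1
  exact h1.comp hG.continuousAt

theorem inner_apply_comm {A : V →L[ℂ] V} (hA : IsSelfAdjoint A) (x y : V) :
    (inner ℂ (A x) y : ℂ) = inner ℂ x (A y) :=
  ContinuousLinearMap.isSelfAdjoint_iff_isSymmetric.1 hA x y

theorem inner_inverse_comm {A : V →L[ℂ] V} (hA : IsSelfAdjoint A) (hu : IsUnit A) (x y : V) :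
    (inner ℂ (Ring.inverse A x) y : ℂ) = inner ℂ x (Ring.inverse A y) := by
  conv_lhs => rw [← apply_inverse_apply hu y]
  rw [← inner_apply_comm hA, apply_inverse_apply hu]

end Inverse

/-! ### Point interactions and multiplication operators -/

section PointWave

open scoped BoundedContinuousFunction FourierTransform ContDiff RealInnerProductSpace

theorem contDiff_linearEquiv {E : Type*} [NormedAddCommGroup E] [NormedSpace ℝ E]
    [FiniteDimensional ℝ E] (T : E ≃ₗ[ℝ] E) : ContDiff ℝ ∞ T :=
  T.toContinuousLinearEquiv.contDiff

theorem hasCompactSupport_comp_linearEquiv {E F : Type*} [NormedAddCommGroup E] [NormedSpace ℝ E]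
    [FiniteDimensional ℝ E] [Zero F] (T : E ≃ₗ[ℝ] E) {f : E → F} (hf : HasCompactSupport f) :
    HasCompactSupport fun x => f (T x) :=
  hf.comp_homeomorph T.toContinuousLinearEquiv.toHomeomorph

/-- The test function `φ` in the original coordinates. -/
def uncoupled (T : VolEquiv) (φ : Test) : 𝓢(E6, C4) :=
  HasCompactSupport.toSchwartzMap (f := fun q => spinUncoupling (φ (T.1.symm q)))
    ((hasCompactSupport_comp_linearEquiv T.1.symm φ.hasCompactSupport).comp_left
      (map_zero spinUncoupling))
    ((spinUncoupling.restrictScalars ℝ).contDiff.comp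
      (φ.contDiff.comp (contDiff_linearEquiv T.1.symm)))

theorem uncoupled_apply (T : VolEquiv) (φ : Test) (q : E6) :
    uncoupled T φ q = spinUncoupling (φ (T.1.symm q)) := rfl

theorem diagonalizer_testToL2 (T : VolEquiv) (φ : Test) :
    diagonalizer T (testToL2 φ) =ᵐ[volume] (𝓕 (uncoupled T φ) : 𝓢(E6, C4)) := by
  have h1 := L_toLp_uncouple T (φ.continuous.memLp_of_hasCompactSupport (p := 2)
    (μ := (volume : Measure E6)) φ.hasCompactSupport)
  have h2 : (memLp_uncouple T (φ.continuous.memLp_of_hasCompactSupport (p := 2)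
    (μ := (volume : Measure E6)) φ.hasCompactSupport)).toLp _
      = (uncoupled T φ).toLp 2 := rfl
  rw [testToL2, ← h1, diagonalizer_apply_L, h2, SchwartzMap.toLp_fourier_eq]
  exact SchwartzMap.coeFn_toLp _ _ _

/-- The spin vector `|σ⟩` in `ℂ² ⊗ ℂ²`. -/
def spinVec (σ : Idx) : C4 := spinUncoupling (EuclideanSpace.single σ 1)

/-- The Fourier transform of the point interaction. -/
def pointWave (T : VolEquiv) (σ : Idx) (X : E3) (N : ℝ) (p : E6) : C4 :=
  (Real.fourierChar (-⟪p, T.1 (WithLp.toLp 2 ((0 : E3), X))⟫) : ℂ) • ((N : ℂ) • spinVec σ)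

theorem continuous_pointWave (T : VolEquiv) (σ : Idx) (X : E3) (N : ℝ) :
    Continuous (pointWave T σ X N) := by
  have h1 : Continuous fun p : E6 =>
      (Real.fourierChar (-⟪p, T.1 (WithLp.toLp 2 ((0 : E3), X))⟫) : ℂ) :=
    continuous_subtype_val.comp (Real.continuous_fourierChar.comp
      (continuous_id.inner continuous_const).neg)
  exact h1.smul continuous_const

theorem apply_pointWave (T : VolEquiv) (σ : Idx) (X : E3) (N : ℝ) (p : E6) (A : C4 →L[ℂ] C4) :
    A (pointWave T σ X N p) =
      (Real.fourierChar (-⟪p, T.1 (WithLp.toLp 2 ((0 : E3), X))⟫) : ℂ)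
        • ((N : ℂ) • A (spinVec σ)) := by
  simp only [pointWave, map_smul]

theorem norm_apply_pointWave (T : VolEquiv) (σ : Idx) (X : E3) {N : ℝ} (hN : 0 < N) (p : E6)
    (A : C4 →L[ℂ] C4) : ‖A (pointWave T σ X N p)‖ = N * ‖A (spinVec σ)‖ := by
  rw [apply_pointWave, norm_smul, norm_smul, Circle.norm_coe, one_mul, Complex.norm_real,
    Real.norm_of_nonneg hN.le]

theorem inner_spinVec (σ : Idx) (x : CIdx) : inner ℂ (spinVec σ) (spinUncoupling x) = x σ := by
  rw [spinVec, ← inner_spinCoupling, spinCoupling_spinUncoupling, EuclideanSpace.inner_single_left]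
  simp

/-- Fourier inversion at the point `T Q₀`; pairing with the spin vector reads off the component `σ`.
-/
theorem psi_eq_integral (T : VolEquiv) (σ : Idx) (X : E3) (N : ℝ) (φ : Test) :
    psi σ X N φ = ∫ p, inner ℂ (pointWave T σ X N p) ((𝓕 (uncoupled T φ) : 𝓢(E6, C4)) p) := by
  have hc : Continuous fun p : E6 => Real.fourierChar ⟪p, T.1 (WithLp.toLp 2 ((0 : E3), X))⟫ :=
    Real.continuous_fourierChar.comp (continuous_id.inner continuous_const)
  set y : E6 := T.1 (WithLp.toLp 2 ((0 : E3), X)) with hy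
  have h1 : uncoupled T φ y = ∫ p, Real.fourierChar ⟪p, y⟫ • (𝓕 (uncoupled T φ) : 𝓢(E6, C4)) p := by
    conv_lhs => rw [← FourierTransform.fourierInv_fourier_eq (F := 𝓢(E6, C4)) (uncoupled T φ)]
    rw [SchwartzMap.fourierInv_coe, Real.fourierInv_eq]
  have h2 : psi σ X N φ = (N : ℂ) * inner ℂ (spinVec σ) (uncoupled T φ y) := by
    rw [uncoupled_apply, inner_spinVec, hy, LinearEquiv.symm_apply_apply]
    rfl
  have hint : Integrable fun p => Real.fourierChar ⟪p, y⟫ • (𝓕 (uncoupled T φ) : 𝓢(E6, C4)) p :=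
    ((𝓕 (uncoupled T φ) : 𝓢(E6, C4)).integrable (μ := volume)).mono
      (hc.smul (𝓕 (uncoupled T φ) : 𝓢(E6, C4)).continuous).aestronglyMeasurable
      (ae_of_all _ fun p => by rw [Circle.norm_smul])
  rw [h2, h1, ← integral_inner hint, ← integral_const_mul]
  refine integral_congr_ae (ae_of_all _ fun p => ?_)
  dsimp only
  rw [pointWave, Circle.smul_def, inner_smul_left, inner_smul_left, inner_smul_right,
    Complex.conj_ofReal, AddChar.map_neg_eq_inv, Circle.coe_inv_eq_conj, Complex.conj_conj]
  ring

theorem memLp_of_norm_le_mul_schwartz {u : 𝓢(E6, C4)} {f : E6 → C4} (hf : Continuous f) {C : ℝ}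
    {k : ℕ} (h : ∀ p, ‖f p‖ ≤ C * (1 + ‖p‖ ^ 2) ^ k * ‖u p‖) : MemLp f 2 volume := by
  have hg : (fun p : E6 => (((1 + ‖p‖ ^ 2 : ℝ) : ℂ)) ^ k).HasTemperateGrowth := by fun_prop
  refine ((SchwartzMap.smulLeftCLM C4 (fun p : E6 => (((1 + ‖p‖ ^ 2 : ℝ) : ℂ)) ^ k) u).memLp 2
    volume).of_le_mul (c := C) hf.aestronglyMeasurable (ae_of_all _ fun p => ?_)
  rw [SchwartzMap.smulLeftCLM_apply_apply hg, norm_smul, norm_pow, Complex.norm_real,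
    Real.norm_of_nonneg (by positivity), ← mul_assoc]
  exact h p

/-- A test function with prescribed uncoupled form. -/
def coupled (T : VolEquiv) (g : E6 → ℂ) (hg : ContDiff ℝ ∞ g) (hgs : HasCompactSupport g)
    (x : C4) : Test where
  toFun q := spinCoupling (g (T.1 q) • x)
  contDiff' := (spinCoupling.restrictScalars ℝ).contDiff.comp
    ((hg.comp (contDiff_linearEquiv T.1)).smul contDiff_const)
  hasCompactSupport' := ((hasCompactSupport_comp_linearEquiv T.1 hgs).smul_right
    (f' := fun _ => x)).comp_left (map_zero spinCoupling)
  tsupport_subset' := fun _ _ => trivial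

theorem fourier_uncoupled_coupled (T : VolEquiv) (g : E6 → ℂ) (hg : ContDiff ℝ ∞ g)
    (hgs : HasCompactSupport g) (x : C4) (p : E6) :
    (𝓕 (uncoupled T (coupled T g hg hgs x)) : 𝓢(E6, C4)) p = 𝓕 g p • x := by
  rw [SchwartzMap.fourier_coe, Real.fourier_eq, Real.fourier_eq, ← integral_smul_const]
  refine integral_congr_ae (ae_of_all _ fun q => ?_)
  dsimp only
  rw [uncoupled_apply]
  change Real.fourierChar (-⟪q, p⟫) • spinUncoupling (spinCoupling (g (T.1 (T.1.symm q)) • x)) = _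
  rw [spinUncoupling_spinCoupling, LinearEquiv.apply_symm_apply, smul_assoc]

/-- The image of the point interaction under a multiplication operator in momentum space. -/
theorem isExtApply_conj_iff (T : VolEquiv) (σ : Idx) (X : E3) (N : ℝ) (G : E6 →ᵇ (C4 →L[ℂ] C4))
    (hG : ∀ p, IsSelfAdjoint (G p)) {C : ℝ} {k : ℕ}
    (hlow : ∀ p x, ‖x‖ ≤ C * (1 + ‖p‖ ^ 2) ^ k * ‖G p x‖) (η : Kc) :
    IsExtApply testToL2 ((diagonalizer T).symm.conjStarAlgEquiv (mulOp volume G)) (psi σ X N) η ↔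
      diagonalizer T η =ᵐ[volume] fun p => G p (pointWave T σ X N p) := by
  have hu : ∀ p, IsUnit (G p) := fun p => isUnit_of_norm_le (hlow p)
  have hinv : ∀ p x, ‖Ring.inverse (G p) x‖ ≤ C * (1 + ‖p‖ ^ 2) ^ k * ‖x‖ := fun p x => by
    have := hlow p (Ring.inverse (G p) x)
    rwa [apply_inverse_apply (hu p)] at this
  have hci : Continuous fun p => Ring.inverse (G p) := continuous_inverse G.continuous hu
  -- By the lower bound `G⁻¹` grows at most polynomially, so it maps Schwartz functions into `L²`;
  -- in particular test functions lie in the range of the operator.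
  have hmem : ∀ u : 𝓢(E6, C4), MemLp (fun p => Ring.inverse (G p) (u p)) 2 volume := fun u =>
    memLp_of_norm_le_mul_schwartz (hci.clm_apply u.continuous) (fun p => hinv p (u p))
  have hI1 : ∀ u : 𝓢(E6, C4),
      Integrable fun p => inner ℂ (Ring.inverse (G p) (diagonalizer T η p)) (u p) := fun u => by
    refine (L2.integrable_inner (𝕜 := ℂ) (diagonalizer T η) ((hmem u).toLp _)).congr ?_
    filter_upwards [(hmem u).coeFn_toLp] with p h2
    rw [h2, inner_inverse_comm (hG p) (hu p)]
  have hI2 : ∀ u : 𝓢(E6, C4), Integrable fun p => inner ℂ (pointWave T σ X N p) (u p) := fun u => by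
    refine ((u.integrable (μ := volume)).norm.const_mul ‖(N : ℂ) • spinVec σ‖).mono'
      ((continuous_pointWave T σ X N).inner u.continuous).aestronglyMeasurable
      (ae_of_all _ fun p => (norm_inner_le_norm _ _).trans_eq ?_)
    rw [pointWave, norm_smul, Circle.norm_coe, one_mul]
  constructor
  · intro h
    -- Writing the transformed test function as `G` times `g` moves `G⁻¹` onto the transform of `η`,
    -- so that this function and the wave have equal pairings with all transformed test functions.
    have key : ∀ φ : Test, ∫ p, inner ℂ (Ring.inverse (G p) (diagonalizer T η p)
        - pointWave T σ X N p) ((𝓕 (uncoupled T φ) : 𝓢(E6, C4)) p) = 0 := by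
      intro φ
      obtain ⟨g, hg1, hg2⟩ := h φ
      rw [LinearIsometryEquiv.conjStarAlgEquiv_apply_apply, LinearIsometryEquiv.symm_symm,
        LinearIsometryEquiv.symm_apply_eq] at hg1
      rw [psi_eq_integral T, ← (diagonalizer T).inner_map_map, L2.inner_def] at hg2
      simp only [inner_sub_left]
      rw [integral_sub (hI1 _) (hI2 _), hg2, sub_eq_zero]
      refine integral_congr_ae ?_
      filter_upwards [mulOp_ae G (diagonalizer T g), diagonalizer_testToL2 T φ] with p h1 h2
      rw [hg1, h2] at h1
      rw [h1, inner_inverse_comm (hG p) (hu p), inverse_apply_apply (hu p)]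
    -- Test functions with a fixed spin `x` reduce the separation property to scalar functions.
    have hx : ∀ x : C4, ∀ᵐ p, inner ℂ (Ring.inverse (G p) (diagonalizer T η p)
        - pointWave T σ X N p) x = 0 := by
      intro x
      refine ae_eq_zero_of_integral_fourier_mul_eq_zero (fun g => ?_) fun g hg hgs => ?_
      · have h1 := (hI1 (SchwartzMap.postcompCLM (ContinuousLinearMap.toSpanSingleton ℂ x) g)).sub
          (hI2 (SchwartzMap.postcompCLM (ContinuousLinearMap.toSpanSingleton ℂ x) g))
        refine h1.congr (ae_of_all _ fun p => ?_)
        simp only [Pi.sub_apply, ← inner_sub_left]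
        change inner ℂ _ (g p • x) = _
        rw [inner_smul_right]
      · rw [← key (coupled T g hg hgs x)]
        refine integral_congr_ae (ae_of_all _ fun p => ?_)
        dsimp only
        rw [fourier_uncoupled_coupled, inner_smul_right]
    have h1 : ∀ᵐ p, ∀ i, inner ℂ (Ring.inverse (G p) (diagonalizer T η p)
        - pointWave T σ X N p) (EuclideanSpace.single i (1 : ℂ)) = 0 := ae_all_iff.2 fun i => hx _
    filter_upwards [h1] with p h1
    have h2 : Ring.inverse (G p) (diagonalizer T η p) - pointWave T σ X N p = 0 := by
      ext i
      have h3 := h1 i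
      rw [EuclideanSpace.inner_single_right, one_mul, map_eq_zero_iff _ (RingHom.injective _)] at h3
      exact h3
    rw [← sub_eq_zero.1 h2, apply_inverse_apply (hu p)]
  · intro h φ
    refine ⟨(diagonalizer T).symm ((hmem (𝓕 (uncoupled T φ))).toLp _), ?_, ?_⟩
    · rw [LinearIsometryEquiv.conjStarAlgEquiv_apply_apply, LinearIsometryEquiv.symm_symm,
        LinearIsometryEquiv.apply_symm_apply, LinearIsometryEquiv.symm_apply_eq]
      refine mulOp_eq_of_ae ?_
      filter_upwards [diagonalizer_testToL2 T φ, (hmem (𝓕 (uncoupled T φ))).coeFn_toLp]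
        with p h1 h2
      rw [h1, h2, apply_inverse_apply (hu p)]
    · rw [psi_eq_integral T, ← (diagonalizer T).inner_map_map, LinearIsometryEquiv.apply_symm_apply,
        L2.inner_def]
      refine integral_congr_ae ?_
      filter_upwards [h, (hmem (𝓕 (uncoupled T φ))).coeFn_toLp] with p h1 h2
      rw [h1, h2, inner_apply_comm (hG p), apply_inverse_apply (hu p)]

/-- The character in `pointWave` has modulus one and drops out of the norm, so the criterion
involves neither `X` nor `T`. -/
theorem exists_isExtApply_iff (T : VolEquiv) (σ : Idx) (X : E3) {N : ℝ} (hN : 0 < N)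
    (G : E6 →ᵇ (C4 →L[ℂ] C4)) (hG : ∀ p, IsSelfAdjoint (G p)) {C : ℝ} {k : ℕ}
    (hlow : ∀ p x, ‖x‖ ≤ C * (1 + ‖p‖ ^ 2) ^ k * ‖G p x‖) :
    (∃ η, IsExtApply testToL2 ((diagonalizer T).symm.conjStarAlgEquiv (mulOp volume G))
      (psi σ X N) η) ↔ Integrable fun p => ‖G p (spinVec σ)‖ ^ 2 := by
  have hc : Continuous fun p => G p (pointWave T σ X N p) :=
    G.continuous.clm_apply (continuous_pointWave T σ X N)
  have h1 : MemLp (fun p => G p (pointWave T σ X N p)) 2 volume ↔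
      Integrable fun p => ‖G p (spinVec σ)‖ ^ 2 := by
    rw [memLp_two_iff_integrable_sq_norm hc.aestronglyMeasurable]
    simp only [norm_apply_pointWave T σ X hN, mul_pow]
    exact integrable_const_mul_iff (IsUnit.mk0 _ (by positivity)) _
  rw [← h1]
  constructor
  · rintro ⟨η, hη⟩
    exact (memLp_congr_ae ((isExtApply_conj_iff T σ X N G hG hlow η).1 hη)).1 (Lp.memLp _)
  · intro h
    refine ⟨(diagonalizer T).symm (h.toLp _), (isExtApply_conj_iff T σ X N G hG hlow _).2 ?_⟩
    rw [LinearIsometryEquiv.apply_symm_apply]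
    exact h.coeFn_toLp

theorem exists_isExtApply_norm_eq_one_iff (T : VolEquiv) (σ : Idx) (X : E3) {N : ℝ} (hN : 0 < N)
    (G : E6 →ᵇ (C4 →L[ℂ] C4)) (hG : ∀ p, IsSelfAdjoint (G p)) {C : ℝ} {k : ℕ}
    (hlow : ∀ p x, ‖x‖ ≤ C * (1 + ‖p‖ ^ 2) ^ k * ‖G p x‖)
    (hint : Integrable fun p => ‖G p (spinVec σ)‖ ^ 2) :
    (∃ η, IsExtApply testToL2 ((diagonalizer T).symm.conjStarAlgEquiv (mulOp volume G))
      (psi σ X N) η ∧ ‖η‖ = 1) ↔ N ^ 2 * ∫ p, ‖G p (spinVec σ)‖ ^ 2 = 1 := by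
  have h1 : ∀ η, IsExtApply testToL2 ((diagonalizer T).symm.conjStarAlgEquiv (mulOp volume G))
      (psi σ X N) η → ‖η‖ ^ 2 = N ^ 2 * ∫ p, ‖G p (spinVec σ)‖ ^ 2 := by
    intro η hη
    rw [← (diagonalizer T).norm_map, lp_norm_sq, ← integral_const_mul]
    refine integral_congr_ae ?_
    filter_upwards [(isExtApply_conj_iff T σ X N G hG hlow η).1 hη] with p h2
    rw [h2, norm_apply_pointWave T σ X hN, mul_pow]
  constructor
  · rintro ⟨η, hη, hn⟩
    rw [← h1 η hη, hn, one_pow]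
  · intro h
    obtain ⟨η, hη⟩ := (exists_isExtApply_iff T σ X hN G hG hlow).2 hint
    refine ⟨η, hη, ?_⟩
    have h2 := h1 η hη
    rw [h] at h2
    exact (pow_eq_one_iff_of_nonneg (norm_nonneg _) two_ne_zero).1 h2

end PointWave

end

end Rashba

/-! ### Decay in momentum and regularity of the point interaction -/

open MeasureTheory Filter Topology
open scoped SchwartzMap LineDeriv Laplacian Distributions

namespace Rashba

noncomputable section

/-! ### Norm bounds for functions of `(T² + 1)⁻¹` -/

section Bounds

variable {A : Type*} [CStarAlgebra A]

/-- The spectrum is expressed through the complex algebra map at real `t`, so that no real algebra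
structure appears outside `realCfc`. -/
theorem norm_realCfc_le {f : ℝ → ℝ} {a : A} {c : ℝ} (hc : 0 ≤ c)
    (h : ∀ t : ℝ, ¬ IsUnit (algebraMap ℂ A t - a) → |f t| ≤ c) : ‖realCfc f a‖ ≤ c :=
  norm_cfc_le hc fun t ht => h t (spectrum.mem_iff.1 ht)

/-- The function `1/f` of `a` is the inverse. This converts a lower bound on the spectrum into one
on norms `‖f(a) x‖`. -/
theorem exists_mul_realCfc_eq_one {f : ℝ → ℝ} (hf : Continuous f) {a : A} (ha : IsSelfAdjoint a)
    {m : ℝ} (hm : 0 < m) (h : ∀ t : ℝ, ¬ IsUnit (algebraMap ℂ A t - a) → m ≤ f t) :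
    ∃ b, b * realCfc f a = 1 ∧ ‖b‖ ≤ m⁻¹ := by
  have h' : ∀ t ∈ spectrum ℝ a, m ≤ f t := fun t ht => h t (spectrum.mem_iff.1 ht)
  refine ⟨realCfc (fun t => (f t)⁻¹) a, ?_, norm_realCfc_le (by positivity) fun t ht => ?_⟩
  · unfold realCfc
    have hci : ContinuousOn (fun t => (f t)⁻¹) (spectrum ℝ a) :=
      hf.continuousOn.inv₀ fun t ht => (hm.trans_le (h' t ht)).ne'
    rw [← cfc_mul _ _ a hci hf.continuousOn, ← cfc_const_one ℝ a ha]
    refine cfc_congr fun t ht => ?_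
    exact inv_mul_cancel₀ (hm.trans_le (h' t ht)).ne'
  · have h1 := h t ht
    rw [abs_of_nonneg (inv_nonneg.2 (hm.le.trans h1))]
    exact inv_anti₀ hm h1

/-- On `[0, 1]` one has `√t ≥ t` and `√(1 - t) ≥ 1 - t`, so the denominator is at least `1`; the
exponent is `4/2 = 2`. -/
theorem scaleFun_four_le {t : ℝ} (h0 : 0 ≤ t) (h1 : t ≤ 1) : |scaleFun 4 t| ≤ t := by
  have hs : 1 ≤ Real.sqrt t + Real.sqrt (1 - t) := by
    have h2 : t ≤ Real.sqrt t := Real.le_sqrt_of_sq_le (by nlinarith)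
    have h3 : 1 - t ≤ Real.sqrt (1 - t) := Real.le_sqrt_of_sq_le (by nlinarith)
    linarith
  have h4 : Real.sqrt t / (Real.sqrt t + Real.sqrt (1 - t)) ≤ Real.sqrt t :=
    div_le_self (Real.sqrt_nonneg t) hs
  have h5 : scaleFun 4 t = (Real.sqrt t / (Real.sqrt t + Real.sqrt (1 - t))) ^ 2 := by
    unfold scaleFun
    norm_num
  rw [h5, abs_of_nonneg (by positivity)]
  calc _ ≤ Real.sqrt t ^ 2 := by gcongr
    _ = t := Real.sq_sqrt h0

/-- Here `t` lies in `[0, 1]`, so the denominator is at most `2`. -/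
theorem rpow_le_scaleFun (n : ℕ) {s t : ℝ} (hs : 0 ≤ s) (hst : s ^ 2 ≤ t) (h1 : t ≤ 1) :
    (s / 2) ^ ((n : ℝ) / 2) ≤ scaleFun n t := by
  unfold scaleFun
  refine Real.rpow_le_rpow (by positivity) ?_ (by positivity)
  have h2 : s ≤ Real.sqrt t := Real.le_sqrt_of_sq_le hst
  have h3 : Real.sqrt t ≤ 1 := Real.sqrt_le_one.2 h1
  have h4 : Real.sqrt (1 - t) ≤ 1 := Real.sqrt_le_one.2 (by nlinarith)
  rw [div_le_div_iff₀ two_pos (sqrt_add_sqrt_pos t)]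
  nlinarith [Real.sqrt_nonneg t, Real.sqrt_nonneg (1 - t)]

variable {V : Type*} [NormedAddCommGroup V] [InnerProductSpace ℂ V]

/-- Where the scalar part `P` dominates, `‖M y‖ ≥ (1 + P)/2 · ‖y‖`, and `norm_sq_add_norm_sq_le`
turns this into decay. Elsewhere `1 + P` is bounded and the contraction bound is enough. -/
theorem norm_resSq_apply_le_of_decomp [CompleteSpace V] {M N : V →L[ℂ] V} {P K : ℝ}
    (hM : IsSelfAdjoint M)
    (hMN : ∀ x, M x = (P : ℂ) • x + N x) (hP : 0 ≤ P) (hK : 0 ≤ K)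
    (hN : ∀ x, ‖N x‖ ≤ K * Real.sqrt (1 + P) * ‖x‖) (x : V) :
    (1 + P) ^ 2 * ‖resSq M x‖ ≤ 16 * (K + 1) ^ 4 * ‖x‖ := by
  set y := resSq M x with hy
  have h1 := norm_sq_add_norm_sq_le hM y
  rw [sq_add_one_resSq_apply hM] at h1
  have h2 : P * ‖y‖ - K * Real.sqrt (1 + P) * ‖y‖ ≤ ‖M y‖ := by
    have h3 : (P : ℂ) • y = M y - N y := by rw [hMN]; abel
    have h4 : P * ‖y‖ = ‖M y - N y‖ := by
      rw [← h3, norm_smul, Complex.norm_real, Real.norm_of_nonneg hP]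
    linarith [norm_sub_le (M y) (N y), hN y]
  set s := Real.sqrt (1 + P) with hs
  have hs1 : 1 ≤ s := Real.one_le_sqrt.2 (by linarith)
  have hs2 : 1 + P = s ^ 2 := (Real.sq_sqrt (by linarith)).symm
  rcases eq_or_lt_of_le (norm_nonneg y) with h0 | h0
  · rw [← h0]; simp only [mul_zero]; positivity
  have hxy : ‖y‖ ≤ ‖x‖ := by rw [hy]; exact norm_resSq_apply_le hM x
  rw [hs2]
  -- For `s ≥ 2(K + 1)` one has `s²/2 ≥ (K + 1) s ≥ K s + 1`, that is, `P - K s ≥ s²/2`. The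
  -- constant `16 (K + 1)⁴` is the fourth power of the threshold.
  rcases le_total s (2 * (K + 1)) with h5 | h5
  · calc (s ^ 2) ^ 2 * ‖y‖ ≤ ((2 * (K + 1)) ^ 2) ^ 2 * ‖x‖ := by gcongr
      _ = 16 * (K + 1) ^ 4 * ‖x‖ := by ring
  · have h6 : s ^ 2 / 2 * ‖y‖ ≤ ‖M y‖ := by
      refine le_trans ?_ h2
      rw [← sub_mul]
      refine mul_le_mul_of_nonneg_right ?_ h0.le
      nlinarith
    have h7 : (s ^ 2 / 2 * ‖y‖) ^ 2 ≤ ‖y‖ * ‖x‖ := by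
      have : (s ^ 2 / 2 * ‖y‖) ^ 2 ≤ ‖M y‖ ^ 2 := by gcongr
      nlinarith
    have h8 : (s ^ 2) ^ 2 * ‖y‖ ≤ 4 * ‖x‖ := by
      have : ‖y‖ * ((s ^ 2) ^ 2 * ‖y‖) ≤ ‖y‖ * (4 * ‖x‖) := by nlinarith
      exact le_of_mul_le_mul_left this h0
    refine h8.trans (mul_le_mul_of_nonneg_right ?_ (norm_nonneg x))
    have : 1 ≤ (K + 1) ^ 4 := one_le_pow₀ (by linarith)
    linarith

theorem norm_le_norm_resSq_apply_of_decomp [CompleteSpace V] {M N : V →L[ℂ] V} {P K : ℝ}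
    (hM : IsSelfAdjoint M)
    (hMN : ∀ x, M x = (P : ℂ) • x + N x) (hP : 0 ≤ P) (hK : 0 ≤ K)
    (hN : ∀ x, ‖N x‖ ≤ K * Real.sqrt (1 + P) * ‖x‖) (x : V) :
    ‖x‖ ≤ ((K + 1) ^ 2 + 1) * (1 + P) ^ 2 * ‖resSq M x‖ := by
  have hs1 : 1 ≤ Real.sqrt (1 + P) := Real.one_le_sqrt.2 (by linarith)
  have hs2 : Real.sqrt (1 + P) ≤ 1 + P := Real.sqrt_le_iff.2 ⟨by linarith, by nlinarith⟩
  have h1 : ∀ z, ‖M z‖ ≤ (K + 1) * (1 + P) * ‖z‖ := fun z => by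
    rw [hMN]
    refine (norm_add_le _ _).trans ?_
    rw [norm_smul, Complex.norm_real, Real.norm_of_nonneg hP]
    have h2 := hN z
    have h3 : K * Real.sqrt (1 + P) * ‖z‖ ≤ K * (1 + P) * ‖z‖ := by gcongr
    nlinarith [norm_nonneg z]
  conv_lhs => rw [← sq_add_one_resSq_apply hM x]
  set y := resSq M x
  have h4 : ‖M (M y)‖ ≤ (K + 1) * (1 + P) * ((K + 1) * (1 + P) * ‖y‖) :=
    (h1 _).trans (by gcongr; exact h1 y)
  have h5 : ‖y‖ ≤ (1 + P) ^ 2 * ‖y‖ :=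
    le_mul_of_one_le_left (norm_nonneg y) (one_le_pow₀ (by linarith))
  refine (norm_add_le _ _).trans ?_
  calc ‖M (M y)‖ + ‖y‖ ≤ (K + 1) * (1 + P) * ((K + 1) * (1 + P) * ‖y‖) + (1 + P) ^ 2 * ‖y‖ :=
        add_le_add h4 h5
    _ = _ := by ring

variable [FiniteDimensional ℂ V]

/-- In finite dimension a spectral value is an eigenvalue. The two norm bounds confine `|t|`, and
pairing `x = t (M² + 1) x` with `x` gives the sign. -/
theorem mem_Icc_of_not_isUnit_sub_resSq {M : V →L[ℂ] V} (hM : IsSelfAdjoint M) {c : ℝ}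
    (hc : 0 < c) (hlow : ∀ x, ‖x‖ ≤ c * ‖resSq M x‖) {t : ℝ}
    (ht : ¬ IsUnit (algebraMap ℂ (V →L[ℂ] V) t - resSq M)) : c⁻¹ ≤ t ∧ t ≤ 1 := by
  have h1 : ∃ x : V, x ≠ 0 ∧ resSq M x = (t : ℂ) • x := by
    by_contra! hcon
    apply ht
    set B := algebraMap ℂ (V →L[ℂ] V) t - resSq M with hB
    have hBx : ∀ x, B x = (t : ℂ) • x - resSq M x := fun x => rfl
    have hinj : Function.Injective B := by
      refine (injective_iff_map_eq_zero B).2 fun x hx => ?_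
      by_contra hx0
      rw [hBx, sub_eq_zero] at hx
      exact hcon x hx0 hx.symm
    exact ContinuousLinearMap.isUnit_iff_bijective.2
      ⟨hinj, (LinearMap.injective_iff_surjective (f := B.toLinearMap)).1 hinj⟩
  obtain ⟨x, hx0, hx⟩ := h1
  have hxn : 0 < ‖x‖ := norm_pos_iff.2 hx0
  have hn : ‖resSq M x‖ = |t| * ‖x‖ := by
    rw [hx, norm_smul, Complex.norm_real, Real.norm_eq_abs]
  have h2 : c⁻¹ ≤ |t| := by
    have h3 := hlow x
    rw [hn] at h3
    have h4 : 1 * ‖x‖ ≤ c * |t| * ‖x‖ := by linarith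
    rw [inv_le_iff_one_le_mul₀' hc]
    exact le_of_mul_le_mul_right h4 hxn
  have h3 : |t| ≤ 1 := by
    have h4 := norm_resSq_apply_le hM x
    rw [hn] at h4
    exact le_of_mul_le_mul_right (by linarith) hxn
  have h4 : 0 ≤ t := by
    have h5 := sq_add_one_resSq_apply hM x
    rw [hx, map_smul, map_smul, ← smul_add] at h5
    have h6 : (t : ℂ) * (inner ℂ (M x) (M x) + inner ℂ x x) = inner ℂ x x := by
      conv_rhs => rw [← h5]
      rw [inner_smul_right, inner_add_right, h5, inner_apply_comm hM]
    rw [inner_self_eq_norm_sq_to_K, inner_self_eq_norm_sq_to_K] at h6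
    have h7 : t * (‖M x‖ ^ 2 + ‖x‖ ^ 2) = ‖x‖ ^ 2 := by
      apply Complex.ofReal_injective
      push_cast
      exact h6
    by_contra! hneg
    nlinarith [sq_nonneg ‖M x‖, pow_pos hxn 2]
  rw [abs_of_nonneg h4] at h2 h3
  exact ⟨h2, h3⟩

theorem norm_scaleFun_four_resSq_apply_le {M : V →L[ℂ] V} (hM : IsSelfAdjoint M) {c C : ℝ}
    (hc : 0 < c) (hC : 0 ≤ C) (hlow : ∀ x, ‖x‖ ≤ c * ‖resSq M x‖) (hup : ∀ x, ‖resSq M x‖ ≤ C * ‖x‖)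
    (x : V) : ‖realCfc (scaleFun 4) (resSq M) x‖ ≤ C * ‖x‖ := by
  refine ContinuousLinearMap.le_of_opNorm_le _ (norm_realCfc_le hC fun t ht => ?_) x
  have h1 := mem_Icc_of_not_isUnit_sub_resSq hM hc hlow ht
  have h0 : 0 ≤ t := le_trans (by positivity) h1.1
  refine (scaleFun_four_le h0 h1.2).trans ?_
  have h2 := spectrum.norm_le_norm_mul_of_mem (spectrum.mem_iff.2 ht)
  rw [Complex.norm_real, Real.norm_of_nonneg h0] at h2
  have h3 : ‖resSq M‖ ≤ C := ContinuousLinearMap.opNorm_le_bound _ hC hup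
  have h4 : ‖(1 : V →L[ℂ] V)‖ ≤ 1 := ContinuousLinearMap.norm_id_le
  calc t ≤ ‖resSq M‖ * ‖(1 : V →L[ℂ] V)‖ := h2
    _ ≤ C * 1 := by gcongr
    _ = C := mul_one C

theorem norm_le_norm_scaleFun_resSq_apply {M : V →L[ℂ] V} (hM : IsSelfAdjoint M) (n : ℕ) {s : ℝ}
    (hs : 0 < s) (hlow : ∀ x, s ^ 2 * ‖x‖ ≤ ‖resSq M x‖) (x : V) :
    (s / 2) ^ ((n : ℝ) / 2) * ‖x‖ ≤ ‖realCfc (scaleFun n) (resSq M) x‖ := by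
  have hlow' : ∀ x, ‖x‖ ≤ (s ^ 2)⁻¹ * ‖resSq M x‖ := fun x => by
    rw [le_inv_mul_iff₀ (by positivity)]
    exact hlow x
  obtain ⟨b, hb1, hb2⟩ := exists_mul_realCfc_eq_one (continuous_scaleFun n)
    (isSelfAdjoint_resSq hM) (m := (s / 2) ^ ((n : ℝ) / 2)) (by positivity) fun t ht => by
      have h1 := mem_Icc_of_not_isUnit_sub_resSq hM (by positivity) hlow' ht
      rw [inv_inv] at h1
      exact rpow_le_scaleFun n hs.le h1.1 h1.2
  have h2 : b (realCfc (scaleFun n) (resSq M) x) = x :=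
    congrArg (fun B : V →L[ℂ] V => B x) hb1
  rw [← le_inv_mul_iff₀ (by positivity)]
  conv_lhs => rw [← h2]
  exact (b.le_opNorm _).trans (by gcongr)

end Bounds

end

end Rashba

open MeasureTheory Filter Topology
open scoped SchwartzMap LineDeriv Laplacian Distributions

namespace Rashba

noncomputable section

/-! ### Structure of the symbol -/

section Structure

/-- The kinetic energy `(2π)² ‖p‖²`. -/
def kin (p : E6) : ℝ := (2 * Real.pi) ^ 2 * ‖p‖ ^ 2

theorem kin_nonneg (p : E6) : 0 ≤ kin p := by unfold kin; positivity

theorem continuous_kin : Continuous kin := by unfold kin; fun_prop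

/-- The sum `M ⊗ 1 + 1 ⊗ N` on `ℂ² ⊗ ℂ²`. -/
def kronSum (M N : Matrix (Fin 2) (Fin 2) ℂ) : Matrix (Fin 2 × Fin 2) (Fin 2 × Fin 2) ℂ :=
  fun i j => M i.1 j.1 * (1 : Matrix (Fin 2) (Fin 2) ℂ) i.2 j.2
    + (1 : Matrix (Fin 2) (Fin 2) ℂ) i.1 j.1 * N i.2 j.2

/-- The spin-orbit coupling of one particle. -/
def soMatrix (z : ℂ) : Matrix (Fin 2) (Fin 2) ℂ := !![0, Complex.I * star z; -(Complex.I * z), 0]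

/-- The symbol of the spin-orbit coupling of two particles. -/
def spinOrbit (p : E6) : C4 →L[ℂ] C4 :=
  Matrix.toEuclideanCLM (𝕜 := ℂ) (kronSum (soMatrix (zFun p.fst)) (soMatrix (zFun p.snd)))

/-- The Zeeman term of two particles. -/
def zeeman : C4 →L[ℂ] C4 :=
  Matrix.toEuclideanCLM (𝕜 := ℂ) (kronSum !![1, 0; 0, -1] !![1, 0; 0, -1])

theorem zFun_add (x y : E3) : zFun (x + y) = zFun x + zFun y := by
  simp [zFun]; ring

theorem zFun_smul (c : ℝ) (x : E3) : zFun (c • x) = c * zFun x := by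
  simp [zFun]; ring

/-- The components of a vector in `ℂ² ⊗ ℂ²`. -/
def mk4 (a b c d : ℂ) : C4 := WithLp.toLp 2 fun s => !![a, b; c, d] s.1 s.2

theorem mk4_eta (x : C4) : mk4 (x (0, 0)) (x (0, 1)) (x (1, 0)) (x (1, 1)) = x := by
  ext ⟨i, j⟩
  fin_cases i <;> fin_cases j <;> rfl

theorem mk4_add (a b c d a' b' c' d' : ℂ) :
    mk4 a b c d + mk4 a' b' c' d' = mk4 (a + a') (b + b') (c + c') (d + d') := by
  ext ⟨i, j⟩
  fin_cases i <;> fin_cases j <;> rfl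

theorem smul_mk4 (r a b c d : ℂ) : r • mk4 a b c d = mk4 (r * a) (r * b) (r * c) (r * d) := by
  ext ⟨i, j⟩
  fin_cases i <;> fin_cases j <;> rfl

theorem norm_sq_mk4 (a b c d : ℂ) :
    ‖mk4 a b c d‖ ^ 2 = ‖a‖ ^ 2 + ‖b‖ ^ 2 + ‖c‖ ^ 2 + ‖d‖ ^ 2 := by
  rw [EuclideanSpace.norm_sq_eq, Fintype.sum_prod_type]
  simp [mk4, Fin.sum_univ_two, add_assoc]

theorem inner_mk4 (a b c d a' b' c' d' : ℂ) : inner ℂ (mk4 a b c d) (mk4 a' b' c' d')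
    = star a * a' + star b * b' + star c * c' + star d * d' := by
  rw [PiLp.inner_apply, Fintype.sum_prod_type]
  simp [mk4, Fin.sum_univ_two, add_assoc, mul_comm]

theorem zeeman_mk4 (a b c d : ℂ) : zeeman (mk4 a b c d) = mk4 (2 * a) 0 0 (-2 * d) := by
  ext ⟨i, j⟩
  rw [zeeman, toEuclideanCLM_apply_apply, Fintype.sum_prod_type]
  revert i j
  simp only [Fin.sum_univ_two, Fin.forall_fin_two]
  refine ⟨⟨?_, ?_⟩, ?_, ?_⟩ <;> norm_num [kronSum, mk4]

theorem spinOrbit_mk4 (p : E6) (a b c d : ℂ) : spinOrbit p (mk4 a b c d) =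
    mk4 (Complex.I * (star (zFun p.fst) * c + star (zFun p.snd) * b))
      (Complex.I * (star (zFun p.fst) * d - zFun p.snd * a))
      (Complex.I * (star (zFun p.snd) * d - zFun p.fst * a))
      (-Complex.I * (zFun p.fst * b + zFun p.snd * c)) := by
  ext ⟨i, j⟩
  rw [spinOrbit, toEuclideanCLM_apply_apply, Fintype.sum_prod_type]
  revert i j
  simp only [Fin.sum_univ_two, Fin.forall_fin_two]
  refine ⟨⟨?_, ?_⟩, ?_, ?_⟩ <;> simp [kronSum, soMatrix, mk4] <;> ring

theorem twoOp_mk4 (α β : ℝ) (p : E6) (a b c d : ℂ) : twoOp α β p (mk4 a b c d) =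
    (kin p : ℂ) • mk4 a b c d + ((α : ℂ) • spinOrbit p (mk4 a b c d)
      + (β : ℂ) • zeeman (mk4 a b c d)) := by
  have hk : (kin p : ℂ) = (((2 * Real.pi) ^ 2 * ‖p.fst‖ ^ 2 : ℝ) : ℂ)
      + (((2 * Real.pi) ^ 2 * ‖p.snd‖ ^ 2 : ℝ) : ℂ) := by
    rw [kin, WithLp.prod_norm_sq_eq_of_L2]
    push_cast
    ring
  rw [spinOrbit_mk4, zeeman_mk4, smul_mk4, smul_mk4, smul_mk4, mk4_add, mk4_add, hk]
  ext ⟨i, j⟩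
  rw [twoOp, toEuclideanCLM_apply_apply, Fintype.sum_prod_type]
  revert i j
  simp only [Fin.sum_univ_two, Fin.forall_fin_two]
  refine ⟨⟨?_, ?_⟩, ?_, ?_⟩ <;>
    simp [twoSymbol, oneSymbol, Splus, Sminus, S1, S2, S3, mk4] <;> ring_nf <;> simp <;> ring

theorem twoOp_eq (α β : ℝ) (p : E6) (x : C4) : twoOp α β p x =
    (kin p : ℂ) • x + ((α : ℂ) • spinOrbit p + (β : ℂ) • zeeman) x := by
  rw [← mk4_eta x]
  exact twoOp_mk4 α β p _ _ _ _

theorem spinOrbit_add (p q : E6) : spinOrbit (p + q) = spinOrbit p + spinOrbit q := by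
  ext1 x
  rw [_root_.add_apply, ← mk4_eta x, spinOrbit_mk4, spinOrbit_mk4, spinOrbit_mk4, mk4_add]
  simp only [WithLp.add_fst, WithLp.add_snd, zFun_add, star_add]
  congr 1 <;> ring

theorem spinOrbit_smul (c : ℝ) (p : E6) : spinOrbit (c • p) = c • spinOrbit p := by
  ext1 x
  rw [_root_.smul_apply, ← Complex.coe_smul, ← mk4_eta x, spinOrbit_mk4, spinOrbit_mk4, smul_mk4]
  simp only [WithLp.smul_fst, WithLp.smul_snd, zFun_smul, star_mul', Complex.star_def,
    Complex.conj_ofReal]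
  congr 1 <;> ring

theorem exists_norm_le_of_linear {E F : Type*} [NormedAddCommGroup E] [NormedSpace ℝ E]
    [FiniteDimensional ℝ E] [NormedAddCommGroup F] [NormedSpace ℝ F] (f : E →ₗ[ℝ] F) :
    ∃ C, 0 ≤ C ∧ ∀ x, ‖f x‖ ≤ C * ‖x‖ :=
  ⟨‖LinearMap.toContinuousLinearMap f‖, norm_nonneg _,
    (LinearMap.toContinuousLinearMap f).le_opNorm⟩

theorem exists_norm_spinOrbit_le : ∃ C, 0 ≤ C ∧ ∀ p, ‖spinOrbit p‖ ≤ C * ‖p‖ :=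
  exists_norm_le_of_linear (⟨⟨spinOrbit, spinOrbit_add⟩, spinOrbit_smul⟩ : E6 →ₗ[ℝ] C4 →L[ℂ] C4)

/-- A first order term is controlled by the square root of the kinetic energy. Uniformity in `|α| ≤
α₀` is what later makes the error of the expansion uniform. -/
theorem exists_norm_coupling_le (α₀ β : ℝ) (hα₀ : 0 ≤ α₀) : ∃ K, 0 ≤ K ∧ ∀ α, |α| ≤ α₀ → ∀ p x,
    ‖((α : ℂ) • spinOrbit p + (β : ℂ) • zeeman) x‖ ≤ K * Real.sqrt (1 + kin p) * ‖x‖ := by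
  obtain ⟨C, hC0, hC⟩ := exists_norm_spinOrbit_le
  refine ⟨α₀ * C + |β| * ‖zeeman‖, by positivity, fun α hα p x => ?_⟩
  refine ContinuousLinearMap.le_of_opNorm_le _ ?_ x
  have h1 : 1 ≤ Real.sqrt (1 + kin p) := Real.one_le_sqrt.2 (by linarith [kin_nonneg p])
  have h2 : ‖p‖ ≤ Real.sqrt (1 + kin p) := by
    refine Real.le_sqrt_of_sq_le ?_
    have h3 : 1 ≤ (2 * Real.pi) ^ 2 := one_le_pow₀ (by linarith [Real.pi_gt_three])
    have h4 := le_mul_of_one_le_left (sq_nonneg ‖p‖) h3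
    unfold kin
    linarith
  refine (norm_add_le _ _).trans ?_
  rw [norm_smul, norm_smul, Complex.norm_real, Complex.norm_real, add_mul]
  refine add_le_add ?_ ?_
  · calc ‖α‖ * ‖spinOrbit p‖ ≤ α₀ * (C * Real.sqrt (1 + kin p)) := by
          gcongr
          · exact hα
          · exact (hC p).trans (by gcongr)
      _ = _ := by ring
  · exact le_mul_of_one_le_right (by positivity) h1

/-- Uniform two-sided bounds for `(M² + 1)⁻¹`. -/
theorem exists_norm_resSq_bounds (α₀ β : ℝ) (hα₀ : 0 ≤ α₀) : ∃ c C, 0 < c ∧ 0 < C ∧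
    ∀ α, |α| ≤ α₀ → ∀ p x, (1 + kin p) ^ 2 * ‖resSq (twoOp α β p) x‖ ≤ C * ‖x‖ ∧
      ‖x‖ ≤ c * (1 + kin p) ^ 2 * ‖resSq (twoOp α β p) x‖ := by
  obtain ⟨K, hK0, hK⟩ := exists_norm_coupling_le α₀ β hα₀
  refine ⟨(K + 1) ^ 2 + 1, 16 * (K + 1) ^ 4, by positivity, by positivity, fun α hα p x => ⟨?_, ?_⟩⟩
  · exact norm_resSq_apply_le_of_decomp (isSelfAdjoint_twoOp α β p) (twoOp_eq α β p) (kin_nonneg p)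
      hK0 (hK α hα p) x
  · exact norm_le_norm_resSq_apply_of_decomp (isSelfAdjoint_twoOp α β p) (twoOp_eq α β p)
      (kin_nonneg p) hK0 (hK α hα p) x

theorem one_add_kin_le (p : E6) : 1 + kin p ≤ (2 * Real.pi) ^ 2 * (1 + ‖p‖ ^ 2) := by
  have h3 : 1 ≤ (2 * Real.pi) ^ 2 := one_le_pow₀ (by linarith [Real.pi_gt_three])
  unfold kin
  linarith

theorem le_one_add_kin (p : E6) : 1 + ‖p‖ ^ 2 ≤ 1 + kin p := by
  have h3 : 1 ≤ (2 * Real.pi) ^ 2 := one_le_pow₀ (by linarith [Real.pi_gt_three])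
  have h4 := le_mul_of_one_le_left (sq_nonneg ‖p‖) h3
  unfold kin
  linarith

theorem finrank_E6 : Module.finrank ℝ E6 = 6 := by
  rw [(WithLp.linearEquiv 2 ℝ (E3 × E3)).finrank_eq]
  simp

instance : Nontrivial E6 := Module.nontrivial_of_finrank_pos (R := ℝ) (by rw [finrank_E6]; norm_num)

/-- The integrand decays like `‖p‖⁻⁸` in dimension 6. -/
theorem integrable_inv_one_add_kin_pow : Integrable fun p : E6 => ((1 + kin p) ^ 4)⁻¹ := by
  have h1 : Integrable fun p : E6 => (1 + ‖p‖ ^ 2) ^ (-(8 : ℝ) / 2) :=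
    integrable_rpow_neg_one_add_norm_sq (by rw [finrank_E6]; norm_num)
  have hk := continuous_kin
  refine h1.mono' (Continuous.inv₀ (by fun_prop) fun p => by
    have := kin_nonneg p; positivity).aestronglyMeasurable (ae_of_all _ fun p => ?_)
  have h2 := kin_nonneg p
  rw [Real.norm_of_nonneg (by positivity), show (-(8 : ℝ) / 2) = -(4 : ℕ) by norm_num,
    Real.rpow_neg (by positivity), Real.rpow_natCast]
  gcongr
  have := le_one_add_kin p
  linarith

/-- The borderline exponent: in polar coordinates `r⁵ / (1 + r²)³` behaves like `1/r`. -/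
theorem not_integrable_inv_one_add_norm_sq_pow :
    ¬ Integrable fun p : E6 => ((1 + ‖p‖ ^ 2) ^ 3)⁻¹ := by
  intro h
  have h1 := (integrable_fun_norm_addHaar (volume : Measure E6)
    (f := fun r : ℝ => ((1 + r ^ 2) ^ 3)⁻¹)).1 h
  rw [finrank_E6] at h1
  refine not_integrableOn_Ioi_inv (a := 1) ?_
  -- The factor `8` comes from `(1 + y²)³ ≤ (2y²)³ = 8 y⁶` for `y > 1`.
  have h2 : IntegrableOn (fun y : ℝ => 8 * (y ^ (6 - 1) • ((1 + y ^ 2) ^ 3)⁻¹)) (Set.Ioi 1) :=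
    (h1.mono_set (Set.Ioi_subset_Ioi zero_le_one)).const_mul 8
  refine h2.mono' (measurable_inv.aestronglyMeasurable) ?_
  refine (ae_restrict_iff' measurableSet_Ioi).2 (ae_of_all _ fun y (hy : 1 < y) => ?_)
  have hy0 : 0 < y := by linarith
  rw [Real.norm_of_nonneg (by positivity), smul_eq_mul, ← div_eq_mul_inv, ← mul_div_assoc,
    inv_le_iff_one_le_mul₀' hy0, ← mul_div_assoc, one_le_div (by positivity)]
  have h3 : (1 + y ^ 2) ^ 3 ≤ (2 * y ^ 2) ^ 3 := by
    gcongr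
    nlinarith
  calc _ ≤ _ := h3
    _ = _ := by ring

theorem spinVec_norm (σ : Idx) : ‖spinVec σ‖ = 1 := by
  rw [← norm_spinCoupling, spinVec, spinCoupling_spinUncoupling, PiLp.norm_single,
    norm_one]

end Structure

end

end Rashba

open MeasureTheory Filter Topology
open scoped SchwartzMap LineDeriv Laplacian Distributions

namespace Rashba

noncomputable section

/-! ### Regularity and normalization of the point interaction -/

section Regularity

variable (α β : ℝ)

/-- The number `(d (1 + kin p))⁻¹` bounds `√t` from below for every eigenvalue `t` of `(M² + 1)⁻¹`.
That it is at most `1` allows powers of it to be compared by their exponents. -/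
theorem exists_scale_lower_bound : ∃ d, 0 < d ∧ ∀ (n : ℕ) (p : E6) (x : C4),
    ((d * (1 + kin p))⁻¹ / 2) ^ ((n : ℝ) / 2) * ‖x‖
      ≤ ‖realCfc (scaleFun n) (symbol α β).res p x‖ ∧ (d * (1 + kin p))⁻¹ ≤ 1 := by
  obtain ⟨c, C, hc, -, hb⟩ := exists_norm_resSq_bounds |α| β (abs_nonneg α)
  refine ⟨Real.sqrt c, Real.sqrt_pos.2 hc, fun n p x => ?_⟩
  have hk := kin_nonneg p
  have hsc := Real.sqrt_pos.2 hc
  have hlow : ∀ x, ((Real.sqrt c * (1 + kin p))⁻¹) ^ 2 * ‖x‖ ≤ ‖resSq (twoOp α β p) x‖ := by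
    intro x
    rw [inv_pow, inv_mul_le_iff₀ (by positivity), mul_pow, Real.sq_sqrt hc.le]
    exact (hb α le_rfl p x).2
  constructor
  · rw [realCfc_apply_bcf (continuous_scaleFun n) (symbol α β).isSelfAdjoint_res]
    exact norm_le_norm_scaleFun_resSq_apply (isSelfAdjoint_twoOp α β p) n (by positivity) hlow x
  · have h1 := (hlow (spinVec .singlet)).trans
      (norm_resSq_apply_le (isSelfAdjoint_twoOp α β p) (spinVec .singlet))
    rw [spinVec_norm, mul_one] at h1
    exact (sq_le_one_iff₀ (by positivity)).1 h1

theorem isSelfAdjoint_scale_apply (n : ℕ) (p : E6) :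
    IsSelfAdjoint (realCfc (scaleFun n) (symbol α β).res p) := by
  rw [realCfc_apply_bcf (continuous_scaleFun n) (symbol α β).isSelfAdjoint_res]
  exact isSelfAdjoint_realCfc _ _

theorem exists_norm_le_norm_scale {n : ℕ} (hn : n ≤ 4) : ∃ C, ∀ (p : E6) (x : C4),
    ‖x‖ ≤ C * (1 + ‖p‖ ^ 2) ^ 2 * ‖realCfc (scaleFun n) (symbol α β).res p x‖ := by
  obtain ⟨d, hd, hb⟩ := exists_scale_lower_bound α β
  refine ⟨4 * d ^ 2 * ((2 * Real.pi) ^ 2) ^ 2, fun p x => ?_⟩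
  obtain ⟨h1, h2⟩ := hb n p x
  have hk := kin_nonneg p
  set s := (d * (1 + kin p))⁻¹ with hs
  have hs0 : 0 < s := by positivity
  -- The base is below `1`, so the larger exponent gives the smaller power; this is where `n ≤ 4`
  -- enters.
  have h3 : (s / 2) ^ 2 ≤ (s / 2) ^ ((n : ℝ) / 2) := by
    rw [← Real.rpow_natCast]
    refine Real.rpow_le_rpow_of_exponent_ge (by positivity) (by linarith) ?_
    have : (n : ℝ) ≤ 4 := by exact_mod_cast hn
    push_cast
    linarith
  have h4 : (s / 2) ^ 2 * ‖x‖ ≤ ‖realCfc (scaleFun n) (symbol α β).res p x‖ :=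
    (mul_le_mul_of_nonneg_right h3 (norm_nonneg x)).trans h1
  have h5 : ‖x‖ = 4 * d ^ 2 * (1 + kin p) ^ 2 * ((s / 2) ^ 2 * ‖x‖) := by
    rw [hs]
    field_simp
    norm_num
  rw [h5]
  calc _ ≤ 4 * d ^ 2 * ((2 * Real.pi) ^ 2 * (1 + ‖p‖ ^ 2)) ^ 2
        * ‖realCfc (scaleFun n) (symbol α β).res p x‖ := by
        gcongr
        exact one_add_kin_le p
    _ = _ := by ring

theorem memNegScale_iff (T : VolEquiv) (σ : Idx) (X : E3) {N : ℝ} (hN : 0 < N) {n : ℕ}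
    (hn : n ≤ 4) : MemNegScale (Hc T α β) testToL2 n (psi σ X N) ↔
      Integrable fun p => ‖realCfc (scaleFun n) (symbol α β).res p (spinVec σ)‖ ^ 2 := by
  obtain ⟨C, hC⟩ := exists_norm_le_norm_scale α β hn
  rw [MemNegScale, absAddOnePow_Hc]
  exact exists_isExtApply_iff T σ X hN _ (isSelfAdjoint_scale_apply α β n) hC

/-- The squared norm is at most a constant times `(1 + kin p)⁻⁴`. -/
theorem memNegScale_four (T : VolEquiv) (σ : Idx) (X : E3) {N : ℝ} (hN : 0 < N) :
    MemNegScale (Hc T α β) testToL2 4 (psi σ X N) := by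
  rw [memNegScale_iff α β T σ X hN le_rfl]
  obtain ⟨c, C, hc, hC, hb⟩ := exists_norm_resSq_bounds |α| β (abs_nonneg α)
  have hcont : Continuous fun p => ‖realCfc (scaleFun 4) (symbol α β).res p (spinVec σ)‖ ^ 2 :=
    (((realCfc (scaleFun 4) (symbol α β).res).continuous.clm_apply continuous_const).norm).pow 2
  refine (integrable_inv_one_add_kin_pow.const_mul (C ^ 2)).mono' hcont.aestronglyMeasurable
    (ae_of_all _ fun p => ?_)
  have hk := kin_nonneg p
  rw [Real.norm_of_nonneg (by positivity),
    realCfc_apply_bcf (continuous_scaleFun 4) (symbol α β).isSelfAdjoint_res]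
  have h1 := norm_scaleFun_four_resSq_apply_le (isSelfAdjoint_twoOp α β p)
    (c := c * (1 + kin p) ^ 2) (C := C * ((1 + kin p) ^ 2)⁻¹) (by positivity) (by positivity)
    (fun x => (hb α le_rfl p x).2) (fun x => by
      have := (hb α le_rfl p x).1
      rw [← le_inv_mul_iff₀ (by positivity)] at this
      exact this.trans_eq (by ring)) (spinVec σ)
  rw [spinVec_norm, mul_one] at h1
  calc _ ≤ (C * ((1 + kin p) ^ 2)⁻¹) ^ 2 := by gcongr; exact h1
    _ = _ := by rw [mul_pow, inv_pow, ← pow_mul]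

/-- The squared norm is at least a constant times `(1 + ‖p‖²)⁻³`. -/
theorem not_memNegScale_three (T : VolEquiv) (σ : Idx) (X : E3) {N : ℝ} (hN : 0 < N) :
    ¬ MemNegScale (Hc T α β) testToL2 3 (psi σ X N) := by
  rw [memNegScale_iff α β T σ X hN (by norm_num)]
  intro h
  obtain ⟨d, hd, hb⟩ := exists_scale_lower_bound α β
  refine not_integrable_inv_one_add_norm_sq_pow
    ((h.const_mul (8 * d ^ 3 * ((2 * Real.pi) ^ 2) ^ 3)).mono'
      (Continuous.inv₀ (by fun_prop) fun p => by positivity).aestronglyMeasurable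
      (ae_of_all _ fun p => ?_))
  obtain ⟨h1, -⟩ := hb 3 p (spinVec σ)
  have hk := kin_nonneg p
  rw [spinVec_norm, mul_one] at h1
  set s := (d * (1 + kin p))⁻¹ with hs
  have hs0 : 0 < s := by positivity
  have h2 : ((s / 2) ^ (((3 : ℕ) : ℝ) / 2)) ^ 2 = (s / 2) ^ 3 := by
    rw [← Real.rpow_natCast, ← Real.rpow_mul (by positivity), ← Real.rpow_natCast]
    norm_num
  have h3 : (s / 2) ^ 3 ≤ ‖realCfc (scaleFun 3) (symbol α β).res p (spinVec σ)‖ ^ 2 := by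
    rw [← h2]
    gcongr
  rw [Real.norm_of_nonneg (by positivity)]
  have h4 : ((1 + kin p) ^ 3)⁻¹ = 8 * d ^ 3 * (s / 2) ^ 3 := by
    rw [hs]
    field_simp
    norm_num
  have h5 : ((1 + ‖p‖ ^ 2) ^ 3)⁻¹ ≤ ((2 * Real.pi) ^ 2) ^ 3 * ((1 + kin p) ^ 3)⁻¹ := by
    rw [← div_eq_mul_inv, inv_le_comm₀ (by positivity) (by positivity), inv_div,
      div_le_iff₀ (by positivity), ← mul_pow]
    have := one_add_kin_le p
    rw [mul_comm]
    gcongr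
  refine h5.trans ?_
  rw [h4]
  calc _ = 8 * d ^ 3 * ((2 * Real.pi) ^ 2) ^ 3 * (s / 2) ^ 3 := by ring
    _ ≤ _ := by gcongr

/-- The squared norm of `((Hᶜ)² + 1)⁻¹ ψ_σ` for `N = 1`. -/
def normSq (σ : Idx) : ℝ := ∫ p, ‖resSq (twoOp α β p) (spinVec σ)‖ ^ 2

theorem continuous_resSq_twoOp : Continuous fun p => resSq (twoOp α β p) :=
  (symbol α β).res.continuous

theorem integrable_normSq (σ : Idx) :
    Integrable fun p => ‖resSq (twoOp α β p) (spinVec σ)‖ ^ 2 := by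
  obtain ⟨c, C, hc, hC, hb⟩ := exists_norm_resSq_bounds |α| β (abs_nonneg α)
  refine (integrable_inv_one_add_kin_pow.const_mul (C ^ 2)).mono'
    (((continuous_resSq_twoOp α β).clm_apply continuous_const).norm.pow 2).aestronglyMeasurable
    (ae_of_all _ fun p => ?_)
  have hk := kin_nonneg p
  have h1 := (hb α le_rfl p (spinVec σ)).1
  rw [spinVec_norm, mul_one, ← le_inv_mul_iff₀ (by positivity)] at h1
  rw [Real.norm_of_nonneg (by positivity)]
  calc _ ≤ (((1 + kin p) ^ 2)⁻¹ * C) ^ 2 := by gcongr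
    _ = _ := by rw [mul_pow, inv_pow, ← pow_mul, mul_comm]

/-- The integrand is continuous, and it is nonzero at `p = 0` because `(M² + 1)⁻¹` is injective. -/
theorem normSq_pos (σ : Idx) : 0 < normSq α β σ := by
  refine integral_pos_of_integrable_nonneg_nonzero
    (((continuous_resSq_twoOp α β).clm_apply continuous_const).norm.pow 2)
    (integrable_normSq α β σ) (fun p => by positivity) (x := 0) ?_
  intro h0
  have h1 := sq_add_one_resSq_apply (isSelfAdjoint_twoOp α β 0) (spinVec σ)
  rw [norm_eq_zero.1 (pow_eq_zero_iff two_ne_zero |>.1 h0)] at h1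
  have h2 := spinVec_norm σ
  rw [← h1] at h2
  simp at h2

theorem isNormalized_iff (T : VolEquiv) (σ : Idx) (X : E3) {N : ℝ} (hN : 0 < N) :
    IsNormalized (Hc T α β) testToL2 (psi σ X N) ↔ N = (Real.sqrt (normSq α β σ))⁻¹ := by
  obtain ⟨c, C, hc, hC, hb⟩ := exists_norm_resSq_bounds |α| β (abs_nonneg α)
  have hI := normSq_pos α β σ
  have h1 := exists_isExtApply_norm_eq_one_iff T σ X hN (symbol α β).res
    (fun p => isSelfAdjoint_resSq (isSelfAdjoint_twoOp α β p))
    (C := c * ((2 * Real.pi) ^ 2) ^ 2) (k := 2) (fun p x => by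
      refine ((hb α le_rfl p x).2).trans ?_
      have h2 := one_add_kin_le p
      have h3 := kin_nonneg p
      calc _ ≤ c * ((2 * Real.pi) ^ 2 * (1 + ‖p‖ ^ 2)) ^ 2 * ‖resSq (twoOp α β p) x‖ := by gcongr
        _ = _ := by rw [Symbol.res_apply, symbol_toFun]; ring) (integrable_normSq α β σ)
  rw [IsNormalized, invSqAddOne_Hc, h1]
  change N ^ 2 * normSq α β σ = 1 ↔ _
  rw [← Real.sqrt_inv, eq_comm (a := N), Real.sqrt_eq_iff_mul_self_eq (by positivity) hN.le, ← sq,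
    inv_eq_iff_eq_inv]
  constructor
  · exact fun h => eq_inv_of_mul_eq_one_right h
  · rintro h
    rw [h, mul_inv_cancel₀ (by positivity)]

theorem inv_sq_inv_sqrt_normSq (σ : Idx) :
    (((Real.sqrt (normSq α β σ))⁻¹) ^ 2)⁻¹ = normSq α β σ := by
  rw [inv_pow, inv_inv, Real.sq_sqrt (normSq_pos α β σ).le]

end Regularity

end

end Rashba

/-! ### Expansion in the spin-orbit coupling -/

open MeasureTheory Filter Topology
open scoped SchwartzMap LineDeriv Laplacian Distributions

namespace Rashba

noncomputable section

/-! ### Second order perturbation theory for `(T² + 1)⁻¹` -/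

section Perturbation

variable {V : Type*} [NormedAddCommGroup V] [InnerProductSpace ℂ V]

/-- `(1 + t²)⁻¹`. -/
def resFun (t : ℝ) : ℝ := (t ^ 2 + 1)⁻¹

/-- The second order coefficient of `‖((M + αW)² + 1)⁻¹ v‖²` for an eigenvector `v` of `M` with
eigenvalue `a` and an eigenvector `W v` of `M` with eigenvalue `b`, divided by `‖W v‖²`. -/
def secondOrder (a b : ℝ) : ℝ :=
  resFun a ^ 2 * ((a + b) ^ 2 * resFun b ^ 2 + 2 * resFun a * ((a + b) ^ 2 * resFun b - 1))

/-- The term of first order of `((M + αW)² + 1)⁻¹ v`, where `B = (M² + 1)⁻¹`. -/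
def pertOne (M W B : V →L[ℂ] V) (v : V) : V := -B (M (W (B v)) + W (M (B v)))

/-- The term of second order of `((M + αW)² + 1)⁻¹ v`, where `B = (M² + 1)⁻¹`. -/
def pertTwo (M W B : V →L[ℂ] V) (v : V) : V :=
  -B (M (W (pertOne M W B v)) + W (M (pertOne M W B v)) + W (W (B v)))

/-- The term of third order of `((M + αW)² + 1)⁻¹ v`, where `B = (M² + 1)⁻¹`. -/
def pertThree (M W B : V →L[ℂ] V) (v : V) : V :=
  -B (M (W (pertTwo M W B v)) + W (M (pertTwo M W B v)) + W (W (pertOne M W B v)))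

theorem norm_add_real_smul_sq (x y : V) (t : ℝ) :
    ‖x + (t : ℂ) • y‖ ^ 2 = ‖x‖ ^ 2 + 2 * (t * (inner ℂ x y : ℂ).re) + t ^ 2 * ‖y‖ ^ 2 := by
  have := norm_add_sq (𝕜 := ℂ) x ((t : ℂ) • y)
  rwa [inner_smul_right, norm_smul, Complex.norm_real, RCLike.re_eq_complex_re,
    Complex.re_ofReal_mul, mul_pow, Real.norm_eq_abs, sq_abs] at this

theorem abs_re_inner_le {x y : V} {A B : ℝ} (hx : ‖x‖ ≤ A) (hy : ‖y‖ ≤ B) :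
    |(inner ℂ x y : ℂ).re| ≤ A * B :=
  (Complex.abs_re_le_norm _).trans ((norm_inner_le_norm _ _).trans
    (mul_le_mul hx hy (norm_nonneg _) ((norm_nonneg _).trans hx)))

theorem norm_add_real_smul_le {x y : V} {t A B : ℝ} (ht : |t| ≤ 1) (hx : ‖x‖ ≤ A) (hy : ‖y‖ ≤ B) :
    ‖x + (t : ℂ) • y‖ ≤ A + B := by
  refine (norm_add_le _ _).trans (add_le_add hx ?_)
  rw [norm_smul, Complex.norm_real, Real.norm_eq_abs]
  exact (mul_le_of_le_one_left (norm_nonneg y) ht).trans hy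

/-- Even and odd orders are orthogonal, so beyond the second order there remains `α⁴` times `‖u₂‖² +
2 Re⟨u₁, u₃⟩ + α² ‖u₃‖² + 2 Re⟨s, r⟩ + α⁴ ‖r‖²`, where `s` is the truncated sum. Since `‖s‖ ≤ 4A`,
the constant is `1 + 2 + 1 + 8 + 1 = 13`. -/
theorem abs_norm_sq_sub_le {u u₀ u₁ u₂ u₃ r : V} {α A : ℝ} (hα : |α| ≤ 1)
    (hu : u = (u₀ + ((α ^ 2 : ℝ) : ℂ) • u₂) + (α : ℂ) • (u₁ + ((α ^ 2 : ℝ) : ℂ) • u₃)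
      + ((α ^ 4 : ℝ) : ℂ) • r)
    (h₀ : ‖u₀‖ ≤ A) (h₁ : ‖u₁‖ ≤ A) (h₂ : ‖u₂‖ ≤ A) (h₃ : ‖u₃‖ ≤ A) (hr : ‖r‖ ≤ A)
    (h₀₁ : inner ℂ u₀ u₁ = (0 : ℂ)) (h₀₃ : inner ℂ u₀ u₃ = (0 : ℂ))
    (h₂₁ : inner ℂ u₂ u₁ = (0 : ℂ)) (h₂₃ : inner ℂ u₂ u₃ = (0 : ℂ)) :
    |‖u‖ ^ 2 - (‖u₀‖ ^ 2 + α ^ 2 * (‖u₁‖ ^ 2 + 2 * (inner ℂ u₀ u₂ : ℂ).re))|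
      ≤ 13 * A ^ 2 * α ^ 4 := by
  have hα2 : α ^ 2 ≤ 1 := (sq_le_one_iff_abs_le_one α).2 hα
  have hα2' : |α ^ 2| ≤ 1 := by rwa [abs_of_nonneg (sq_nonneg α)]
  have hα4 : α ^ 4 ≤ 1 := pow_le_one₀ (n := 2) (sq_nonneg α) hα2 |>.trans_eq' (by ring)
  have b1 := norm_add_real_smul_le hα (norm_add_real_smul_le hα2' h₀ h₂)
    (norm_add_real_smul_le hα2' h₁ h₃)
  have b3 := abs_re_inner_le b1 hr
  have b4 := abs_re_inner_le h₁ h₃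
  have hEO : inner ℂ (u₀ + ((α ^ 2 : ℝ) : ℂ) • u₂) (u₁ + ((α ^ 2 : ℝ) : ℂ) • u₃) = (0 : ℂ) := by
    simp only [inner_add_left, inner_add_right, inner_smul_left, inner_smul_right,
      h₀₁, h₀₃, h₂₁, h₂₃, mul_zero, add_zero]
  have b5 : ‖u₂‖ ^ 2 ≤ A ^ 2 := pow_le_pow_left₀ (norm_nonneg _) h₂ 2
  have b6 : ‖u₃‖ ^ 2 ≤ A ^ 2 := pow_le_pow_left₀ (norm_nonneg _) h₃ 2
  have b7 : ‖r‖ ^ 2 ≤ A ^ 2 := pow_le_pow_left₀ (norm_nonneg _) hr 2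
  have c1 : α ^ 2 * ‖u₃‖ ^ 2 ≤ A ^ 2 := (mul_le_of_le_one_left (sq_nonneg _) hα2).trans b6
  have c2 : α ^ 4 * ‖r‖ ^ 2 ≤ A ^ 2 := (mul_le_of_le_one_left (sq_nonneg _) hα4).trans b7
  have c3 : 0 ≤ α ^ 2 * ‖u₃‖ ^ 2 := by positivity
  have c4 : 0 ≤ α ^ 4 * ‖r‖ ^ 2 := by positivity
  have c5 : 0 ≤ ‖u₂‖ ^ 2 := by positivity
  rw [hu, norm_add_real_smul_sq, norm_add_real_smul_sq (u₀ + _), hEO, norm_add_real_smul_sq u₀,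
    norm_add_real_smul_sq u₁]
  generalize (inner ℂ _ r : ℂ).re = x at *
  generalize (inner ℂ u₁ u₃ : ℂ).re = y at *
  generalize (inner ℂ u₀ u₂ : ℂ).re = w at *
  generalize ‖u₀‖ ^ 2 = a₀ at *
  generalize ‖u₁‖ ^ 2 = a₁ at *
  generalize ‖u₂‖ ^ 2 = a₂ at *
  generalize ‖u₃‖ ^ 2 = a₃ at *
  generalize ‖r‖ ^ 2 = a₄ at *
  have key : a₀ + 2 * (α ^ 2 * w) + (α ^ 2) ^ 2 * a₂ + 2 * (α * (0 : ℂ).re)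
      + α ^ 2 * (a₁ + 2 * (α ^ 2 * y) + (α ^ 2) ^ 2 * a₃) + 2 * (α ^ 4 * x) + (α ^ 4) ^ 2 * a₄
      - (a₀ + α ^ 2 * (a₁ + 2 * w))
      = (a₂ + 2 * y + α ^ 2 * a₃ + 2 * x + α ^ 4 * a₄) * α ^ 4 := by
    rw [Complex.zero_re]
    ring
  rw [key, abs_mul, abs_of_nonneg (by positivity : 0 ≤ α ^ 4)]
  refine mul_le_mul_of_nonneg_right ?_ (by positivity)
  rw [abs_le] at b3 b4 ⊢
  constructor <;> linarith

variable [CompleteSpace V]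

/-- `(M + αW)² + 1 = (M² + 1) + α (MW + WM) + α² W²`, and the corrections are defined so that the
orders one to three cancel. Thus the truncated sum is mapped to `v + α⁴ z`, and applying the
resolvent yields the remainder. -/
theorem resSq_add_smul_eq {M W : V →L[ℂ] V} (hM : IsSelfAdjoint M) (hW : IsSelfAdjoint W) (α : ℝ)
    (v : V) : resSq (M + (α : ℂ) • W) v
      = (resSq M v + ((α ^ 2 : ℝ) : ℂ) • pertTwo M W (resSq M) v)
        + (α : ℂ) • (pertOne M W (resSq M) v + ((α ^ 2 : ℝ) : ℂ) • pertThree M W (resSq M) v)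
        + ((α ^ 4 : ℝ) : ℂ) • -resSq (M + (α : ℂ) • W)
          (M (W (pertThree M W (resSq M) v)) + W (M (pertThree M W (resSq M) v))
            + W (W (pertTwo M W (resSq M) v))
            + (α : ℂ) • W (W (pertThree M W (resSq M) v))) := by
  have hT : IsSelfAdjoint (M + (α : ℂ) • W) :=
    hM.add (IsSelfAdjoint.smul (by simp [IsSelfAdjoint]) hW)
  set u₀ := resSq M v with h0
  set u₁ := pertOne M W (resSq M) v with h1
  set u₂ := pertTwo M W (resSq M) v with h2
  set u₃ := pertThree M W (resSq M) v with h3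
  have e0 : M (M u₀) = v - u₀ := eq_sub_of_add_eq (sq_add_one_resSq_apply hM v)
  have e1 : M (M u₁) = -(M (W u₀) + W (M u₀)) - u₁ := by
    refine eq_sub_of_add_eq ?_
    rw [h1, pertOne, map_neg, map_neg, ← neg_add, sq_add_one_resSq_apply hM]
  have e2 : M (M u₂) = -(M (W u₁) + W (M u₁) + W (W u₀)) - u₂ := by
    refine eq_sub_of_add_eq ?_
    rw [h2, pertTwo, map_neg, map_neg, ← neg_add, sq_add_one_resSq_apply hM]
  have e3 : M (M u₃) = -(M (W u₂) + W (M u₂) + W (W u₁)) - u₃ := by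
    refine eq_sub_of_add_eq ?_
    rw [h3, pertThree, map_neg, map_neg, ← neg_add, sq_add_one_resSq_apply hM]
  set T := M + (α : ℂ) • W with hTdef
  have hTx : ∀ x, T x = M x + (α : ℂ) • W x := fun x => rfl
  set S := (u₀ + ((α ^ 2 : ℝ) : ℂ) • u₂) + (α : ℂ) • (u₁ + ((α ^ 2 : ℝ) : ℂ) • u₃) with hS
  set z := M (W u₃) + W (M u₃) + W (W u₂) + (α : ℂ) • W (W u₃) with hz
  have hTS : T (T S) + S = v + ((α ^ 4 : ℝ) : ℂ) • z := by
    rw [hTx, hTx]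
    simp only [hS, hz, map_add, map_smul, e0, e1, e2, e3]
    push_cast
    module
  have h5 := resSq_apply_sq_add_one hT S
  rw [hTS, map_add, map_smul] at h5
  rw [smul_neg, ← h5]
  abel

/-- Second order expansion of `‖((M + αW)² + 1)⁻¹ v‖²`, where the first order term vanishes by
parity. -/
theorem abs_norm_resSq_sq_sub_le {M W : V →L[ℂ] V} (hM : IsSelfAdjoint M) (hW : IsSelfAdjoint W)
    {α C r : ℝ} (hα : |α| ≤ 1) (hC : 1 ≤ C) (hr : 0 < r)
    (hb₀ : ∀ x, ‖resSq M x‖ ≤ C * r * ‖x‖)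
    (hb : ∀ x, ‖resSq (M + (α : ℂ) • W) x‖ ≤ C * r * ‖x‖)
    (hX₁ : ∀ x, ‖M (W x) + W (M x)‖ ≤ C * r⁻¹ * ‖x‖) (hX₂ : ∀ x, ‖W (W x)‖ ≤ C * r⁻¹ * ‖x‖)
    {K K' : Submodule ℂ V} (hKK' : ∀ x ∈ K, ∀ y ∈ K', inner ℂ x y = (0 : ℂ))
    (hMK : ∀ x ∈ K, M x ∈ K) (hMK' : ∀ x ∈ K', M x ∈ K') (hWK : ∀ x ∈ K, W x ∈ K')
    (hWK' : ∀ x ∈ K', W x ∈ K) (hbK : ∀ x ∈ K, resSq M x ∈ K) (hbK' : ∀ x ∈ K', resSq M x ∈ K')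
    {v : V} (hv : v ∈ K) (hv1 : ‖v‖ ≤ 1) :
    |‖resSq (M + (α : ℂ) • W) v‖ ^ 2 - (‖resSq M v‖ ^ 2
      + α ^ 2 * (‖pertOne M W (resSq M) v‖ ^ 2
        + 2 * (inner ℂ (resSq M v) (pertTwo M W (resSq M) v) : ℂ).re))|
      ≤ 13 * (2 * C * (2 * C ^ 2 + 1) ^ 4 * r) ^ 2 * α ^ 4 := by
  have hC0 : 0 < C := by linarith
  have m₀ : resSq M v ∈ K := hbK v hv
  have m₁ : pertOne M W (resSq M) v ∈ K' :=
    neg_mem (hbK' _ (add_mem (hMK' _ (hWK _ m₀)) (hWK _ (hMK _ m₀))))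
  have m₂ : pertTwo M W (resSq M) v ∈ K :=
    neg_mem (hbK _ (add_mem (add_mem (hMK _ (hWK' _ m₁)) (hWK' _ (hMK' _ m₁)))
      (hWK' _ (hWK _ m₀))))
  have m₃ : pertThree M W (resSq M) v ∈ K' :=
    neg_mem (hbK' _ (add_mem (add_mem (hMK' _ (hWK _ m₂)) (hWK _ (hMK _ m₂)))
      (hWK _ (hWK' _ m₁))))
  -- A resolvent contributes `C r`, an anticommutator or `W²` contributes `C r⁻¹`; the powers of `r`
  -- cancel in each step of the recursion.
  have step : ∀ B : V →L[ℂ] V, (∀ x, ‖B x‖ ≤ C * r * ‖x‖) → ∀ x t,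
      ‖x‖ ≤ C * r⁻¹ * t → ‖-B x‖ ≤ C ^ 2 * t := by
    intro B hB x t hx
    rw [norm_neg]
    calc ‖B x‖ ≤ C * r * (C * r⁻¹ * t) := (hB x).trans (by gcongr)
      _ = C ^ 2 * t := by field_simp
  -- `q` satisfies `C² ≤ q` and `C² (q + 1) ≤ q²`, so it absorbs one step of the recursion and the
  -- correction of order `k` is at most `C r q^k`.
  set q := 2 * C ^ 2 + 1 with hq
  have hq1 : 1 ≤ q := by nlinarith [sq_nonneg C]
  have n₀ : ‖resSq M v‖ ≤ C * r := (hb₀ v).trans (mul_le_of_le_one_right (by positivity) hv1)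
  have n₁ : ‖pertOne M W (resSq M) v‖ ≤ C * r * q := by
    refine (step _ hb₀ _ (C * r) ((hX₁ _).trans (by gcongr))).trans ?_
    rw [mul_comm]
    gcongr
    linarith [sq_nonneg C]
  have n₂ : ‖pertTwo M W (resSq M) v‖ ≤ C * r * q ^ 2 := by
    refine (step _ hb₀ _ (C * r * q + C * r) ((norm_add_le _ _).trans ?_)).trans ?_
    · rw [mul_add (C * r⁻¹)]
      exact add_le_add ((hX₁ _).trans (by gcongr)) ((hX₂ _).trans (by gcongr))
    · have : C ^ 2 * (C * r * q + C * r) = C * r * (C ^ 2 * q + C ^ 2) := by ring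
      rw [this]
      gcongr
      nlinarith [sq_nonneg C]
  have n₃ : ‖pertThree M W (resSq M) v‖ ≤ C * r * q ^ 3 := by
    refine (step _ hb₀ _ (C * r * q ^ 2 + C * r * q) ((norm_add_le _ _).trans ?_)).trans ?_
    · rw [mul_add (C * r⁻¹)]
      exact add_le_add ((hX₁ _).trans (by gcongr)) ((hX₂ _).trans (by gcongr))
    · have : C ^ 2 * (C * r * q ^ 2 + C * r * q) = C * r * ((C ^ 2 * q + C ^ 2) * q) := by ring
      rw [this, pow_succ]
      gcongr
      nlinarith [sq_nonneg C]
  have hA : ∀ k ≤ 4, C * r * q ^ k ≤ 2 * C * q ^ 4 * r := fun k hk => by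
    have h1 : q ^ k ≤ q ^ 4 := pow_le_pow_right₀ hq1 hk
    calc C * r * q ^ k ≤ C * r * q ^ 4 := by gcongr
      _ ≤ 2 * (C * r * q ^ 4) := by linarith [show 0 < C * r * q ^ 4 by positivity]
      _ = _ := by ring
  refine abs_norm_sq_sub_le hα (resSq_add_smul_eq hM hW α v)
    (n₀.trans ((by simp : C * r ≤ C * r * q ^ 0).trans (hA 0 (by norm_num))))
    (n₁.trans ((by simp : C * r * q ≤ C * r * q ^ 1).trans (hA 1 (by norm_num))))
    (n₂.trans (hA 2 (by norm_num))) (n₃.trans (hA 3 (by norm_num))) ?_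
    (hKK' _ m₀ _ m₁) (hKK' _ m₀ _ m₃) (hKK' _ m₂ _ m₁) (hKK' _ m₂ _ m₃)
  refine (step _ hb _ (C * r * q ^ 3 + C * r * q ^ 2 + C * r * q ^ 3)
    ((norm_add_le _ _).trans ?_)).trans ?_
  · rw [mul_add (C * r⁻¹), mul_add (C * r⁻¹)]
    refine add_le_add ((norm_add_le _ _).trans (add_le_add ((hX₁ _).trans (by gcongr))
      ((hX₂ _).trans (by gcongr)))) ?_
    rw [norm_smul, Complex.norm_real, Real.norm_eq_abs]
    exact (mul_le_of_le_one_left (norm_nonneg _) hα).trans ((hX₂ _).trans (by gcongr))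
  · have h1 : C ^ 2 * (C * r * q ^ 3 + C * r * q ^ 2 + C * r * q ^ 3)
        = C * r * (q ^ 2 * (2 * (C ^ 2 * q) + C ^ 2)) := by ring
    have h2 : 2 * C * q ^ 4 * r = C * r * (q ^ 2 * (2 * q ^ 2)) := by ring
    rw [h1, h2]
    gcongr
    nlinarith [sq_nonneg C]

theorem resSq_apply_of_eigenvector {M : V →L[ℂ] V} (hM : IsSelfAdjoint M) {a : ℝ} {v : V}
    (hv : M v = (a : ℂ) • v) : resSq M v = (resFun a : ℂ) • v := by
  have h1 := resSq_apply_sq_add_one hM ((resFun a : ℂ) • v)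
  have ha : ((a : ℂ) ^ 2 + 1) ≠ 0 := by
    have : (a ^ 2 + 1 : ℝ) ≠ 0 := by positivity
    exact_mod_cast this
  have h2 : M (M ((resFun a : ℂ) • v)) + (resFun a : ℂ) • v = v := by
    rw [map_smul, map_smul, hv, map_smul, hv, smul_smul, smul_smul, ← add_smul]
    have : (resFun a : ℂ) * (a * a) + resFun a = 1 := by
      rw [resFun]
      push_cast
      field_simp
    rw [mul_assoc, this, one_smul]
  rwa [h2] at h1

/-- The second order term for an eigenvector `v` whose image under the perturbation is the sum of
two orthogonal eigenvectors. -/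
theorem norm_sq_pertOne_add_inner_pertTwo {M W : V →L[ℂ] V} (hM : IsSelfAdjoint M)
    (hW : IsSelfAdjoint W) {a b₁ b₂ : ℝ} {v w₁ w₂ : V} (hv : M v = (a : ℂ) • v)
    (hw : W v = w₁ + w₂) (hw₁ : M w₁ = (b₁ : ℂ) • w₁) (hw₂ : M w₂ = (b₂ : ℂ) • w₂)
    (h12 : inner ℂ w₁ w₂ = (0 : ℂ)) :
    ‖pertOne M W (resSq M) v‖ ^ 2
        + 2 * (inner ℂ (resSq M v) (pertTwo M W (resSq M) v) : ℂ).re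
      = ‖w₁‖ ^ 2 * secondOrder a b₁ + ‖w₂‖ ^ 2 * secondOrder a b₂ := by
  have h21 : inner ℂ w₂ w₁ = (0 : ℂ) := inner_eq_zero_symm.1 h12
  have hb : resSq M v = (resFun a : ℂ) • v := resSq_apply_of_eigenvector hM hv
  have hb₁ : resSq M w₁ = (resFun b₁ : ℂ) • w₁ := resSq_apply_of_eigenvector hM hw₁
  have hb₂ : resSq M w₂ = (resFun b₂ : ℂ) • w₂ := resSq_apply_of_eigenvector hM hw₂
  have h1 : pertOne M W (resSq M) v
      = ((-(resFun a * (a + b₁) * resFun b₁) : ℝ) : ℂ) • w₁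
        + ((-(resFun a * (a + b₂) * resFun b₂) : ℝ) : ℂ) • w₂ := by
    rw [pertOne, hb]
    simp only [map_smul, hv, hw, map_add, hw₁, hw₂, hb₁, hb₂, smul_add]
    push_cast
    module
  have hsa := fun x y : V => ContinuousLinearMap.isSelfAdjoint_iff_isSymmetric.1 hM x y
  have hsw := fun x y : V => ContinuousLinearMap.isSelfAdjoint_iff_isSymmetric.1 hW x y
  have hsb := fun x y : V =>
    ContinuousLinearMap.isSelfAdjoint_iff_isSymmetric.1 (isSelfAdjoint_resSq hM) x y
  have e1 : inner ℂ v (W w₁) = ((‖w₁‖ ^ 2 : ℝ) : ℂ) := by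
    have := hsw v w₁
    simp only [ContinuousLinearMap.coe_coe] at this
    rw [← this, hw, inner_add_left, h21, add_zero, inner_self_eq_norm_sq_to_K]
    push_cast
    rfl
  have e2 : inner ℂ v (W w₂) = ((‖w₂‖ ^ 2 : ℝ) : ℂ) := by
    have := hsw v w₂
    simp only [ContinuousLinearMap.coe_coe] at this
    rw [← this, hw, inner_add_left, h12, zero_add, inner_self_eq_norm_sq_to_K]
    push_cast
    rfl
  have e3 : ∀ x, inner ℂ v (M x) = (a : ℂ) * inner ℂ v x := fun x => by
    have := hsa v x
    simp only [ContinuousLinearMap.coe_coe] at this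
    rw [← this, hv, inner_smul_left, Complex.conj_ofReal]
  have e4 : ∀ x, inner ℂ (resSq M v) (resSq M x) = ((resFun a ^ 2 : ℝ) : ℂ) * inner ℂ v x :=
    fun x => by
      have := hsb (resSq M v) x
      simp only [ContinuousLinearMap.coe_coe] at this
      rw [← this, hb, map_smul, hb, smul_smul, inner_smul_left, map_mul, Complex.conj_ofReal]
      push_cast
      ring
  have h2 : inner ℂ (resSq M v) (pertTwo M W (resSq M) v)
      = ((resFun a ^ 3 * (((a + b₁) ^ 2 * resFun b₁ - 1) * ‖w₁‖ ^ 2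
        + ((a + b₂) ^ 2 * resFun b₂ - 1) * ‖w₂‖ ^ 2) : ℝ) : ℂ) := by
    rw [pertTwo, inner_neg_right, e4, h1, hb]
    simp only [map_smul, map_add, hw, hw₁, hw₂, inner_add_right, inner_smul_right, e3, e1, e2]
    push_cast
    ring
  have h3 : ‖pertOne M W (resSq M) v‖ ^ 2
      = (resFun a * (a + b₁) * resFun b₁) ^ 2 * ‖w₁‖ ^ 2
        + (resFun a * (a + b₂) * resFun b₂) ^ 2 * ‖w₂‖ ^ 2 := by
    rw [h1, norm_add_real_smul_sq, inner_smul_left, h12, mul_zero, norm_smul, Complex.norm_real,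
      Real.norm_eq_abs, mul_pow, sq_abs]
    simp only [Complex.zero_re]
    ring
  rw [h2, h3, Complex.ofReal_re, secondOrder, secondOrder]
  ring

end Perturbation

end

end Rashba

open MeasureTheory Filter Topology
open scoped SchwartzMap LineDeriv Laplacian Distributions

namespace Rashba

noncomputable section

/-! ### Expansion of the normalization integral -/

section Expansion

theorem twoOp_eq_add (α β : ℝ) (p : E6) :
    twoOp α β p = twoOp 0 β p + (α : ℂ) • spinOrbit p := by
  ext1 x
  rw [_root_.add_apply, twoOp_eq, twoOp_eq]
  simp only [_root_.add_apply, _root_.smul_apply, Complex.ofReal_zero, zero_smul, zero_add]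
  abel

theorem isSelfAdjoint_sub {V : Type*} [NormedAddCommGroup V] [InnerProductSpace ℂ V]
    [CompleteSpace V] {A B : V →L[ℂ] V} (hA : IsSelfAdjoint A) (hB : IsSelfAdjoint B) :
    IsSelfAdjoint (A - B) := hA.sub hB

theorem isSelfAdjoint_spinOrbit (p : E6) : IsSelfAdjoint (spinOrbit p) := by
  have h1 := isSelfAdjoint_sub (isSelfAdjoint_twoOp 1 0 p) (isSelfAdjoint_twoOp 0 0 p)
  rwa [twoOp_eq_add 1 0 p, Complex.ofReal_one, one_smul, add_sub_cancel_left] at h1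

theorem twoOp_zero_mk4 (β : ℝ) (p : E6) (a b c d : ℂ) : twoOp 0 β p (mk4 a b c d) =
    mk4 (((kin p + 2 * β : ℝ) : ℂ) * a) (kin p * b) (kin p * c)
      (((kin p + -(2 * β) : ℝ) : ℂ) * d) := by
  rw [twoOp_mk4, zeeman_mk4, Complex.ofReal_zero, zero_smul, zero_add, smul_mk4, smul_mk4, mk4_add]
  push_cast
  congr 1 <;> ring

theorem resSq_twoOp_zero_mk4 (β : ℝ) (p : E6) (a b c d : ℂ) :
    resSq (twoOp 0 β p) (mk4 a b c d) =
      mk4 (resFun (kin p + 2 * β) * a) (resFun (kin p) * b) (resFun (kin p) * c)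
        (resFun (kin p + -(2 * β)) * d) := by
  have hs := isSelfAdjoint_twoOp 0 β p
  have h1 : resSq (twoOp 0 β p) (mk4 a 0 0 0) = (resFun (kin p + 2 * β) : ℂ) • mk4 a 0 0 0 :=
    resSq_apply_of_eigenvector hs (by simp only [twoOp_zero_mk4, smul_mk4, mul_zero])
  have h2 : resSq (twoOp 0 β p) (mk4 0 b c 0) = (resFun (kin p) : ℂ) • mk4 0 b c 0 :=
    resSq_apply_of_eigenvector hs (by simp only [twoOp_zero_mk4, smul_mk4, mul_zero])
  have h3 : resSq (twoOp 0 β p) (mk4 0 0 0 d) = (resFun (kin p + -(2 * β)) : ℂ) • mk4 0 0 0 d :=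
    resSq_apply_of_eigenvector hs (by simp only [twoOp_zero_mk4, smul_mk4, mul_zero])
  have h4 : mk4 a b c d = mk4 a 0 0 0 + mk4 0 b c 0 + mk4 0 0 0 d := by simp [mk4_add]
  rw [h4, map_add, map_add, h1, h2, h3]
  simp only [smul_mk4, mk4_add, mul_zero, add_zero, zero_add]

/-- The spinors with even magnetic quantum number difference. -/
def evenSpin : Submodule ℂ C4 where
  carrier := {x | x (0, 1) = 0 ∧ x (1, 0) = 0}
  add_mem' := by rintro x y ⟨h1, h2⟩ ⟨h3, h4⟩; simp [h1, h2, h3, h4]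
  zero_mem' := by simp
  smul_mem' := by rintro c x ⟨h1, h2⟩; simp [h1, h2]

/-- The spinors with vanishing magnetic quantum number. -/
def oddSpin : Submodule ℂ C4 where
  carrier := {x | x (0, 0) = 0 ∧ x (1, 1) = 0}
  add_mem' := by rintro x y ⟨h1, h2⟩ ⟨h3, h4⟩; simp [h1, h2, h3, h4]
  zero_mem' := by simp
  smul_mem' := by rintro c x ⟨h1, h2⟩; simp [h1, h2]

theorem mk4_mem_evenSpin (a b c d : ℂ) : mk4 a b c d ∈ evenSpin ↔ b = 0 ∧ c = 0 := Iff.rfl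

theorem mk4_mem_oddSpin (a b c d : ℂ) : mk4 a b c d ∈ oddSpin ↔ a = 0 ∧ d = 0 := Iff.rfl

theorem exists_mk4_of_mem_evenSpin {x : C4} (hx : x ∈ evenSpin) : ∃ a d, x = mk4 a 0 0 d :=
  ⟨x (0, 0), x (1, 1), by
    have h1 := (mk4_eta x).symm
    rwa [show x (0, 1) = 0 from hx.1, show x (1, 0) = 0 from hx.2] at h1⟩

theorem exists_mk4_of_mem_oddSpin {x : C4} (hx : x ∈ oddSpin) : ∃ b c, x = mk4 0 b c 0 :=
  ⟨x (0, 1), x (1, 0), by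
    have h1 := (mk4_eta x).symm
    rwa [show x (0, 0) = 0 from hx.1, show x (1, 1) = 0 from hx.2] at h1⟩

theorem inner_evenSpin_oddSpin {x y : C4} (hx : x ∈ evenSpin) (hy : y ∈ oddSpin) :
    inner ℂ x y = (0 : ℂ) := by
  obtain ⟨a, d, rfl⟩ := exists_mk4_of_mem_evenSpin hx
  obtain ⟨b, c, rfl⟩ := exists_mk4_of_mem_oddSpin hy
  simp [inner_mk4]

theorem twoOp_zero_mem_evenSpin (β : ℝ) (p : E6) {x : C4} (hx : x ∈ evenSpin) :
    twoOp 0 β p x ∈ evenSpin := by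
  obtain ⟨a, d, rfl⟩ := exists_mk4_of_mem_evenSpin hx
  rw [twoOp_zero_mk4, mk4_mem_evenSpin]
  simp

theorem twoOp_zero_mem_oddSpin (β : ℝ) (p : E6) {x : C4} (hx : x ∈ oddSpin) :
    twoOp 0 β p x ∈ oddSpin := by
  obtain ⟨a, d, rfl⟩ := exists_mk4_of_mem_oddSpin hx
  rw [twoOp_zero_mk4, mk4_mem_oddSpin]
  simp

theorem resSq_twoOp_zero_mem_evenSpin (β : ℝ) (p : E6) {x : C4} (hx : x ∈ evenSpin) :
    resSq (twoOp 0 β p) x ∈ evenSpin := by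
  obtain ⟨a, d, rfl⟩ := exists_mk4_of_mem_evenSpin hx
  rw [resSq_twoOp_zero_mk4, mk4_mem_evenSpin]
  simp

theorem resSq_twoOp_zero_mem_oddSpin (β : ℝ) (p : E6) {x : C4} (hx : x ∈ oddSpin) :
    resSq (twoOp 0 β p) x ∈ oddSpin := by
  obtain ⟨a, d, rfl⟩ := exists_mk4_of_mem_oddSpin hx
  rw [resSq_twoOp_zero_mk4, mk4_mem_oddSpin]
  simp

theorem spinOrbit_mem_oddSpin (p : E6) {x : C4} (hx : x ∈ evenSpin) :
    spinOrbit p x ∈ oddSpin := by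
  obtain ⟨a, d, rfl⟩ := exists_mk4_of_mem_evenSpin hx
  rw [spinOrbit_mk4, mk4_mem_oddSpin]
  simp

theorem spinOrbit_mem_evenSpin (p : E6) {x : C4} (hx : x ∈ oddSpin) :
    spinOrbit p x ∈ evenSpin := by
  obtain ⟨a, d, rfl⟩ := exists_mk4_of_mem_oddSpin hx
  rw [spinOrbit_mk4, mk4_mem_evenSpin]
  simp

theorem norm_le_one_add_kin (p : E6) : ‖p‖ ≤ 1 + kin p := by
  have := le_one_add_kin p
  nlinarith [sq_nonneg (‖p‖ - 1)]

/-- The growth `O(‖p‖)` of `W` is relaxed to `O(1 + kin p)`, which still balances the factor `(1 +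
kin p)⁻²` gained from each resolvent. -/
theorem exists_norm_anticommutator_le (β : ℝ) : ∃ C, ∀ p x,
    ‖twoOp 0 β p (spinOrbit p x) + spinOrbit p (twoOp 0 β p x)‖ ≤ C * (1 + kin p) ^ 2 * ‖x‖ ∧
      ‖spinOrbit p (spinOrbit p x)‖ ≤ C * (1 + kin p) ^ 2 * ‖x‖ := by
  obtain ⟨C, hC0, hC⟩ := exists_norm_spinOrbit_le
  have hW : ∀ p x, ‖spinOrbit p x‖ ≤ C * (1 + kin p) * ‖x‖ := fun p x =>
    (spinOrbit p).le_of_opNorm_le ((hC p).trans (by gcongr; exact norm_le_one_add_kin p)) x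
  have hM : ∀ p x, ‖twoOp 0 β p x‖ ≤ (1 + |β| * ‖zeeman‖) * (1 + kin p) * ‖x‖ := fun p x => by
    have hk := kin_nonneg p
    have h1 : twoOp 0 β p x = (kin p : ℂ) • x + (β : ℂ) • zeeman x := by
      rw [twoOp_eq]
      simp only [_root_.add_apply, _root_.smul_apply, Complex.ofReal_zero, zero_smul, zero_add]
    rw [h1]
    refine (norm_add_le _ _).trans ?_
    rw [norm_smul, norm_smul, Complex.norm_real, Complex.norm_real, Real.norm_of_nonneg hk,
      Real.norm_eq_abs]
    have h2 := mul_le_mul_of_nonneg_left (zeeman.le_opNorm x) (abs_nonneg β)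
    have h3 : 0 ≤ |β| * ‖zeeman‖ * ‖x‖ * kin p := by positivity
    nlinarith [norm_nonneg x]
  set D := 1 + |β| * ‖zeeman‖ with hD
  have hD0 : 0 ≤ D := by positivity
  refine ⟨2 * (D * C) + C * C, fun p x => ?_⟩
  have hk := kin_nonneg p
  have h1 : ‖twoOp 0 β p (spinOrbit p x)‖ ≤ D * C * ((1 + kin p) ^ 2 * ‖x‖) :=
    calc _ ≤ D * (1 + kin p) * (C * (1 + kin p) * ‖x‖) := (hM p _).trans (by gcongr; exact hW p x)
      _ = _ := by ring
  have h2 : ‖spinOrbit p (twoOp 0 β p x)‖ ≤ D * C * ((1 + kin p) ^ 2 * ‖x‖) :=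
    calc _ ≤ C * (1 + kin p) * (D * (1 + kin p) * ‖x‖) := (hW p _).trans (by gcongr; exact hM p x)
      _ = _ := by ring
  have h3 : ‖spinOrbit p (spinOrbit p x)‖ ≤ C * C * ((1 + kin p) ^ 2 * ‖x‖) :=
    calc _ ≤ C * (1 + kin p) * (C * (1 + kin p) * ‖x‖) := (hW p _).trans (by gcongr; exact hW p x)
      _ = _ := by ring
  have h4 : 0 ≤ D * C * ((1 + kin p) ^ 2 * ‖x‖) := by positivity
  have h5 : 0 ≤ C * C * ((1 + kin p) ^ 2 * ‖x‖) := by positivity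
  constructor
  · refine (norm_add_le _ _).trans ?_
    linarith
  · linarith

/-- The coefficient of `α²` in the expansion of `‖((M + αW)² + 1)⁻¹ v‖²`. -/
def pertSecond (β : ℝ) (v : C4) (p : E6) : ℝ :=
  ‖pertOne (twoOp 0 β p) (spinOrbit p) (resSq (twoOp 0 β p)) v‖ ^ 2
    + 2 * (inner ℂ (resSq (twoOp 0 β p) v)
      (pertTwo (twoOp 0 β p) (spinOrbit p) (resSq (twoOp 0 β p)) v) : ℂ).re

/-- The case `r = (1 + kin p)⁻²` of `abs_norm_resSq_sq_sub_le`, with `evenSpin` and `oddSpin` as the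
two sectors in either order. The error is of size `r²`, which is integrable. -/
theorem exists_abs_norm_resSq_sq_sub_le (β : ℝ) : ∃ B, ∀ α, |α| ≤ 1 → ∀ p, ∀ v : C4, ‖v‖ ≤ 1 →
    (v ∈ evenSpin ∨ v ∈ oddSpin) → |‖resSq (twoOp α β p) v‖ ^ 2
      - (‖resSq (twoOp 0 β p) v‖ ^ 2 + α ^ 2 * pertSecond β v p)|
      ≤ B * α ^ 4 * ((1 + kin p) ^ 4)⁻¹ := by
  obtain ⟨c, C₁, -, hC₁, hb⟩ := exists_norm_resSq_bounds 1 β zero_le_one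
  obtain ⟨C₂, hX⟩ := exists_norm_anticommutator_le β
  set C := max 1 (max C₁ C₂) with hC
  have hCC₁ : C₁ ≤ C := (le_max_left _ _).trans (le_max_right _ _)
  have hCC₂ : C₂ ≤ C := (le_max_right _ _).trans (le_max_right _ _)
  refine ⟨13 * (2 * C * (2 * C ^ 2 + 1) ^ 4) ^ 2, fun α hα p v hv1 hv => ?_⟩
  have hk := kin_nonneg p
  set r := ((1 + kin p) ^ 2)⁻¹ with hr
  have hr0 : 0 < r := by positivity
  have hB : ∀ α, |α| ≤ 1 → ∀ x, ‖resSq (twoOp α β p) x‖ ≤ C * r * ‖x‖ := fun α hα x => by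
    have h1 := (hb α hα p x).1
    rw [← le_inv_mul_iff₀ (by positivity), ← hr] at h1
    calc _ ≤ r * (C₁ * ‖x‖) := h1
      _ ≤ r * (C * ‖x‖) := by gcongr
      _ = _ := by ring
  have hX₁ := fun x => (hX p x).1.trans (by gcongr : _ ≤ C * (1 + kin p) ^ 2 * ‖x‖)
  have hX₂ := fun x => (hX p x).2.trans (by gcongr : _ ≤ C * (1 + kin p) ^ 2 * ‖x‖)
  have hri : (1 + kin p) ^ 2 = r⁻¹ := by rw [hr, inv_inv]
  rw [hri] at hX₁ hX₂
  have hB' := hB α hα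
  rw [twoOp_eq_add] at hB' ⊢
  have hfin : 13 * (2 * C * (2 * C ^ 2 + 1) ^ 4) ^ 2 * α ^ 4 * ((1 + kin p) ^ 4)⁻¹
      = 13 * (2 * C * (2 * C ^ 2 + 1) ^ 4 * r) ^ 2 * α ^ 4 := by
    rw [hr, mul_pow _ ((1 + kin p) ^ 2)⁻¹, inv_pow, ← pow_mul]
    ring
  rw [hfin]
  rcases hv with hv | hv
  · exact abs_norm_resSq_sq_sub_le (isSelfAdjoint_twoOp 0 β p) (isSelfAdjoint_spinOrbit p) hα
      (le_max_left _ _) hr0 (hB 0 (by simp)) hB' hX₁ hX₂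
      (fun x hx y hy => inner_evenSpin_oddSpin hx hy)
      (fun x => twoOp_zero_mem_evenSpin β p) (fun x => twoOp_zero_mem_oddSpin β p)
      (fun x => spinOrbit_mem_oddSpin p) (fun x => spinOrbit_mem_evenSpin p)
      (fun x => resSq_twoOp_zero_mem_evenSpin β p) (fun x => resSq_twoOp_zero_mem_oddSpin β p)
      hv hv1
  · exact abs_norm_resSq_sq_sub_le (isSelfAdjoint_twoOp 0 β p) (isSelfAdjoint_spinOrbit p) hα
      (le_max_left _ _) hr0 (hB 0 (by simp)) hB' hX₁ hX₂
      (fun x hx y hy => inner_eq_zero_symm.1 (inner_evenSpin_oddSpin hy hx))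
      (fun x => twoOp_zero_mem_oddSpin β p) (fun x => twoOp_zero_mem_evenSpin β p)
      (fun x => spinOrbit_mem_evenSpin p) (fun x => spinOrbit_mem_oddSpin p)
      (fun x => resSq_twoOp_zero_mem_oddSpin β p) (fun x => resSq_twoOp_zero_mem_evenSpin β p)
      hv hv1

theorem continuous_clm_sub {E V : Type*} [TopologicalSpace E] [NormedAddCommGroup V]
    [NormedSpace ℂ V] {A B : E → V →L[ℂ] V} (hA : Continuous A) (hB : Continuous B) :
    Continuous fun p => A p - B p := hA.sub hB

theorem continuous_spinOrbit : Continuous spinOrbit := by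
  have h1 := continuous_clm_sub (continuous_twoOp 1 0) (continuous_twoOp 0 0)
  have h2 : (fun p => twoOp 1 0 p - twoOp 0 0 p) = spinOrbit := by
    funext p
    rw [twoOp_eq_add 1 0 p, Complex.ofReal_one, one_smul, add_sub_cancel_left]
  rwa [h2] at h1

theorem continuous_pertSecond (β : ℝ) (v : C4) : Continuous (pertSecond β v) := by
  have hM := continuous_twoOp 0 β
  have hW := continuous_spinOrbit
  have hB := continuous_resSq_twoOp 0 β
  have h0 : Continuous fun p => resSq (twoOp 0 β p) v := hB.clm_apply continuous_const
  have h1 : Continuous fun p => pertOne (twoOp 0 β p) (spinOrbit p) (resSq (twoOp 0 β p)) v :=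
    (hB.clm_apply ((hM.clm_apply (hW.clm_apply h0)).add (hW.clm_apply (hM.clm_apply h0)))).neg
  have h2 : Continuous fun p => pertTwo (twoOp 0 β p) (spinOrbit p) (resSq (twoOp 0 β p)) v :=
    (hB.clm_apply (((hM.clm_apply (hW.clm_apply h1)).add (hW.clm_apply (hM.clm_apply h1))).add
      (hW.clm_apply (hW.clm_apply h0)))).neg
  exact (h1.norm.pow 2).add (continuous_const.mul (Complex.continuous_re.comp (h0.inner h2)))

theorem spinVec_apply (σ : Idx) (i : Fin 2 × Fin 2) : spinVec σ i = star (clebschGordan σ i) := by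
  simp [spinVec, spinUncoupling, Matrix.toLpLin_apply, Matrix.mulVec_single]

theorem spinVec_triplet1 : spinVec .triplet1 = mk4 1 0 0 0 := by
  rw [← mk4_eta (spinVec _)]
  simp only [spinVec_apply]
  simp [clebschGordan]

theorem spinVec_tripletm1 : spinVec .tripletm1 = mk4 0 0 0 1 := by
  rw [← mk4_eta (spinVec _)]
  simp only [spinVec_apply]
  simp [clebschGordan]

theorem spinVec_triplet0 :
    spinVec .triplet0 = mk4 0 (Real.sqrt 2 : ℂ)⁻¹ (Real.sqrt 2 : ℂ)⁻¹ 0 := by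
  rw [← mk4_eta (spinVec _)]
  simp only [spinVec_apply]
  simp [clebschGordan]

theorem spinVec_singlet :
    spinVec .singlet = mk4 0 (Real.sqrt 2 : ℂ)⁻¹ (-(Real.sqrt 2 : ℂ)⁻¹) 0 := by
  rw [← mk4_eta (spinVec _)]
  simp only [spinVec_apply]
  simp [clebschGordan, neg_div]

theorem spinVec_mem (σ : Idx) : spinVec σ ∈ evenSpin ∨ spinVec σ ∈ oddSpin := by
  cases σ
  · exact Or.inl (by rw [spinVec_triplet1, mk4_mem_evenSpin]; simp)
  · exact Or.inr (by rw [spinVec_triplet0, mk4_mem_oddSpin]; simp)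
  · exact Or.inl (by rw [spinVec_tripletm1, mk4_mem_evenSpin]; simp)
  · exact Or.inr (by rw [spinVec_singlet, mk4_mem_oddSpin]; simp)

/-- At `α = 1` the expansion exhibits this function as a difference of integrable functions up to an
integrable error, so it needs no estimate of its own. -/
theorem integrable_pertSecond (σ : Idx) (β : ℝ) : Integrable (pertSecond β (spinVec σ)) := by
  obtain ⟨B, hB⟩ := exists_abs_norm_resSq_sq_sub_le β
  refine (((integrable_normSq 1 β σ).add (integrable_normSq 0 β σ)).add
    (integrable_inv_one_add_kin_pow.const_mul B)).mono'
    (continuous_pertSecond β _).aestronglyMeasurable (ae_of_all _ fun p => ?_)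
  have h1 := hB 1 (by simp) p (spinVec σ) (spinVec_norm σ).le (spinVec_mem σ)
  rw [one_pow, one_pow, one_mul, mul_one] at h1
  simp only [Pi.add_apply]
  have h2 := sq_nonneg ‖resSq (twoOp 1 β p) (spinVec σ)‖
  have h3 := sq_nonneg ‖resSq (twoOp 0 β p) (spinVec σ)‖
  rw [Real.norm_eq_abs]
  rw [abs_le] at h1 ⊢
  constructor <;> linarith

theorem isBigO_normSq (σ : Idx) (β : ℝ) :
    (fun α : ℝ => normSq α β σ - (normSq 0 β σ + α ^ 2 * ∫ p, pertSecond β (spinVec σ) p))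
      =O[𝓝[≥] 0] fun α : ℝ => α ^ 4 := by
  obtain ⟨B, hB⟩ := exists_abs_norm_resSq_sq_sub_le β
  refine Asymptotics.IsBigO.of_bound (B * ∫ p : E6, ((1 + kin p) ^ 4)⁻¹) ?_
  have h1 : ∀ᶠ α : ℝ in 𝓝[≥] 0, |α| ≤ 1 := by
    have : ∀ᶠ α : ℝ in 𝓝 0, |α| < 1 :=
      (continuous_abs.tendsto' (0 : ℝ) 0 abs_zero).eventually_lt_const one_pos
    exact (this.filter_mono nhdsWithin_le_nhds).mono fun _ h => h.le
  filter_upwards [h1] with α hα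
  have h2 : Integrable fun p => α ^ 2 * pertSecond β (spinVec σ) p :=
    (integrable_pertSecond σ β).const_mul _
  have h3 : normSq α β σ - (normSq 0 β σ + α ^ 2 * ∫ p, pertSecond β (spinVec σ) p)
      = ∫ p, (‖resSq (twoOp α β p) (spinVec σ)‖ ^ 2 - (‖resSq (twoOp 0 β p) (spinVec σ)‖ ^ 2
        + α ^ 2 * pertSecond β (spinVec σ) p)) := by
    have h4 : Integrable fun p => ‖resSq (twoOp 0 β p) (spinVec σ)‖ ^ 2
        + α ^ 2 * pertSecond β (spinVec σ) p := (integrable_normSq 0 β σ).add h2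
    rw [integral_sub (integrable_normSq α β σ) h4,
      integral_add (integrable_normSq 0 β σ) h2, integral_const_mul]
    rfl
  rw [h3, Real.norm_of_nonneg (by positivity : 0 ≤ α ^ 4)]
  refine (norm_integral_le_of_norm_le (integrable_inv_one_add_kin_pow.const_mul (B * α ^ 4))
    (ae_of_all _ fun p => ?_)).trans_eq ?_
  · exact hB α hα p _ (spinVec_norm σ).le (spinVec_mem σ)
  · rw [integral_const_mul]
    ring

end Expansion

end

end Rashba

/-! ### Reduction of the coefficients to one-dimensional integrals -/

open MeasureTheory Filter Topology
open scoped SchwartzMap LineDeriv Laplacian Distributions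

namespace Rashba

noncomputable section

/-! ### Radial integrals -/

section Radial

open scoped RealInnerProductSpace

section General

variable {E : Type*} [NormedAddCommGroup E] [InnerProductSpace ℝ E] [FiniteDimensional ℝ E]
  [MeasurableSpace E] [BorelSpace E]

theorem integrable_inner_sq_mul {φ : ℝ → ℝ} (hφ : Continuous φ)
    (hint : Integrable fun p : E => ‖p‖ ^ 2 * φ ‖p‖) {e : E} (he : ‖e‖ = 1) :
    Integrable fun p : E => ⟪e, p⟫ ^ 2 * φ ‖p‖ := by
  refine hint.mono (Continuous.aestronglyMeasurable (by fun_prop)) (ae_of_all _ fun p => ?_)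
  rw [norm_mul, norm_mul]
  refine mul_le_mul_of_nonneg_right ?_ (norm_nonneg _)
  rw [Real.norm_of_nonneg (sq_nonneg _), Real.norm_of_nonneg (sq_nonneg _), ← sq_abs ⟪e, p⟫]
  have h1 := abs_real_inner_le_norm e p
  rw [he, one_mul] at h1
  gcongr

/-- The reflection that sends `e` to `e'` preserves the measure and the norm. -/
theorem integral_inner_sq_mul_eq {φ : ℝ → ℝ} {e e' : E} (he : ‖e‖ = ‖e'‖) :
    ∫ p : E, ⟪e, p⟫ ^ 2 * φ ‖p‖ = ∫ p : E, ⟪e', p⟫ ^ 2 * φ ‖p‖ := by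
  set R := (ℝ ∙ (e - e'))ᗮ.reflection with hR
  have hRe : R e = e' := Submodule.reflection_sub he
  symm
  rw [← R.measurePreserving.integral_comp R.toHomeomorph.measurableEmbedding]
  refine integral_congr_ae (ae_of_all _ fun p => ?_)
  dsimp only
  rw [← hRe, LinearIsometryEquiv.inner_map_map, LinearIsometryEquiv.norm_map]

/-- The average of a quadratic form of rank one over spheres. -/
theorem integral_inner_sq_mul {φ : ℝ → ℝ} (hφ : Continuous φ)
    (hint : Integrable fun p : E => ‖p‖ ^ 2 * φ ‖p‖) {e : E} (he : ‖e‖ = 1) :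
    (Module.finrank ℝ E : ℝ) * ∫ p : E, ⟪e, p⟫ ^ 2 * φ ‖p‖ = ∫ p : E, ‖p‖ ^ 2 * φ ‖p‖ := by
  set b := stdOrthonormalBasis ℝ E with hb
  -- Over an orthonormal basis the squares sum to `‖p‖²`, and by symmetry all summands have the same
  -- integral.
  have h1 : ∫ p : E, ‖p‖ ^ 2 * φ ‖p‖ = ∑ i, ∫ p : E, ⟪b i, p⟫ ^ 2 * φ ‖p‖ := by
    rw [← integral_finsetSum _ fun i _ => integrable_inner_sq_mul hφ hint (b.norm_eq_one i)]
    refine integral_congr_ae (ae_of_all _ fun p => ?_)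
    dsimp only
    rw [← Finset.sum_mul, b.sum_sq_inner_right]
  have h2 : ∀ i, ∫ p : E, ⟪b i, p⟫ ^ 2 * φ ‖p‖ = ∫ p : E, ⟪e, p⟫ ^ 2 * φ ‖p‖ := fun i =>
    integral_inner_sq_mul_eq (by rw [he, b.norm_eq_one])
  rw [h1, Finset.sum_congr rfl fun i _ => h2 i]
  simp

end General

/-- Polar coordinates: the unit ball of `ℝ⁶` has volume `π³/6`, so the sphere contributes `π³`, and
`u = (2π)² r²` turns `r⁵ dr` into `u² du / (2 (2π)⁶)`. -/
theorem integral_kin (Φ : ℝ → ℝ) :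
    ∫ p : E6, Φ (kin p) = 1 / (128 * Real.pi ^ 3) * ∫ u in Set.Ioi (0 : ℝ), u ^ 2 * Φ u := by
  have hπ := Real.pi_pos
  have h1 := integral_fun_norm_addHaar (volume : Measure E6)
    (fun r : ℝ => Φ ((2 * Real.pi) ^ 2 * r ^ 2))
  rw [finrank_E6] at h1
  have hvol : (volume : Measure E6).real (Metric.ball 0 1) = Real.pi ^ 3 / 6 := by
    rw [Measure.real, InnerProductSpace.volume_ball, finrank_E6, ENNReal.ofReal_one, one_pow,
      one_mul, ENNReal.toReal_ofReal (by positivity)]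
    have h2 : Real.sqrt Real.pi ^ 6 = Real.pi ^ 3 := by
      rw [show (6 : ℕ) = 2 * 3 by norm_num, pow_mul, Real.sq_sqrt hπ.le]
    have h3 : Real.Gamma ((6 : ℕ) / 2 + 1) = 6 := by
      rw [show (((6 : ℕ) : ℝ) / 2 + 1) = (3 : ℕ) + 1 by norm_num, Real.Gamma_nat_eq_factorial]
      norm_num [Nat.factorial]
    rw [h2, h3]
  have h4 : ∫ y in Set.Ioi (0 : ℝ), y ^ (6 - 1) • Φ ((2 * Real.pi) ^ 2 * y ^ 2)
      = 1 / 2 * ∫ t in Set.Ioi (0 : ℝ), t ^ 2 * Φ ((2 * Real.pi) ^ 2 * t) := by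
    rw [← integral_comp_rpow_Ioi_of_pos (g := fun t => t ^ 2 * Φ ((2 * Real.pi) ^ 2 * t)) two_pos,
      ← integral_const_mul]
    refine setIntegral_congr_fun measurableSet_Ioi fun y hy => ?_
    rw [show (2 : ℝ) - 1 = 1 by norm_num, Real.rpow_one, Real.rpow_two, smul_eq_mul, smul_eq_mul]
    ring
  have h5 : ∫ t in Set.Ioi (0 : ℝ), t ^ 2 * Φ ((2 * Real.pi) ^ 2 * t)
      = (((2 * Real.pi) ^ 2) ^ 3)⁻¹ * ∫ u in Set.Ioi (0 : ℝ), u ^ 2 * Φ u := by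
    have h6 := integral_comp_mul_left_Ioi (fun u => u ^ 2 * Φ u) 0
      (b := (2 * Real.pi) ^ 2) (by positivity)
    rw [mul_zero, smul_eq_mul] at h6
    have h7 : ∫ t in Set.Ioi (0 : ℝ), t ^ 2 * Φ ((2 * Real.pi) ^ 2 * t)
        = (((2 * Real.pi) ^ 2) ^ 2)⁻¹ * ∫ t in Set.Ioi (0 : ℝ),
          ((2 * Real.pi) ^ 2 * t) ^ 2 * Φ ((2 * Real.pi) ^ 2 * t) := by
      rw [← integral_const_mul]
      refine setIntegral_congr_fun measurableSet_Ioi fun y hy => ?_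
      field_simp
    rw [h7, h6]
    field_simp
  rw [h4, h5, hvol] at h1
  refine h1.trans ?_
  rw [nsmul_eq_mul, smul_eq_mul]
  field_simp
  ring

/-- Integration of a quadratic form that is a sum of squares of unit linear functionals. -/
theorem integral_norm_sq_mul {ι : Type*} [Fintype ι] {φ : ℝ → ℝ} (hφ : Continuous φ)
    (hint : Integrable fun p => kin p * φ (kin p)) {w : E6 → C4} {e : ι → E6}
    (he : ∀ i, ‖e i‖ = 1) (hw : ∀ p, ‖w p‖ ^ 2 = (2 * Real.pi) ^ 2 * ∑ i, ⟪e i, p⟫ ^ 2) :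
    Integrable (fun p => ‖w p‖ ^ 2 * φ (kin p)) ∧
    ∫ p, ‖w p‖ ^ 2 * φ (kin p) = Fintype.card ι / 6 * ∫ p, kin p * φ (kin p) := by
  have hπ := Real.pi_pos
  set ψ : ℝ → ℝ := fun r => (2 * Real.pi) ^ 2 * φ ((2 * Real.pi) ^ 2 * r ^ 2) with hψ
  have hψc : Continuous ψ := by fun_prop
  have h1 : ∀ p : E6, kin p * φ (kin p) = ‖p‖ ^ 2 * ψ ‖p‖ := fun p => by
    simp only [kin, hψ]
    ring
  have h2 : ∀ p : E6, ‖w p‖ ^ 2 * φ (kin p) = ∑ i, ⟪e i, p⟫ ^ 2 * ψ ‖p‖ := fun p => by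
    rw [hw, ← Finset.sum_mul]
    simp only [kin, hψ]
    ring
  simp only [h1] at hint ⊢
  simp only [h2]
  have h3 := fun i => integrable_inner_sq_mul hψc hint (he i)
  refine ⟨integrable_finsetSum _ fun i _ => h3 i, ?_⟩
  rw [integral_finsetSum _ fun i _ => h3 i]
  have h4 : ∀ i, ∫ p, ⟪e i, p⟫ ^ 2 * ψ ‖p‖ = 1 / 6 * ∫ p : E6, ‖p‖ ^ 2 * ψ ‖p‖ := fun i => by
    have h5 := integral_inner_sq_mul hψc hint (he i)
    rw [finrank_E6] at h5
    push_cast at h5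
    linarith
  rw [Finset.sum_congr rfl fun i _ => h4 i, Finset.sum_const, nsmul_eq_mul, Finset.card_univ]
  ring

end Radial

end

end Rashba

open MeasureTheory Filter Topology
open scoped SchwartzMap LineDeriv Laplacian Distributions

namespace Rashba

noncomputable section

/-! ### The coefficients as one-dimensional integrals -/

section Coefficients

open scoped RealInnerProductSpace

theorem resFun_pos (t : ℝ) : 0 < resFun t := by unfold resFun; positivity

theorem continuous_resFun : Continuous resFun := by
  unfold resFun
  exact Continuous.inv₀ (by fun_prop) fun t => by positivity

theorem continuous_secondOrder (a b : ℝ) : Continuous fun u => secondOrder (u + a) (u + b) := by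
  have h := continuous_resFun
  unfold secondOrder
  fun_prop

/-- Square `1 + u ≤ |u + c| + (1 + |c|)`. -/
theorem resFun_add_le (c : ℝ) {u : ℝ} (hu : 0 ≤ u) :
    resFun (u + c) ≤ 2 * (1 + |c|) ^ 2 * ((1 + u) ^ 2)⁻¹ := by
  unfold resFun
  rw [← div_eq_mul_inv, inv_le_comm₀ (by positivity) (by positivity), inv_div,
    div_le_iff₀ (by positivity)]
  have h1 : 1 + u ≤ |u + c| + (1 + |c|) := by
    have := abs_sub_abs_le_abs_sub u (-c)
    rw [abs_neg, sub_neg_eq_add, abs_of_nonneg hu] at this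
    linarith
  have h2 : (1 + u) ^ 2 ≤ (|u + c| + (1 + |c|)) ^ 2 := by gcongr
  have h3 : 1 ≤ (1 + |c|) ^ 2 := one_le_pow₀ (by linarith [abs_nonneg c])
  have h4 : (u + c) ^ 2 * 1 ≤ (u + c) ^ 2 * (1 + |c|) ^ 2 := by gcongr
  nlinarith [sq_nonneg (|u + c| - (1 + |c|)), sq_abs (u + c)]

theorem exists_resFun_sq_le (a : ℝ) :
    ∃ C, ∀ u, 0 ≤ u → |resFun (u + a) ^ 2| ≤ C * ((1 + u) ^ 4)⁻¹ := by
  refine ⟨(2 * (1 + |a|) ^ 2) ^ 2, fun u hu => ?_⟩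
  rw [abs_of_nonneg (by positivity)]
  have h1 := resFun_add_le a hu
  have h2 := (resFun_pos (u + a)).le
  calc resFun (u + a) ^ 2 ≤ (2 * (1 + |a|) ^ 2 * ((1 + u) ^ 2)⁻¹) ^ 2 := by gcongr
    _ = _ := by rw [mul_pow, inv_pow, ← pow_mul]

/-- Each `resFun` is `O((1 + u)⁻²)`, and one of them pays for `(a + b)² = O((1 + u)²)`. Hence
`secondOrder` is `O((1 + u)⁻⁶)`, which leaves room for the factor `u`. -/
theorem exists_secondOrder_le (a b : ℝ) :
    ∃ C, ∀ u, 0 ≤ u → |u * secondOrder (u + a) (u + b)| ≤ C * ((1 + u) ^ 4)⁻¹ := by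
  obtain ⟨A, hA0, hA⟩ : ∃ A, 0 < A ∧ ∀ u, 0 ≤ u → resFun (u + a) ≤ A * ((1 + u) ^ 2)⁻¹ :=
    ⟨_, by positivity, fun u hu => resFun_add_le a hu⟩
  obtain ⟨B, hB0, hB⟩ : ∃ B, 0 < B ∧ ∀ u, 0 ≤ u → resFun (u + b) ≤ B * ((1 + u) ^ 2)⁻¹ :=
    ⟨_, by positivity, fun u hu => resFun_add_le b hu⟩
  set D := (2 + |a| + |b|) ^ 2 with hD
  refine ⟨A ^ 2 * (D * B ^ 2 + 2 * A * (D * B + 1)), fun u hu => ?_⟩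
  have hx := (resFun_pos (u + a)).le
  have hy := (resFun_pos (u + b)).le
  have hA := hA u hu
  have hB := hB u hu
  have h1 : (u + a + (u + b)) ^ 2 ≤ D * (1 + u) ^ 2 := by
    rw [hD, ← mul_pow]
    refine sq_le_sq.2 ((abs_le.2 ⟨?_, ?_⟩).trans (le_abs_self _)) <;>
      nlinarith [abs_nonneg a, abs_nonneg b, neg_abs_le a, neg_abs_le b, le_abs_self a,
        le_abs_self b, mul_nonneg (abs_nonneg a) hu, mul_nonneg (abs_nonneg b) hu]
  set s := ((1 + u) ^ 2)⁻¹ with hs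
  have hs0 : 0 < s := by positivity
  have hsu : (1 + u) ^ 2 * s = 1 := by rw [hs]; field_simp
  have h2 : (u + a + (u + b)) ^ 2 * resFun (u + b) ≤ D * B :=
    calc _ ≤ D * (1 + u) ^ 2 * (B * s) := by gcongr
      _ = D * B * ((1 + u) ^ 2 * s) := by ring
      _ = D * B := by rw [hsu, mul_one]
  have h2' : 0 ≤ (u + a + (u + b)) ^ 2 * resFun (u + b) := by positivity
  have h3 : |secondOrder (u + a) (u + b)| ≤ (A * s) ^ 2 * (D * B * (B * s) + 2 * (A * s) * (D * B + 1)) := by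
    rw [secondOrder, abs_mul, abs_of_nonneg (by positivity : 0 ≤ resFun (u + a) ^ 2)]
    have h4 : (u + a + (u + b)) ^ 2 * resFun (u + b) ^ 2 ≤ D * B * (B * s) := by
      rw [sq (resFun _), ← mul_assoc]
      gcongr
    have h5 : |(u + a + (u + b)) ^ 2 * resFun (u + b) - 1| ≤ D * B + 1 := by
      rw [abs_le]
      constructor <;> linarith
    gcongr
    refine (abs_add_le _ _).trans (add_le_add ?_ ?_)
    · rwa [abs_of_nonneg (by positivity)]
    · rw [abs_mul, abs_mul, abs_of_nonneg hx, abs_two]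
      gcongr
  rw [abs_mul, abs_of_nonneg hu]
  have h6 : (A * s) ^ 2 * (D * B * (B * s) + 2 * (A * s) * (D * B + 1))
      = A ^ 2 * (D * B ^ 2 + 2 * A * (D * B + 1)) * s ^ 3 := by ring
  rw [h6] at h3
  have h7 : u * s ≤ 1 := by
    rw [← hsu]
    gcongr
    nlinarith
  have h8 : ((1 + u) ^ 4)⁻¹ = s ^ 2 := by rw [hs, inv_pow, ← pow_mul]
  rw [h8]
  calc u * |secondOrder (u + a) (u + b)|
      ≤ u * (A ^ 2 * (D * B ^ 2 + 2 * A * (D * B + 1)) * s ^ 3) := by gcongr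
    _ = A ^ 2 * (D * B ^ 2 + 2 * A * (D * B + 1)) * s ^ 2 * (u * s) := by ring
    _ ≤ _ := mul_le_of_le_one_right (by positivity) h7

theorem integrable_comp_kin {Φ : ℝ → ℝ} (hΦ : Continuous Φ) {C : ℝ}
    (h : ∀ u, 0 ≤ u → |Φ u| ≤ C * ((1 + u) ^ 4)⁻¹) : Integrable fun p => Φ (kin p) :=
  (integrable_inv_one_add_kin_pow.const_mul C).mono' (hΦ.comp continuous_kin).aestronglyMeasurable
    (ae_of_all _ fun p => h _ (kin_nonneg p))

theorem integrableOn_sq_mul {Φ : ℝ → ℝ} (hΦ : Continuous Φ) {C : ℝ}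
    (h : ∀ u, 0 ≤ u → |Φ u| ≤ C * ((1 + u) ^ 4)⁻¹) :
    IntegrableOn (fun u => u ^ 2 * Φ u) (Set.Ioi 0) := by
  have h1 : Integrable fun u : ℝ => (1 + ‖u‖) ^ (-(2 : ℝ)) :=
    integrable_one_add_norm (by simp)
  refine (h1.const_mul C).integrableOn.mono' (by fun_prop) ?_
  refine (ae_restrict_iff' measurableSet_Ioi).2 (ae_of_all _ fun u (hu : 0 < u) => ?_)
  have h2 := h u hu.le
  rw [Real.norm_eq_abs, abs_mul, abs_of_nonneg (sq_nonneg u), Real.norm_of_nonneg hu.le,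
    Real.rpow_neg (by positivity), Real.rpow_two]
  calc u ^ 2 * |Φ u| ≤ (1 + u) ^ 2 * (C * ((1 + u) ^ 4)⁻¹) := by
        gcongr
        linarith
    _ = _ := by field_simp

theorem normSq_zero_eq {σ : Idx} {β a : ℝ}
    (hv : ∀ p, twoOp 0 β p (spinVec σ) = ((kin p + a : ℝ) : ℂ) • spinVec σ) :
    normSq 0 β σ = 1 / (128 * Real.pi ^ 3) *
      ∫ u in Set.Ioi (0 : ℝ), u ^ 2 * resFun (u + a) ^ 2 := by
  rw [← integral_kin fun u => resFun (u + a) ^ 2, normSq]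
  refine integral_congr_ae (ae_of_all _ fun p => ?_)
  dsimp only
  rw [resSq_apply_of_eigenvector (isSelfAdjoint_twoOp 0 β p) (hv p), norm_smul, spinVec_norm,
    mul_one, Complex.norm_real, Real.norm_eq_abs, sq_abs]

/-- `w₁` and `w₂` are the components of `W |σ⟩` with energies `kin p + b₁` and `kin p + b₂`. The
squared norm of each averages over spheres to `kin` times the number of its functionals divided by
six. -/
theorem integral_pertSecond_eq {ι κ : Type*} [Fintype ι] [Fintype κ] {σ : Idx} {β a b₁ b₂ : ℝ}
    {w₁ w₂ : E6 → C4} {e₁ : ι → E6} {e₂ : κ → E6}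
    (hv : ∀ p, twoOp 0 β p (spinVec σ) = ((kin p + a : ℝ) : ℂ) • spinVec σ)
    (hw : ∀ p, spinOrbit p (spinVec σ) = w₁ p + w₂ p)
    (hw₁ : ∀ p, twoOp 0 β p (w₁ p) = ((kin p + b₁ : ℝ) : ℂ) • w₁ p)
    (hw₂ : ∀ p, twoOp 0 β p (w₂ p) = ((kin p + b₂ : ℝ) : ℂ) • w₂ p)
    (h12 : ∀ p, inner ℂ (w₁ p) (w₂ p) = (0 : ℂ)) (he₁ : ∀ i, ‖e₁ i‖ = 1) (he₂ : ∀ i, ‖e₂ i‖ = 1)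
    (hn₁ : ∀ p, ‖w₁ p‖ ^ 2 = (2 * Real.pi) ^ 2 * ∑ i, ⟪e₁ i, p⟫ ^ 2)
    (hn₂ : ∀ p, ‖w₂ p‖ ^ 2 = (2 * Real.pi) ^ 2 * ∑ i, ⟪e₂ i, p⟫ ^ 2) :
    ∫ p, pertSecond β (spinVec σ) p = 1 / (128 * Real.pi ^ 3) *
      (Fintype.card ι / 6 * (∫ u in Set.Ioi (0 : ℝ), u ^ 2 * (u * secondOrder (u + a) (u + b₁)))
        + Fintype.card κ / 6 *
          ∫ u in Set.Ioi (0 : ℝ), u ^ 2 * (u * secondOrder (u + a) (u + b₂))) := by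
  have key : ∀ b, Integrable fun p => kin p * secondOrder (kin p + a) (kin p + b) := fun b => by
    obtain ⟨C, hC⟩ := exists_secondOrder_le a b
    exact integrable_comp_kin (continuous_id.mul (continuous_secondOrder a b)) hC
  obtain ⟨i1, j1⟩ := integral_norm_sq_mul (continuous_secondOrder a b₁) (key b₁) he₁ hn₁
  obtain ⟨i2, j2⟩ := integral_norm_sq_mul (continuous_secondOrder a b₂) (key b₂) he₂ hn₂
  have h1 : ∀ p, pertSecond β (spinVec σ) p = ‖w₁ p‖ ^ 2 * secondOrder (kin p + a) (kin p + b₁)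
      + ‖w₂ p‖ ^ 2 * secondOrder (kin p + a) (kin p + b₂) := fun p =>
    norm_sq_pertOne_add_inner_pertTwo (isSelfAdjoint_twoOp 0 β p) (isSelfAdjoint_spinOrbit p)
      (hv p) (hw p) (hw₁ p) (hw₂ p) (h12 p)
  simp only [h1]
  rw [integral_add i1 i2, j1, j2, integral_kin fun u => u * secondOrder (u + a) (u + b₁),
    integral_kin fun u => u * secondOrder (u + a) (u + b₂)]
  ring

/-- A vector of `ℝ⁶` along the `j`-th coordinate axes of the two particles. -/
def axisVec (c d : ℝ) (j : Fin 3) : E6 :=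
  WithLp.toLp 2 (EuclideanSpace.single j c, EuclideanSpace.single j d)

theorem norm_axisVec {c d : ℝ} (h : c ^ 2 + d ^ 2 = 1) (j : Fin 3) : ‖axisVec c d j‖ = 1 := by
  have h1 : ‖axisVec c d j‖ ^ 2 = 1 := by
    rw [WithLp.prod_norm_sq_eq_of_L2]
    simp [axisVec, h]
  exact (pow_eq_one_iff_of_nonneg (norm_nonneg _) two_ne_zero).1 h1

theorem inner_axisVec (c d : ℝ) (j : Fin 3) (p : E6) :
    ⟪axisVec c d j, p⟫ = c * p.fst j + d * p.snd j := by
  rw [WithLp.prod_inner_apply]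
  simp [axisVec, EuclideanSpace.inner_single_left]

theorem zFun_norm_sq (x y : E3) (c d : ℝ) : ‖(c : ℂ) * zFun x + d * zFun y‖ ^ 2
    = (2 * Real.pi) ^ 2 * ((c * x 0 + d * y 0) ^ 2 + (c * x 1 + d * y 1) ^ 2) := by
  have h1 : (c : ℂ) * zFun x + d * zFun y
      = ((2 * Real.pi * (c * x 0 + d * y 0) : ℝ) : ℂ)
        + ((2 * Real.pi * (c * x 1 + d * y 1) : ℝ) : ℂ) * Complex.I := by
    unfold zFun
    push_cast
    ring
  rw [h1, ← Complex.normSq_eq_norm_sq, Complex.normSq_add_mul_I]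
  ring

theorem twoOp_zero_triplet1 (β : ℝ) (p : E6) :
    twoOp 0 β p (spinVec .triplet1) = ((kin p + 2 * β : ℝ) : ℂ) • spinVec .triplet1 := by
  rw [spinVec_triplet1, twoOp_zero_mk4, smul_mk4]
  simp

theorem twoOp_zero_tripletm1 (β : ℝ) (p : E6) :
    twoOp 0 β p (spinVec .tripletm1) = ((kin p + -(2 * β) : ℝ) : ℂ) • spinVec .tripletm1 := by
  rw [spinVec_tripletm1, twoOp_zero_mk4, smul_mk4]
  simp

theorem twoOp_zero_triplet0 (β : ℝ) (p : E6) :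
    twoOp 0 β p (spinVec .triplet0) = ((kin p + 0 : ℝ) : ℂ) • spinVec .triplet0 := by
  rw [spinVec_triplet0, twoOp_zero_mk4, smul_mk4]
  simp

theorem twoOp_zero_singlet (β : ℝ) (p : E6) :
    twoOp 0 β p (spinVec .singlet) = ((kin p + 0 : ℝ) : ℂ) • spinVec .singlet := by
  rw [spinVec_singlet, twoOp_zero_mk4, smul_mk4]
  simp

theorem norm_sq_mk4_odd (x y : E3) {u v : ℂ} (hu : ‖u‖ = ‖zFun x‖) (hv : ‖v‖ = ‖zFun y‖) :
    ‖mk4 0 u v 0‖ ^ 2 = (2 * Real.pi) ^ 2 * (x 0 ^ 2 + x 1 ^ 2 + (y 0 ^ 2 + y 1 ^ 2)) := by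
  have h1 := zFun_norm_sq x y 1 0
  have h2 := zFun_norm_sq x y 0 1
  simp only [Complex.ofReal_one, Complex.ofReal_zero, one_mul, zero_mul, add_zero, zero_add]
    at h1 h2
  rw [norm_sq_mk4, hu, hv, h1, h2, norm_zero]
  ring

/-- From `↑↑` the coupling leads only to the Zeeman shift zero, so the second family is empty; the
first has four functionals, whence `4/6`. -/
theorem integral_pertSecond_triplet1 (β : ℝ) :
    ∫ p, pertSecond β (spinVec .triplet1) p = 1 / (128 * Real.pi ^ 3) * (2 / 3 *
      ∫ u in Set.Ioi (0 : ℝ), u ^ 2 * (u * secondOrder (u + 2 * β) (u + 0))) := by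
  rw [integral_pertSecond_eq (σ := .triplet1) (b₁ := 0) (b₂ := 0)
    (w₁ := fun p => mk4 0 (-(Complex.I * zFun p.snd)) (-(Complex.I * zFun p.fst)) 0)
    (w₂ := fun _ => 0)
    (e₁ := ![axisVec 0 1 0, axisVec 0 1 1, axisVec 1 0 0, axisVec 1 0 1])
    (e₂ := fun i : Fin 0 => i.elim0) (twoOp_zero_triplet1 β)]
  · norm_num
  · intro p
    rw [spinVec_triplet1, spinOrbit_mk4, add_zero]
    congr 1 <;> ring
  · intro p
    rw [twoOp_zero_mk4, smul_mk4]
    simp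
  · simp
  · simp
  · simp [Fin.forall_fin_succ, norm_axisVec]
  · simp
  · intro p
    rw [norm_sq_mk4_odd p.snd p.fst (by simp) (by simp)]
    simp only [Fin.sum_univ_four, Matrix.cons_val, inner_axisVec]
    ring
  · simp

theorem integral_pertSecond_tripletm1 (β : ℝ) :
    ∫ p, pertSecond β (spinVec .tripletm1) p = 1 / (128 * Real.pi ^ 3) * (2 / 3 *
      ∫ u in Set.Ioi (0 : ℝ), u ^ 2 * (u * secondOrder (u + -(2 * β)) (u + 0))) := by
  rw [integral_pertSecond_eq (σ := .tripletm1) (b₁ := 0) (b₂ := 0)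
    (w₁ := fun p => mk4 0 (Complex.I * star (zFun p.fst)) (Complex.I * star (zFun p.snd)) 0)
    (w₂ := fun _ => 0)
    (e₁ := ![axisVec 1 0 0, axisVec 1 0 1, axisVec 0 1 0, axisVec 0 1 1])
    (e₂ := fun i : Fin 0 => i.elim0) (twoOp_zero_tripletm1 β)]
  · norm_num
  · intro p
    rw [spinVec_tripletm1, spinOrbit_mk4, add_zero]
    congr 1 <;> ring
  · intro p
    rw [twoOp_zero_mk4, smul_mk4]
    simp
  · simp
  · simp
  · simp [Fin.forall_fin_succ, norm_axisVec]
  · simp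
  · intro p
    rw [norm_sq_mk4_odd p.fst p.snd (by simp) (by simp)]
    simp only [Fin.sum_univ_four, Matrix.cons_val, inner_axisVec]
    ring
  · simp

/-- The coefficient of `α²` for the states with magnetic quantum number zero. -/
theorem integral_pertSecond_of_eq_mk4 {σ : Idx} (β : ℝ) {ε : ℝ} (hε : ε ^ 2 = 1)
    (hv : ∀ p, twoOp 0 β p (spinVec σ) = ((kin p + 0 : ℝ) : ℂ) • spinVec σ)
    (hσ : spinVec σ = mk4 0 (Real.sqrt 2 : ℂ)⁻¹ (ε * (Real.sqrt 2 : ℂ)⁻¹) 0) :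
    ∫ p, pertSecond β (spinVec σ) p = 1 / (128 * Real.pi ^ 3) * (1 / 3 *
      ((∫ u in Set.Ioi (0 : ℝ), u ^ 2 * (u * secondOrder (u + 0) (u + 2 * β)))
        + ∫ u in Set.Ioi (0 : ℝ), u ^ 2 * (u * secondOrder (u + 0) (u + -(2 * β))))) := by
  -- `|σ⟩ = t (↑↓ + ε ↓↑)`, with `ε = 1` for the triplet and `ε = -1` for the singlet. The coupling
  -- leads to `↑↑` and to `↓↓`, with two functionals each, whence `2/6` twice.
  set t : ℝ := (Real.sqrt 2)⁻¹ with ht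
  have ht2 : t ^ 2 = 1 / 2 := by rw [ht, inv_pow, Real.sq_sqrt (by norm_num)]; norm_num
  have ht1 : (ε * t) ^ 2 + t ^ 2 = 1 := by rw [mul_pow, hε, ht2]; norm_num
  have ht1' : t ^ 2 + (ε * t) ^ 2 = 1 := by rw [add_comm]; exact ht1
  have htc : (Real.sqrt 2 : ℂ)⁻¹ = (t : ℂ) := by rw [ht]; push_cast; rfl
  rw [htc] at hσ
  rw [integral_pertSecond_eq (b₁ := 2 * β) (b₂ := -(2 * β))
    (w₁ := fun p => mk4 (Complex.I * star ((ε * t : ℝ) * zFun p.fst + (t : ℝ) * zFun p.snd)) 0 0 0)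
    (w₂ := fun p => mk4 0 0 0 (-Complex.I * ((t : ℝ) * zFun p.fst + (ε * t : ℝ) * zFun p.snd)))
    (e₁ := ![axisVec (ε * t) t 0, axisVec (ε * t) t 1])
    (e₂ := ![axisVec t (ε * t) 0, axisVec t (ε * t) 1]) hv]
  · norm_num
    ring
  · intro p
    rw [hσ, spinOrbit_mk4, mk4_add]
    simp only [star_add, star_mul', Complex.star_def, Complex.conj_ofReal]
    push_cast
    congr 1 <;> ring
  · intro p
    rw [twoOp_zero_mk4, smul_mk4]
    simp
  · intro p
    rw [twoOp_zero_mk4, smul_mk4]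
    simp
  · intro p
    simp [inner_mk4]
  · simp [Fin.forall_fin_succ, norm_axisVec, ht1]
  · simp [Fin.forall_fin_succ, norm_axisVec, ht1']
  · intro p
    rw [norm_sq_mk4, norm_mul, norm_star, mul_pow, zFun_norm_sq, Complex.norm_I, norm_zero]
    simp only [Fin.sum_univ_two, Matrix.cons_val, inner_axisVec]
    ring
  · intro p
    rw [norm_sq_mk4, norm_mul, mul_pow, zFun_norm_sq, norm_neg, Complex.norm_I, norm_zero]
    simp only [Fin.sum_univ_two, Matrix.cons_val, inner_axisVec]
    ring

end Coefficients

end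

end Rashba

/-! ### Antiderivatives and comparison with the stated coefficients -/

open MeasureTheory Filter Topology
open scoped SchwartzMap LineDeriv Laplacian Distributions

namespace Rashba

noncomputable section

/-! ### Evaluation of the one-dimensional integrals -/

section Evaluation

open Real (arctan log)

theorem hasDerivAt_resFun_add (c u : ℝ) :
    HasDerivAt (fun u => resFun (u + c)) (-(2 * (u + c) * resFun (u + c) ^ 2)) u := by
  have h1 : HasDerivAt (fun u : ℝ => (u + c) ^ 2 + 1) (2 * (u + c)) u := by
    simpa using (((hasDerivAt_id u).add_const c).pow 2).add_const 1
  have h2 := h1.inv (by positivity)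
  unfold resFun
  refine h2.congr_deriv ?_
  rw [inv_pow]
  ring

theorem hasDerivAt_arctan_add (c u : ℝ) :
    HasDerivAt (fun u => arctan (u + c)) (resFun (u + c)) u := by
  have h1 := ((hasDerivAt_id u).add_const c).arctan
  refine h1.congr_deriv ?_
  simp only [id, resFun]
  rw [add_comm, one_div, mul_one]

theorem hasDerivAt_log_add (c u : ℝ) :
    HasDerivAt (fun u => log ((u + c) ^ 2 + 1)) (2 * (u + c) * resFun (u + c)) u := by
  have h1 : HasDerivAt (fun u : ℝ => (u + c) ^ 2 + 1) (2 * (u + c)) u := by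
    simpa using (((hasDerivAt_id u).add_const c).pow 2).add_const 1
  exact h1.log (by positivity)

theorem tendsto_add_const_atTop (c : ℝ) : Tendsto (fun u : ℝ => u + c) atTop atTop :=
  tendsto_atTop_add_const_right _ c tendsto_id

theorem tendsto_mul_resFun : Tendsto (fun t => t * resFun t) atTop (𝓝 0) := by
  refine squeeze_zero' (g := fun t : ℝ => t⁻¹) ?_ ?_ tendsto_inv_atTop_zero
  · filter_upwards [eventually_gt_atTop 0] with t ht
    exact mul_nonneg ht.le (resFun_pos t).le
  · filter_upwards [eventually_gt_atTop 0] with t ht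
    unfold resFun
    rw [← div_eq_mul_inv, div_le_iff₀ (by positivity)]
    field_simp
    linarith

theorem tendsto_resFun : Tendsto resFun atTop (𝓝 0) := by
  refine squeeze_zero' (g := fun t : ℝ => t⁻¹) ?_ ?_ tendsto_inv_atTop_zero
  · exact Eventually.of_forall fun t => (resFun_pos t).le
  · filter_upwards [eventually_ge_atTop 1] with t ht
    unfold resFun
    exact inv_anti₀ (by linarith) (by nlinarith)

theorem tendsto_arctan_add (c : ℝ) : Tendsto (fun u => arctan (u + c)) atTop (𝓝 (Real.pi / 2)) :=
  (Real.tendsto_arctan_atTop.mono_right nhdsWithin_le_nhds).comp (tendsto_add_const_atTop c)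

theorem tendsto_resFun_add (c : ℝ) : Tendsto (fun u => resFun (u + c)) atTop (𝓝 0) :=
  tendsto_resFun.comp (tendsto_add_const_atTop c)

theorem tendsto_mul_resFun_add (c : ℝ) :
    Tendsto (fun u => (u + c) * resFun (u + c)) atTop (𝓝 0) :=
  tendsto_mul_resFun.comp (tendsto_add_const_atTop c)

/-- The logarithms in the antiderivatives diverge separately; they occur with total coefficient
zero, so only differences matter. -/
theorem tendsto_log_sub (c : ℝ) :
    Tendsto (fun u : ℝ => log ((u + c) ^ 2 + 1) - log ((u + 0) ^ 2 + 1)) atTop (𝓝 0) := by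
  have h1 : Tendsto (fun u => 1 + 2 * c * (u * resFun u) + c ^ 2 * resFun u) atTop (𝓝 1) := by
    have := ((tendsto_mul_resFun.const_mul (2 * c)).const_add 1).add
      (tendsto_resFun.const_mul (c ^ 2))
    simpa using this
  have h2 := (Real.continuousAt_log one_ne_zero).tendsto.comp h1
  rw [Real.log_one] at h2
  refine h2.congr fun u => ?_
  rw [← Real.log_div (by positivity) (by positivity)]
  simp only [Function.comp_apply]
  congr 1
  unfold resFun
  field_simp
  ring

theorem integral_Ioi_eq_sub {F f : ℝ → ℝ} {m : ℝ} (hF : ∀ u, HasDerivAt F (f u) u)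
    (hf : IntegrableOn f (Set.Ioi 0)) (hm : Tendsto F atTop (𝓝 m)) :
    ∫ u in Set.Ioi (0 : ℝ), f u = m - F 0 :=
  integral_Ioi_of_hasDerivAt_of_tendsto (hF 0).continuousAt.continuousWithinAt
    (fun u _ => hF u) hf hm

/-- An antiderivative of `u² (1 + (u + c)²)⁻²`. -/
def quadPrim (c u : ℝ) : ℝ :=
  1 / 2 * (1 + c ^ 2) * arctan (u + c)
    + (1 / 2 * (c ^ 2 - 1) * ((u + c) * resFun (u + c)) + c * resFun (u + c))

theorem hasDerivAt_quadPrim (c u : ℝ) :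
    HasDerivAt (quadPrim c) (u ^ 2 * resFun (u + c) ^ 2) u := by
  have h1 := hasDerivAt_resFun_add c u
  have h2 := ((hasDerivAt_id u).add_const c).mul h1
  have h3 := ((hasDerivAt_arctan_add c u).const_mul (1 / 2 * (1 + c ^ 2))).add
    ((h2.const_mul (1 / 2 * (c ^ 2 - 1))).add (h1.const_mul c))
  refine h3.congr_deriv ?_
  simp only [id, resFun]
  field_simp
  ring

theorem tendsto_quadPrim (c : ℝ) :
    Tendsto (quadPrim c) atTop (𝓝 (1 / 2 * (1 + c ^ 2) * (Real.pi / 2))) := by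
  have := ((tendsto_arctan_add c).const_mul (1 / 2 * (1 + c ^ 2))).add
    (((tendsto_mul_resFun_add c).const_mul (1 / 2 * (c ^ 2 - 1))).add
      ((tendsto_resFun_add c).const_mul c))
  rw [show 1 / 2 * (1 + c ^ 2) * (Real.pi / 2)
    = 1 / 2 * (1 + c ^ 2) * (Real.pi / 2) + (1 / 2 * (c ^ 2 - 1) * 0 + c * 0) by ring]
  exact this

theorem integral_sq_mul_resFun_sq (c : ℝ) : ∫ u in Set.Ioi (0 : ℝ), u ^ 2 * resFun (u + c) ^ 2
    = 1 / 2 * (-c + (Real.pi / 2 - arctan c) * (1 + c ^ 2)) := by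
  obtain ⟨C, hC⟩ := exists_resFun_sq_le c
  have hc := continuous_resFun
  rw [integral_Ioi_eq_sub (hasDerivAt_quadPrim c) (integrableOn_sq_mul (by fun_prop) hC)
    (tendsto_quadPrim c)]
  simp only [quadPrim, zero_add, resFun]
  field_simp
  ring

/-- The part without logarithm of an antiderivative of `u³ (1 + (u + c)²)⁻²`. -/
def cubePrim (c u : ℝ) : ℝ :=
  1 / 2 * resFun (u + c) - 3 * c / 2 * (arctan (u + c) - (u + c) * resFun (u + c))
    - 3 * c ^ 2 / 2 * resFun (u + c) - c ^ 3 / 2 * (arctan (u + c) + (u + c) * resFun (u + c))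

theorem hasDerivAt_cubePrim (c u : ℝ) : HasDerivAt (fun u => 1 / 2 * log ((u + c) ^ 2 + 1)
    + cubePrim c u) (u ^ 3 * resFun (u + c) ^ 2) u := by
  have h1 := hasDerivAt_resFun_add c u
  have h2 := ((hasDerivAt_id u).add_const c).mul h1
  have h3 := hasDerivAt_arctan_add c u
  have h4 := ((hasDerivAt_log_add c u).const_mul (1 / 2)).add
    ((((h1.const_mul (1 / 2)).sub ((h3.sub h2).const_mul (3 * c / 2))).sub
      (h1.const_mul (3 * c ^ 2 / 2))).sub ((h3.add h2).const_mul (c ^ 3 / 2)))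
  refine h4.congr_deriv ?_
  simp only [id, resFun]
  field_simp
  ring

theorem tendsto_cubePrim (c : ℝ) :
    Tendsto (cubePrim c) atTop (𝓝 (-(3 * c + c ^ 3) / 2 * (Real.pi / 2))) := by
  have h1 := tendsto_resFun_add c
  have h2 := tendsto_mul_resFun_add c
  have h3 := tendsto_arctan_add c
  have := (((h1.const_mul (1 / 2)).sub ((h3.sub h2).const_mul (3 * c / 2))).sub
      (h1.const_mul (3 * c ^ 2 / 2))).sub ((h3.add h2).const_mul (c ^ 3 / 2))
  rw [show -(3 * c + c ^ 3) / 2 * (Real.pi / 2) = 1 / 2 * 0 - 3 * c / 2 * (Real.pi / 2 - 0)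
    - 3 * c ^ 2 / 2 * 0 - c ^ 3 / 2 * (Real.pi / 2 + 0) by ring]
  exact this

theorem tendsto_cube_mul_resFun_sq (c : ℝ) :
    Tendsto (fun u => u ^ 3 * resFun (u + c) ^ 2) atTop (𝓝 0) := by
  have h1 := tendsto_resFun_add c
  have h2 := tendsto_mul_resFun_add c
  have h3 := (((h2.mul (h1.const_sub 1)).sub ((h1.mul (h1.const_sub 1)).const_mul (3 * c))).add
    ((h2.mul h1).const_mul (3 * c ^ 2))).sub ((h1.mul h1).const_mul (c ^ 3))
  simp only [mul_zero, sub_zero, add_zero, zero_mul] at h3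
  refine h3.congr fun u => ?_
  unfold resFun
  field_simp
  ring

theorem integrableOn_secondOrder (a b : ℝ) :
    IntegrableOn (fun u => u ^ 2 * (u * secondOrder (u + a) (u + b))) (Set.Ioi 0) := by
  obtain ⟨C, hC⟩ := exists_secondOrder_le a b
  exact integrableOn_sq_mul (continuous_id.mul (continuous_secondOrder a b)) hC

theorem cubePrim_zero (c : ℝ) : cubePrim c 0 =
    1 / 2 + c ^ 2 / 2 * (-1) + -(3 * c + c ^ 3) / 2 * arctan c := by
  simp only [cubePrim, zero_add, resFun]
  field_simp
  ring

/-- The second order coefficient when the perturbation lowers the energy by `c`. -/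
theorem sq_mul_integral_secondOrder_left (c : ℝ) :
    c ^ 2 * ∫ u in Set.Ioi (0 : ℝ), u ^ 2 * (u * secondOrder (u + c) (u + 0))
      = c ^ 2 * (1 - c * (Real.pi / 2 - arctan c)) + 1 / 2 * log (1 + c ^ 2) := by
  rw [← integral_const_mul]
  -- Put `f = resFun²`, `a = u + c`, `b = u`. From `c (a + b) = 1/resFun a - 1/resFun b` follows `c²
  -- secondOrder a b = f b - f a + c f' a`. The last term times `u³` is integrated by parts, which
  -- brings in `quadPrim`.
  have hF : ∀ u, HasDerivAt (fun u => (1 / 2 * log ((u + 0) ^ 2 + 1) + cubePrim 0 u)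
      - (1 / 2 * log ((u + c) ^ 2 + 1) + cubePrim c u)
      + c * (u ^ 3 * resFun (u + c) ^ 2 - 3 * quadPrim c u))
      (c ^ 2 * (u ^ 2 * (u * secondOrder (u + c) (u + 0)))) u := fun u => by
    have h1 := ((hasDerivAt_pow 3 u).mul ((hasDerivAt_resFun_add c u).pow 2)).sub
      ((hasDerivAt_quadPrim c u).const_mul 3)
    refine (((hasDerivAt_cubePrim 0 u).sub (hasDerivAt_cubePrim c u)).add
      (h1.const_mul c)).congr_deriv ?_
    simp only [secondOrder, resFun, add_zero, Pi.pow_apply, Nat.cast_ofNat, Nat.reduceSub, pow_one]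
    field_simp
    ring
  have hm : Tendsto (fun u => (1 / 2 * log ((u + 0) ^ 2 + 1) + cubePrim 0 u)
      - (1 / 2 * log ((u + c) ^ 2 + 1) + cubePrim c u)
      + c * (u ^ 3 * resFun (u + c) ^ 2 - 3 * quadPrim c u)) atTop
      (𝓝 (-(c ^ 3 * (Real.pi / 2)))) := by
    have h1 := (((tendsto_cubePrim 0).sub (tendsto_cubePrim c)).sub
      ((tendsto_log_sub c).const_mul (1 / 2))).add
      (((tendsto_cube_mul_resFun_sq c).sub ((tendsto_quadPrim c).const_mul 3)).const_mul c)
    rw [show -(c ^ 3 * (Real.pi / 2)) = -(3 * 0 + 0 ^ 3) / 2 * (Real.pi / 2)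
      - -(3 * c + c ^ 3) / 2 * (Real.pi / 2) - 1 / 2 * 0
      + c * (0 - 3 * (1 / 2 * (1 + c ^ 2) * (Real.pi / 2))) by ring]
    refine h1.congr fun u => ?_
    ring
  rw [integral_Ioi_eq_sub hF ((integrableOn_secondOrder c 0).const_mul _) hm]
  simp only [cubePrim_zero, quadPrim, zero_add, add_comm (c ^ 2) 1]
  rw [show resFun c = (1 + c ^ 2)⁻¹ by rw [resFun, add_comm]]
  norm_num
  field_simp
  ring

/-- The second order coefficient when the perturbation shifts the energy by `±c`. -/
theorem sq_mul_integral_secondOrder_right (c : ℝ) :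
    c ^ 2 * ((∫ u in Set.Ioi (0 : ℝ), u ^ 2 * (u * secondOrder (u + 0) (u + c)))
        + ∫ u in Set.Ioi (0 : ℝ), u ^ 2 * (u * secondOrder (u + 0) (u + -c)))
      = (3 * c + c ^ 3) * arctan c + c ^ 2 - log (1 + c ^ 2) := by
  rw [← integral_add (integrableOn_secondOrder 0 c) (integrableOn_secondOrder 0 (-c)),
    ← integral_const_mul]
  -- In the same identity for the shifts `c` and `-c` the derivative terms cancel, leaving `f (u +
  -- c) + f (u - c) - 2 f u` with `f = resFun²`.
  have hF : ∀ u, HasDerivAt (fun u => (1 / 2 * log ((u + c) ^ 2 + 1) + cubePrim c u)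
      + (1 / 2 * log ((u + -c) ^ 2 + 1) + cubePrim (-c) u)
      - 2 * (1 / 2 * log ((u + 0) ^ 2 + 1) + cubePrim 0 u))
      (c ^ 2 * (u ^ 2 * (u * secondOrder (u + 0) (u + c))
        + u ^ 2 * (u * secondOrder (u + 0) (u + -c)))) u := fun u => by
    refine (((hasDerivAt_cubePrim c u).add (hasDerivAt_cubePrim (-c) u)).sub
      ((hasDerivAt_cubePrim 0 u).const_mul 2)).congr_deriv ?_
    simp only [secondOrder, resFun, add_zero]
    field_simp
    ring
  have hm : Tendsto (fun u => (1 / 2 * log ((u + c) ^ 2 + 1) + cubePrim c u)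
      + (1 / 2 * log ((u + -c) ^ 2 + 1) + cubePrim (-c) u)
      - 2 * (1 / 2 * log ((u + 0) ^ 2 + 1) + cubePrim 0 u)) atTop (𝓝 0) := by
    have h1 := (((tendsto_cubePrim c).add (tendsto_cubePrim (-c))).sub
      ((tendsto_cubePrim 0).const_mul 2)).add
      (((tendsto_log_sub c).const_mul (1 / 2)).add ((tendsto_log_sub (-c)).const_mul (1 / 2)))
    rw [show -(3 * c + c ^ 3) / 2 * (Real.pi / 2)
      + -(3 * (-c) + (-c) ^ 3) / 2 * (Real.pi / 2) - 2 * (-(3 * 0 + 0 ^ 3) / 2 * (Real.pi / 2))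
      + (1 / 2 * 0 + 1 / 2 * 0) = 0 by ring] at h1
    refine h1.congr fun u => ?_
    ring
  have hint : IntegrableOn (fun u => u ^ 2 * (u * secondOrder (u + 0) (u + c))
      + u ^ 2 * (u * secondOrder (u + 0) (u + -c))) (Set.Ioi 0) :=
    (integrableOn_secondOrder 0 c).add (integrableOn_secondOrder 0 (-c))
  rw [integral_Ioi_eq_sub hF (hint.const_mul _) hm]
  simp only [cubePrim_zero, zero_add, add_comm (c ^ 2) 1, Real.arctan_neg, neg_sq]
  norm_num
  ring

theorem integral_secondOrder_zero :
    ∫ u in Set.Ioi (0 : ℝ), u ^ 2 * (u * secondOrder (u + 0) (u + 0)) = 3 / 2 := by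
  -- At equal energies `secondOrder` is `f''/2` with `f = resFun²`. Two integrations by parts
  -- against `u³` leave `3 u f`, an antiderivative of which is `-(3/2) resFun`.
  have hF : ∀ u, HasDerivAt (fun u => -2 * (u ^ 4 * resFun (u + 0) ^ 3)
      - 3 / 2 * (u ^ 2 * resFun (u + 0) ^ 2) - 3 / 2 * resFun (u + 0))
      (u ^ 2 * (u * secondOrder (u + 0) (u + 0))) u := fun u => by
    have h1 := hasDerivAt_resFun_add 0 u
    refine (((((hasDerivAt_pow 4 u).mul (h1.pow 3)).const_mul (-2)).sub
      (((hasDerivAt_pow 2 u).mul (h1.pow 2)).const_mul (3 / 2))).sub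
      (h1.const_mul (3 / 2))).congr_deriv ?_
    simp only [secondOrder, resFun, add_zero, Pi.pow_apply, Nat.cast_ofNat, Nat.reduceSub, pow_one]
    field_simp
    ring
  have hm : Tendsto (fun u => -2 * (u ^ 4 * resFun (u + 0) ^ 3)
      - 3 / 2 * (u ^ 2 * resFun (u + 0) ^ 2) - 3 / 2 * resFun (u + 0)) atTop (𝓝 0) := by
    have h1 := tendsto_resFun_add 0
    have h2 := (((h1.mul ((h1.const_sub 1).pow 2)).const_mul (-2)).sub
      ((h1.mul (h1.const_sub 1)).const_mul (3 / 2))).sub (h1.const_mul (3 / 2))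
    simp only [zero_mul, mul_zero, sub_zero] at h2
    refine h2.congr fun u => ?_
    simp only [resFun, add_zero]
    field_simp
    ring
  rw [integral_Ioi_eq_sub hF (integrableOn_secondOrder 0 0) hm]
  norm_num [resFun]

end Evaluation

end

end Rashba

open MeasureTheory Filter Topology
open scoped SchwartzMap LineDeriv Laplacian Distributions

namespace Rashba

noncomputable section

/-! ### The expansion of the normalization constant -/

section Expansion

open Real (arctan log)

/-- The argument of `2β + i` and `arctan (2β)` are complementary angles. -/
theorem theta_eq (β : ℝ) : theta β = Real.pi / 2 - arctan (2 * β) := by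
  have hr : 0 < √(1 + (2 * β) ^ 2) := Real.sqrt_pos.2 (by positivity)
  have h := Complex.arg_mul_cos_add_sin_mul_I hr
    (θ := Real.pi / 2 - arctan (2 * β)) ⟨by
      have := Real.arctan_lt_pi_div_two (2 * β); have := Real.pi_pos; linarith, by
      have := Real.neg_pi_div_two_lt_arctan (2 * β); linarith⟩
  rw [← h, theta]
  congr 1
  rw [← Complex.ofReal_cos, ← Complex.ofReal_sin, Real.cos_pi_div_two_sub,
    Real.sin_pi_div_two_sub, Real.sin_arctan, Real.cos_arctan]
  have hc : ((√(1 + (2 * β) ^ 2) : ℝ) : ℂ) ≠ 0 := by exact_mod_cast hr.ne'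
  generalize √(1 + (2 * β) ^ 2) = r at hc
  push_cast
  field_simp

theorem normSq_zero_eq_coeff0 (σ : Idx) (β : ℝ) : normSq 0 β σ = coeff0 σ β := by
  cases σ
  · rw [normSq_zero_eq (twoOp_zero_triplet1 β), integral_sq_mul_resFun_sq]
    norm_num [coeff0, kron, Idx.s, Idx.S, theta_eq]
    field_simp
    ring
  · rw [normSq_zero_eq (twoOp_zero_triplet0 β), integral_sq_mul_resFun_sq]
    norm_num [coeff0, kron, Idx.s, Idx.S, theta_eq]
    field_simp
    ring
  · rw [normSq_zero_eq (twoOp_zero_tripletm1 β), integral_sq_mul_resFun_sq]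
    norm_num [coeff0, kron, Idx.s, Idx.S, theta_eq]
    field_simp
    ring
  · rw [normSq_zero_eq (twoOp_zero_singlet β), integral_sq_mul_resFun_sq]
    norm_num [coeff0, kron, Idx.s, Idx.S, theta_eq]
    field_simp
    ring

/-- The second order coefficient, for a spin component with `S = 1` and `s = ±1`,
up to the factor `1 / (192 π³)`; here `c = ± 2β`. -/
def outerCoeff (c : ℝ) : ℝ :=
  1 - c * (Real.pi / 2 - arctan c) + 1 / 2 * (log (1 + c ^ 2) / c ^ 2)

/-- The second order coefficient, for a spin component with `s = 0`,
up to the factor `1 / (384 π³)`; here `c = 2β`. -/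
def innerCoeff (c : ℝ) : ℝ :=
  (3 + c ^ 2) * (arctan c / c) + 1 - log (1 + c ^ 2) / c ^ 2

theorem integral_secondOrder_left {c : ℝ} (hc : c ≠ 0) :
    ∫ u in Set.Ioi (0 : ℝ), u ^ 2 * (u * secondOrder (u + c) (u + 0)) = outerCoeff c := by
  have h := sq_mul_integral_secondOrder_left c
  refine mul_left_cancel₀ (pow_ne_zero 2 hc) (h.trans ?_)
  unfold outerCoeff
  field_simp

theorem integral_secondOrder_right {c : ℝ} (hc : c ≠ 0) :
    (∫ u in Set.Ioi (0 : ℝ), u ^ 2 * (u * secondOrder (u + 0) (u + c)))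
        + (∫ u in Set.Ioi (0 : ℝ), u ^ 2 * (u * secondOrder (u + 0) (u + -c)))
      = innerCoeff c := by
  have h := sq_mul_integral_secondOrder_right c
  refine mul_left_cancel₀ (pow_ne_zero 2 hc) (h.trans ?_)
  unfold innerCoeff
  field_simp

theorem coeff2_triplet1 {β : ℝ} (hβ : β ≠ 0) :
    coeff2 .triplet1 β = 1 / (192 * Real.pi ^ 3) * outerCoeff (2 * β) := by
  norm_num [coeff2, kron, Idx.s, Idx.S, theta_eq, outerCoeff]
  rw [show (2 * β) ^ 2 = 4 * β ^ 2 by ring]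
  field_simp
  ring

theorem coeff2_tripletm1 {β : ℝ} (hβ : β ≠ 0) :
    coeff2 .tripletm1 β = 1 / (192 * Real.pi ^ 3) * outerCoeff (-(2 * β)) := by
  norm_num [coeff2, kron, Idx.s, Idx.S, theta_eq, outerCoeff, Real.arctan_neg]
  rw [show (2 * β) ^ 2 = 4 * β ^ 2 by ring]
  field_simp
  ring

/-- With `r = √(1 + 4β²)` one has `cos θ = 2β/r` and `sin θ = 1/r`. The logarithms inside the
trigonometric bracket cancel, and the bracket with its prefactor `β r` equals `2β (1 + 4β²)(π - θ)`.
-/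
theorem coeff2_of_s_eq_zero {σ : Idx} (hS : σ.s = 0) {β : ℝ} (hβ : β ≠ 0) :
    coeff2 σ β = 1 / (384 * Real.pi ^ 3) * innerCoeff (2 * β) := by
  have hr : 0 < √(1 + (2 * β) ^ 2) := Real.sqrt_pos.2 (by positivity)
  norm_num [coeff2, kron, hS, theta_eq, innerCoeff, Real.cos_pi_div_two_sub,
    Real.sin_pi_div_two_sub, Real.sin_arctan, Real.cos_arctan]
  rw [show 4 * β ^ 2 = (2 * β) ^ 2 by ring]
  field_simp
  ring

theorem integral_pertSecond_eq_coeff2 (σ : Idx) {β : ℝ} (hβ : β ≠ 0) :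
    ∫ p, pertSecond β (spinVec σ) p = coeff2 σ β := by
  have h2 : 2 * β ≠ 0 := mul_ne_zero two_ne_zero hβ
  cases σ
  · rw [integral_pertSecond_triplet1, integral_secondOrder_left h2, coeff2_triplet1 hβ]
    ring
  · rw [integral_pertSecond_of_eq_mk4 β (ε := 1) (by norm_num) (twoOp_zero_triplet0 β)
      (by simpa using spinVec_triplet0), integral_secondOrder_right h2,
      coeff2_of_s_eq_zero (by rfl) hβ]
    ring
  · rw [integral_pertSecond_tripletm1, integral_secondOrder_left (neg_ne_zero.2 h2),
      coeff2_tripletm1 hβ]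
    ring
  · rw [integral_pertSecond_of_eq_mk4 β (ε := -1) (by norm_num) (twoOp_zero_singlet β)
      (by simpa using spinVec_singlet), integral_secondOrder_right h2,
      coeff2_of_s_eq_zero (by rfl) hβ]
    ring

/-- All four states agree: `2/3 · 3/2 = 1` for `s = ±1` and `1/3 · (3/2 + 3/2) = 1` for `s = 0`. -/
theorem integral_pertSecond_zero (σ : Idx) :
    ∫ p, pertSecond 0 (spinVec σ) p = 1 / (128 * Real.pi ^ 3) := by
  have h := integral_secondOrder_zero
  cases σ
  · rw [integral_pertSecond_triplet1, mul_zero, h]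
    ring
  · rw [integral_pertSecond_of_eq_mk4 0 (ε := 1) (by norm_num) (twoOp_zero_triplet0 0)
      (by simpa using spinVec_triplet0), mul_zero, neg_zero, h]
    ring
  · rw [integral_pertSecond_tripletm1, mul_zero, neg_zero, h]
    ring
  · rw [integral_pertSecond_of_eq_mk4 0 (ε := -1) (by norm_num) (twoOp_zero_singlet 0)
      (by simpa using spinVec_singlet), mul_zero, neg_zero, h]
    ring

theorem isBigO_normSq_of_pos (σ : Idx) {β : ℝ} (hβ : 0 < β) :
    (fun α : ℝ => normSq α β σ - (coeff0 σ β + α ^ 2 * coeff2 σ β))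
      =O[𝓝[≥] 0] fun α : ℝ => α ^ 4 := by
  have h := isBigO_normSq σ β
  rwa [normSq_zero_eq_coeff0, integral_pertSecond_eq_coeff2 σ hβ.ne'] at h

theorem tendsto_arctan_div : Tendsto (fun c => arctan c / c) (𝓝[≠] 0) (𝓝 1) := by
  have h := (Real.hasDerivAt_arctan 0).tendsto_slope_zero
  simpa [div_eq_inv_mul] using h

theorem tendsto_log_div : Tendsto (fun c => log (1 + c ^ 2) / c ^ 2) (𝓝[≠] 0) (𝓝 1) := by
  have h1 : HasDerivAt (fun x => log (1 + x)) 1 0 := by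
    simpa using ((hasDerivAt_id (0 : ℝ)).const_add 1).log (by norm_num)
  have h2 : Tendsto (fun c : ℝ => c ^ 2) (𝓝[≠] 0) (𝓝[≠] 0) := by
    refine tendsto_nhdsWithin_iff.2 ⟨?_, ?_⟩
    · have : Tendsto (fun c : ℝ => c ^ 2) (𝓝 0) (𝓝 (0 ^ 2)) := tendsto_id.pow 2
      rw [zero_pow two_ne_zero] at this
      exact this.mono_left nhdsWithin_le_nhds
    · filter_upwards [self_mem_nhdsWithin] with c hc using pow_ne_zero 2 hc
  have h := h1.tendsto_slope_zero.comp h2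
  simpa [div_eq_inv_mul, Function.comp_def] using h

theorem tendsto_outerCoeff : Tendsto outerCoeff (𝓝[≠] 0) (𝓝 (3 / 2)) := by
  have h1 : Tendsto (fun c : ℝ => 1 - c * (Real.pi / 2 - arctan c)) (𝓝[≠] 0) (𝓝 1) := by
    have : Continuous fun c : ℝ => 1 - c * (Real.pi / 2 - arctan c) := by fun_prop
    simpa using (this.tendsto 0).mono_left nhdsWithin_le_nhds
  have h := h1.add (tendsto_log_div.const_mul (1 / 2))
  rwa [show (1 : ℝ) + 1 / 2 * 1 = 3 / 2 by norm_num] at h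

theorem tendsto_innerCoeff : Tendsto innerCoeff (𝓝[≠] 0) (𝓝 3) := by
  have h1 : Tendsto (fun c : ℝ => 3 + c ^ 2) (𝓝[≠] 0) (𝓝 3) := by
    have : Continuous fun c : ℝ => 3 + c ^ 2 := by fun_prop
    simpa using (this.tendsto 0).mono_left nhdsWithin_le_nhds
  have h := ((h1.mul tendsto_arctan_div).add_const 1).sub tendsto_log_div
  norm_num at h
  exact h

/-- For `s = -1` the factor is `-2`, so zero is approached from the left; the target is therefore
the two-sided punctured neighbourhood. -/
theorem tendsto_mul_nhdsGT {k : ℝ} (hk : k ≠ 0) :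
    Tendsto (fun β => k * β) (𝓝[>] 0) (𝓝[≠] 0) := by
  refine tendsto_nhdsWithin_iff.2 ⟨?_, ?_⟩
  · have : Continuous fun β : ℝ => k * β := by fun_prop
    simpa using (this.tendsto 0).mono_left nhdsWithin_le_nhds
  · filter_upwards [self_mem_nhdsWithin] with β hβ using mul_ne_zero hk (ne_of_gt hβ)

theorem tendsto_coeff0 (σ : Idx) : Tendsto (coeff0 σ) (𝓝[>] 0) (𝓝 (coeff0 σ 0)) := by
  have : Continuous (coeff0 σ) := by
    unfold coeff0
    simp only [theta_eq]
    fun_prop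
  exact this.continuousAt.continuousWithinAt

/-- `3/2` divided by `192 π³` and `3` divided by `384 π³` are the same number, the value found
directly in `integral_pertSecond_zero`. -/
theorem tendsto_coeff2 (σ : Idx) :
    Tendsto (coeff2 σ) (𝓝[>] 0) (𝓝 (1 / (128 * Real.pi ^ 3))) := by
  have hi : ∀ σ : Idx, σ.s = 0 →
      Tendsto (coeff2 σ) (𝓝[>] 0) (𝓝 (1 / (128 * Real.pi ^ 3))) := fun σ hS => by
    have h := (tendsto_innerCoeff.comp (tendsto_mul_nhdsGT two_ne_zero)).const_mul
      (1 / (384 * Real.pi ^ 3))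
    rw [show 1 / (384 * Real.pi ^ 3) * 3 = 1 / (128 * Real.pi ^ 3) by field_simp; norm_num] at h
    refine h.congr' ?_
    filter_upwards [self_mem_nhdsWithin] with β hβ using (coeff2_of_s_eq_zero hS (ne_of_gt hβ)).symm
  have he : 1 / (192 * Real.pi ^ 3) * (3 / 2) = 1 / (128 * Real.pi ^ 3) := by
    field_simp
    norm_num
  cases σ
  · have h := (tendsto_outerCoeff.comp (tendsto_mul_nhdsGT two_ne_zero)).const_mul
      (1 / (192 * Real.pi ^ 3))
    rw [he] at h
    refine h.congr' ?_
    filter_upwards [self_mem_nhdsWithin] with β hβ using (coeff2_triplet1 (ne_of_gt hβ)).symm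
  · exact hi _ rfl
  · have h := (tendsto_outerCoeff.comp (tendsto_mul_nhdsGT
      (neg_ne_zero.2 (two_ne_zero (α := ℝ))))).const_mul (1 / (192 * Real.pi ^ 3))
    rw [he] at h
    refine h.congr' ?_
    filter_upwards [self_mem_nhdsWithin] with β hβ
    rw [coeff2_tripletm1 (ne_of_gt hβ), Function.comp_apply, neg_mul]
  · exact hi _ rfl

theorem isBigO_normSq_zero (σ : Idx) : ∃ c₀ c₂ : ℝ,
    Tendsto (coeff0 σ) (𝓝[>] 0) (𝓝 c₀) ∧ Tendsto (coeff2 σ) (𝓝[>] 0) (𝓝 c₂) ∧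
    (fun α : ℝ => normSq α 0 σ - (c₀ + α ^ 2 * c₂)) =O[𝓝[≥] 0] fun α : ℝ => α ^ 4 := by
  refine ⟨_, _, tendsto_coeff0 σ, tendsto_coeff2 σ, ?_⟩
  have h := isBigO_normSq σ 0
  rwa [normSq_zero_eq_coeff0, integral_pertSecond_zero] at h

end Expansion

end

end Rashba

theorem theorem5p2 (T : Rashba.VolEquiv) (hT : T = Rashba.comInv ∨ T = Rashba.com)
    (σ : Rashba.Idx) :
    (∀ α β : ℝ, 0 ≤ α → 0 ≤ β → ∀ (X : Rashba.E3) (N : ℝ), 0 < N →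
      Rashba.MemNegScale (Rashba.Hc T α β) Rashba.testToL2 4 (Rashba.psi σ X N) ∧
      ¬ Rashba.MemNegScale (Rashba.Hc T α β) Rashba.testToL2 3 (Rashba.psi σ X N)) ∧
    ∀ β : ℝ, 0 ≤ β → ∃ N : ℝ → ℝ,
      (∀ α : ℝ, 0 ≤ α → 0 < N α ∧ ∀ (X : Rashba.E3) (N' : ℝ), 0 < N' →
        (Rashba.IsNormalized (Rashba.Hc T α β) Rashba.testToL2 (Rashba.psi σ X N') ↔
          N' = N α)) ∧
      (0 < β →
        (fun α : ℝ => (N α ^ 2)⁻¹ - (Rashba.coeff0 σ β + α ^ 2 * Rashba.coeff2 σ β))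
          =O[𝓝[≥] 0] fun α : ℝ => α ^ 4) ∧
      (β = 0 → ∃ c₀ c₂ : ℝ,
        Tendsto (Rashba.coeff0 σ) (𝓝[>] 0) (𝓝 c₀) ∧
        Tendsto (Rashba.coeff2 σ) (𝓝[>] 0) (𝓝 c₂) ∧
        (fun α : ℝ => (N α ^ 2)⁻¹ - (c₀ + α ^ 2 * c₂))
          =O[𝓝[≥] 0] fun α : ℝ => α ^ 4) := by
  refine ⟨fun α β _ _ X N hN => ⟨Rashba.memNegScale_four α β T σ X hN,
    Rashba.not_memNegScale_three α β T σ X hN⟩, fun β hβ => ?_⟩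
  -- The inverse square of this constant is `normSq`, an integral in which `X` does not occur.
  refine ⟨fun α => (Real.sqrt (Rashba.normSq α β σ))⁻¹, fun α _ =>
    ⟨inv_pos.2 (Real.sqrt_pos.2 (Rashba.normSq_pos α β σ)),
      fun X N' hN' => Rashba.isNormalized_iff α β T σ X hN'⟩, fun hβ0 => ?_, ?_⟩
  · simp only [Rashba.inv_sq_inv_sqrt_normSq]
    exact Rashba.isBigO_normSq_of_pos σ hβ0
  · rintro rfl
    simp only [Rashba.inv_sq_inv_sqrt_normSq]
    exact Rashba.isBigO_normSq_zero σ
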